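/- Let $f:\mathbb R\to\mathbb R$ be smooth and let $u_0,u_1:\mathbb R^3\to\mathbb R$ be Schwartz functions. Consider on $\mathbb R^{3+1}$ the equation $$u_{tt}-\Delta u=f(u)\,(u_t^2-|\nabla u|^2),\qquad u(0)=u_0,\quad u_t(0)=u_1. \tag{1}$$ Then there is a function $u$ for which one of the following holds. (A) (Finite time blow-up.) There are $-\infty\le T_-<0<T_+\le\infty$, not both infinite, such that $u$ is a smooth solution of (1) on $\mathbb R^3\times(T_-,T_+)$, and for each $T\in\{T_-,T_+\}$ which is finite $u$ blows up at time $T$: there is $x_0\in\mathbb R^3$ such that, for every $\rho>0$, with $B=\{|x-x_0|\le\rho\}$ and with $t\to T$, $t\in(T_-,T_+)$, * $\|u(t)\|_{L^\infty(B)}\to\infty$; * if there is $K$ with $s f(s)\le K(1+s^2)$ for all $s\in\mathbb R$, then also $\|u(t)\|_{H^{3/2}(B)}\to\infty$; * if $K>0$ is such that $f\le K$ on $[0,\infty)$ and $f\ge -K$ on $(-\infty,0]$, then there are $C\in\mathbb R$ and $c>0$ such that for $t$ close to $T$ $$\|u(t)\|_{L^\infty(B)}\ge C+\tfrac1K\,\bigl|\ln|t-T|\bigr|,\qquad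 \|u(t)\|_{H^{3/2}(B)}\ge c\,\bigl|\ln|t-T|\bigr|^{1/2}.$$ Here $\|g\|_{H^{3/2}(B)}^2=\int_B |g|^2+\int_B|\nabla g|^2+\int_B\int_B \frac{|\nabla g(x)-\nabla g(y)|^2}{|x-y|^4}\,dx\,dy$. (B) (Global existence, dispersion and scattering.) $u$ is a smooth solution of (1) on $\mathbb R^{3+1}$, and * $u(t)$ is a Schwartz function for each $t\in\mathbb R$; * $\sup_{t\in\mathbb R}\|u(t)\|_{H^n(\mathbb R^3)}<\infty$ for each $n\ge0$; * for all $k,n\ge 0$ there is $C_{k,n}$ (which may depend on the solution) with $\|D_x^n\partial_t^k u(t)\|_{L^\infty}\le C_{k,n}|t|^{-1}$ for all $t\ne0$; * $u$ scatters: there is a smooth solution $w$ on $\mathbb R^{3+1}$ of the free wave equation $w_{tt}-\Delta w=0$, with Schwartz initial data, such that $\|u(t)-w(t)\|_{H^n}\to0$ and $\|u_t(t)-w_t(t)\|_{H^n}\to 0$ as $t\to\infty$ and as $t\to-\infty$, for each $n\ge0$. -/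

import Mathlib

open MeasureTheory Set Filter Topology
open scoped ENNReal ContDiff SchwartzMap

noncomputable section

/-- Three-dimensional Euclidean space. -/
abbrev R3 : Type := EuclideanSpace ℝ (Fin 3)

/-- `k`-th time derivative `∂ₜᵏ u (t, x)` of a function `u (t, x)`. -/
def timeDeriv (k : ℕ) (u : ℝ → R3 → ℝ) (t : ℝ) (x : R3) : ℝ :=
  iteratedDeriv k (fun s => u s x) t

/-- The wave operator `(u_tt - Δ u) (t, x)`. -/
def waveOp (u : ℝ → R3 → ℝ) (t : ℝ) (x : R3) : ℝ :=
  timeDeriv 2 u t x - Laplacian.laplacian (u t) x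

/-- `u` is a smooth (classical) solution on `I × ℝ³`, `I` an open set of times, of
`u_tt - Δ u = f(u) (u_t² - |∇u|²)`, with `u(0) = u₀`, `u_t(0) = u₁`. -/
structure IsSmoothSolution (f : ℝ → ℝ) (u₀ u₁ : R3 → ℝ) (I : Set ℝ) (u : ℝ → R3 → ℝ) :
    Prop where
  smooth : ContDiffOn ℝ ∞ (fun p : ℝ × R3 => u p.1 p.2) (I ×ˢ univ)
  equation : ∀ t ∈ I, ∀ x, waveOp u t x =
    f (u t x) * (timeDeriv 1 u t x ^ 2 - ‖gradient (u t) x‖ ^ 2)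
  initial : ∀ x, u 0 x = u₀ x
  initial_deriv : ∀ x, timeDeriv 1 u 0 x = u₁ x

/-- `w` is the smooth solution on `ℝ × ℝ³` of the free wave equation `w_tt - Δ w = 0`
with some initial data of Schwartz class. -/
structure IsFreeWave (w : ℝ → R3 → ℝ) : Prop where
  smooth : ContDiff ℝ ∞ (fun p : ℝ × R3 => w p.1 p.2)
  equation : ∀ t x, waveOp w t x = 0
  initial : ∃ φ : 𝓢(R3, ℝ), ∀ x, w 0 x = φ x
  initial_deriv : ∃ ψ : 𝓢(R3, ℝ), ∀ x, timeDeriv 1 w 0 x = ψ x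

/-- The `Hⁿ(ℝ³)` norm of a smooth function, as a number in `[0, ∞]`. -/
def sobolevNorm (n : ℕ) (g : R3 → ℝ) : ℝ≥0∞ :=
  (∑ k ∈ Finset.range (n + 1), ∫⁻ x, ‖iteratedFDeriv ℝ k g x‖ₑ ^ 2) ^ (1 / 2 : ℝ)

/-- The `L^∞` norm of `g` on the ball `|x - x₀| ≤ ρ`, in `[0, ∞]`. -/
def supNormBall (x₀ : R3) (ρ : ℝ) (g : R3 → ℝ) : ℝ≥0∞ :=
  eLpNorm g ∞ (volume.restrict (Metric.closedBall x₀ ρ))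

/-- The (Sobolev-Slobodeckij) `H^{3/2}` norm of a smooth function `g` on the ball
`|x - x₀| ≤ ρ`, in `[0, ∞]`: the square root of
`∫ |g|² + ∫ |∇g|² + ∬ |∇g(x) - ∇g(y)|² / |x - y|⁴ dx dy`. -/
def threeHalvesNormBall (x₀ : R3) (ρ : ℝ) (g : R3 → ℝ) : ℝ≥0∞ :=
  ((∫⁻ x in Metric.closedBall x₀ ρ, ‖g x‖ₑ ^ 2) +
    (∫⁻ x in Metric.closedBall x₀ ρ, ‖fderiv ℝ g x‖ₑ ^ 2) +
    ∫⁻ x in Metric.closedBall x₀ ρ, ∫⁻ y in Metric.closedBall x₀ ρ,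
      ‖fderiv ℝ g x - fderiv ℝ g y‖ₑ ^ 2 / ‖x - y‖ₑ ^ 4) ^ (1 / 2 : ℝ)

/-- The open time interval with (possibly infinite) end points `Tm`, `Tp`. -/
def timeInterval (Tm Tp : EReal) : Set ℝ := {t | Tm < (t : EReal) ∧ (t : EReal) < Tp}

/-- Blow-up of `u`, defined for times in `I`, at the finite end point `T` of `I`, near a
point `x₀`, in `L^∞_loc`; and in `H^{3/2}_loc` if `s f(s)` grows at most quadratically;
both with logarithmic rates if `f` is bounded above by `K` on `[0, ∞)` and bounded below
by `-K` on `(-∞, 0]`. -/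
def BlowsUpAt (f : ℝ → ℝ) (u : ℝ → R3 → ℝ) (I : Set ℝ) (T : ℝ) : Prop :=
  ∃ x₀ : R3, ∀ ρ : ℝ, 0 < ρ →
    Tendsto (fun t => supNormBall x₀ ρ (u t)) (𝓝[I] T) (𝓝 ⊤) ∧
    ((∃ K : ℝ, ∀ s, s * f s ≤ K * (1 + s ^ 2)) →
      Tendsto (fun t => threeHalvesNormBall x₀ ρ (u t)) (𝓝[I] T) (𝓝 ⊤)) ∧
    ∀ K : ℝ, 0 < K → (∀ s, 0 ≤ s → f s ≤ K) → (∀ s, s ≤ 0 → -K ≤ f s) →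
      (∃ C : ℝ, ∀ᶠ t in 𝓝[I] T,
        ENNReal.ofReal (C + K⁻¹ * |Real.log (|t - T|)|) ≤ supNormBall x₀ ρ (u t)) ∧
      ∃ c : ℝ, 0 < c ∧ ∀ᶠ t in 𝓝[I] T,
        ENNReal.ofReal (c * |Real.log (|t - T|)| ^ (1 / 2 : ℝ)) ≤
          threeHalvesNormBall x₀ ρ (u t)

/-- `u` is a smooth solution on `(Tm, Tp) × ℝ³`, where `-∞ ≤ Tm < 0 < Tp ≤ ∞`, at least one
of `Tm`, `Tp` is finite, and `u` blows up at each of them that is finite. -/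
def BlowsUpInFiniteTime (f : ℝ → ℝ) (u₀ u₁ : R3 → ℝ) (u : ℝ → R3 → ℝ) : Prop :=
  ∃ Tm Tp : EReal, Tm < 0 ∧ 0 < Tp ∧ (Tm ≠ ⊥ ∨ Tp ≠ ⊤) ∧
    IsSmoothSolution f u₀ u₁ (timeInterval Tm Tp) u ∧
    ∀ T : ℝ, ((T : EReal) = Tm ∨ (T : EReal) = Tp) →
      BlowsUpAt f u (timeInterval Tm Tp) T

/-- `u` scatters: there is a free wave `w` such that `u - w` and its time derivative tend to
zero in every `Hⁿ`, as `t → +∞` and as `t → -∞`. -/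
def Scatters (u : ℝ → R3 → ℝ) : Prop :=
  ∃ w : ℝ → R3 → ℝ, IsFreeWave w ∧ ∀ n : ℕ, ∀ l ∈ ({atTop, atBot} : Set (Filter ℝ)),
    Tendsto (fun t => sobolevNorm n (fun x => u t x - w t x)) l (𝓝 0) ∧
    Tendsto (fun t => sobolevNorm n (fun x => timeDeriv 1 u t x - timeDeriv 1 w t x))
      l (𝓝 0)

end

/-!
The equation is linearized by a change of variable of the unknown, found by Nirenberg. Let `Φ` be
the function with `Φ(0) = 0`, `Φ'(0) = 1` and `Φ'' + f Φ' = 0`, that is, `Φ'(s) = exp (-∫₀ˢ f)`. It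
is a diffeomorphism of the line onto an open interval `J` around `0`, and the second order part of
the chain rule for the wave operator is a multiple of the null form (`dalembertian_comp`). Hence `u`
solves the nonlinear equation exactly if `V = Φ(u)` is a free wave with values in `J`. The data of
`V` are `Φ(u₀)` and `Φ'(u₀) u₁`, which are Schwartz functions, so `V` exists for all times, and the
solution is `u = Φ⁻¹(V)` for as long as `V` has values in `J` (`isSmoothSolution_nirenbergInv`).

*The free wave.* It is given by Kirchhoff's formula. The spherical mean satisfies the wave equation
because the Laplacian of the sphere is the sum of the squares of the generators of rotations, each
of which integrates to zero by rotation invariance (`integral_spherical_laplacian`). Comparing the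
mean over a sphere with the mean over a shell of thickness one bounds all derivatives of `V` by each
of the weights `(1 + |t|)⁻¹ (1 + ||t| - |x||)⁻ᵐ` (`dominatedBy_kirchhoff`). These bounds are stable
under multiplication and under composition with smooth functions vanishing at zero
(`DominatedBy.comp`), and they contain the decay in time, the rapid decay in space, and the
uniform Sobolev bounds.

*Global existence.* If `V` always has values in `J`, then, since `V` tends to zero at infinity of
space-time, its values stay in a compact subset of `J`. There `Φ⁻¹` may be replaced by a function
`Ψ` that is smooth on the whole line, so `u = Ψ(V)` inherits the bounds of `V`. Since `Ψ(V) - V` is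
quadratic in `V`, its Sobolev norms tend to zero, and `u` scatters to `V` (`scatters_comp`).

*Blow-up.* Otherwise the times at which `V` leaves `J` form a compact set which does not contain
zero, and its points nearest to zero are the end points of the maximal interval. By the symmetry
`u ↦ -u` it suffices to consider a time `T` and a point `x₀` at which `V` reaches the upper end `b`
of `J`. Since `V` is Lipschitz there, `b - Φ(u(t, x)) ≤ M (|t - T| + |x - x₀|)`, and as `Φ`
approaches `b` at infinity at a rate controlled by `f`, this bounds `u` from below: by
`K⁻¹ ln (1 / |t - T|) + C` at `x₀` if `f ≤ K` on the positive half line, and by a multiple of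
`√(ln (1 / r))` on the ball of radius `r ≥ |t - T|` if `s f(s)` grows at most quadratically.

*The `H^{3/2}` norm.* The average `m(r)` of `u(t)` over the ball of radius `r` around `x₀` satisfies
`∫ r m'(r)² dr ≤ C ‖u(t)‖²` (`lintegral_deriv_ballIntegral_le`), as `m'(r)` is bounded by the mean
oscillation of the gradient on that ball. A large value of `m` at `r = |t - T|` thus forces a large
norm (`sub_le_energy_add_log`). Under the weaker growth condition a lower bound at the single
radius `|t - T|` is not sufficient, but the lower bounds at all radii between `|t - T|` and a fixed
one force the norm to be at least of order `√(ln ln (1 / |t - T|))` (`loglog_le_energy`), by an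
inequality of Hardy's type.
-/

/-! ### Smooth functions dominated by a weight -/

section Dominated

variable {P : Type*} [NormedAddCommGroup P] [NormedSpace ℝ P]

/-- `U` is smooth, and each of its iterated derivatives is bounded pointwise by a multiple of the
weight `δ`. -/
structure DominatedBy (δ : P → ℝ) (U : P → ℝ) : Prop where
  smooth : ContDiff ℝ ∞ U
  bound : ∀ N : ℕ, ∃ C : ℝ, ∀ p, ‖iteratedFDeriv ℝ N U p‖ ≤ C * δ p

/-- The directional derivative of `U` along the fixed vector `e`, as a function. -/
noncomputable def dirDeriv (e : P) (U : P → ℝ) (p : P) : ℝ := fderiv ℝ U p e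

theorem ContDiff.dirDeriv {U : P → ℝ} (hU : ContDiff ℝ ∞ U) (e : P) :
    ContDiff ℝ ∞ (dirDeriv e U) :=
  (hU.fderiv_right (m := ∞) (by simp)).clm_apply contDiff_const

theorem DominatedBy.exists_uniform_bound {δ U : P → ℝ} (hδ : ∀ p, 0 ≤ δ p)
    (hU : DominatedBy δ U) (N : ℕ) :
    ∃ A : ℝ, 1 ≤ A ∧ ∀ i ≤ N, ∀ p, ‖iteratedFDeriv ℝ i U p‖ ≤ A * δ p := by
  choose C hC using hU.bound
  refine ⟨1 + ∑ i ∈ Finset.range (N + 1), |C i|, ?_, fun i hi p => (hC i p).trans ?_⟩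
  · linarith [Finset.sum_nonneg (s := Finset.range (N + 1)) (f := fun i => |C i|)
      fun i _ => abs_nonneg _]
  · refine mul_le_mul_of_nonneg_right ?_ (hδ p)
    have := Finset.single_le_sum (f := fun i => |C i|) (fun i _ => abs_nonneg _)
      (Finset.mem_range.2 (Nat.lt_succ_of_le hi))
    linarith [le_abs_self (C i)]

theorem DominatedBy.dirDeriv {δ U : P → ℝ} (hU : DominatedBy δ U) (e : P) :
    DominatedBy δ (dirDeriv e U) where
  smooth := hU.smooth.dirDeriv e
  bound N := by
    obtain ⟨C, hC⟩ := hU.bound (N + 1)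
    refine ⟨‖e‖ * C, fun p => ?_⟩
    have h := norm_iteratedFDeriv_clm_apply_const (𝕜 := ℝ) (n := N) (N := ∞) (x := p) (c := e)
      (hU.smooth.fderiv_right (m := ∞) (by simp)).contDiffAt (by exact_mod_cast le_top)
    rw [norm_iteratedFDeriv_fderiv] at h
    calc _ ≤ ‖e‖ * ‖iteratedFDeriv ℝ (N + 1) U p‖ := h
      _ ≤ ‖e‖ * (C * δ p) := by gcongr; exact hC p
      _ = _ := by ring

theorem DominatedBy.add {δ U V : P → ℝ} (hU : DominatedBy δ U) (hV : DominatedBy δ V) :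
    DominatedBy δ (fun p => U p + V p) where
  smooth := hU.smooth.add hV.smooth
  bound N := by
    obtain ⟨C, hC⟩ := hU.bound N
    obtain ⟨D, hD⟩ := hV.bound N
    refine ⟨C + D, fun p => ?_⟩
    have h : iteratedFDeriv ℝ N (U + V) p = _ := iteratedFDeriv_add_apply
      (hU.smooth.contDiffAt.of_le (by exact_mod_cast le_top))
      (hV.smooth.contDiffAt.of_le (by exact_mod_cast le_top))
    change ‖iteratedFDeriv ℝ N (U + V) p‖ ≤ _
    rw [h, add_mul]
    exact (norm_add_le _ _).trans (add_le_add (hC p) (hD p))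

theorem DominatedBy.mul {δ η U V : P → ℝ} (hδ : ∀ p, 0 ≤ δ p) (hη : ∀ p, 0 ≤ η p)
    (hU : DominatedBy δ U) (hV : DominatedBy η V) :
    DominatedBy (fun p => δ p * η p) (fun p => U p * V p) where
  smooth := hU.smooth.mul hV.smooth
  bound N := by
    obtain ⟨A, -, hA⟩ := hU.exists_uniform_bound hδ N
    obtain ⟨B, -, hB⟩ := hV.exists_uniform_bound hη N
    refine ⟨∑ i ∈ Finset.range (N + 1), (N.choose i : ℝ) * A * B, fun p => ?_⟩
    refine (norm_iteratedFDeriv_mul_le hU.smooth hV.smooth p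
      (by exact_mod_cast le_top)).trans ?_
    rw [Finset.sum_mul]
    refine Finset.sum_le_sum fun i hi => ?_
    have hi' : i ≤ N := Nat.lt_succ_iff.1 (Finset.mem_range.1 hi)
    calc _ ≤ (N.choose i : ℝ) * (A * δ p) * (B * η p) := by
          gcongr
          · exact mul_nonneg (Nat.cast_nonneg _) ((norm_nonneg _).trans (hA i hi' p))
          · exact hA i hi' p
          · exact hB _ (Nat.sub_le _ _) p
      _ = _ := by ring

/-- On a bounded range, a smooth function vanishing at zero is bounded by its argument, and the
Faà di Bruno estimate with `D = A δ ^ (1 / N)` bounds the derivatives of the composition. -/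
theorem DominatedBy.comp {δ U : P → ℝ} (hδ : ∀ p, 0 ≤ δ p) (hδ1 : ∀ p, δ p ≤ 1)
    (hU : DominatedBy δ U) {Ψ : ℝ → ℝ} (hΨ : ContDiff ℝ ∞ Ψ) (hΨ0 : Ψ 0 = 0) :
    DominatedBy δ (fun p => Ψ (U p)) where
  smooth := hΨ.comp hU.smooth
  bound N := by
    obtain ⟨A, hA1, hA⟩ := hU.exists_uniform_bound hδ N
    have hUb : ∀ p, U p ∈ Icc (-A) A := fun p => by
      have h := hA 0 (Nat.zero_le _) p
      rw [norm_iteratedFDeriv_zero, Real.norm_eq_abs] at h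
      exact abs_le.1 (h.trans (mul_le_of_le_one_right (by linarith) (hδ1 p)))
    rcases Nat.eq_zero_or_pos N with rfl | hN
    · have hc : Continuous (deriv Ψ) := hΨ.continuous_deriv (by simp)
      obtain ⟨B, hB⟩ := (isCompact_Icc (a := -A) (b := A)).exists_bound_of_continuousOn
        hc.continuousOn
      have hB0 : 0 ≤ B := (norm_nonneg _).trans (hB 0 ⟨by linarith, by linarith⟩)
      refine ⟨B * A, fun p => ?_⟩
      have h := (convex_Icc (-A) A).norm_image_sub_le_of_norm_deriv_le
        (fun x _ => (hΨ.differentiable (by simp)) x) hB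
        (x := 0) (y := U p) ⟨by linarith, by linarith⟩ (hUb p)
      rw [hΨ0, sub_zero, sub_zero] at h
      rw [norm_iteratedFDeriv_zero]
      refine h.trans ?_
      rw [mul_assoc]
      refine mul_le_mul_of_nonneg_left ?_ hB0
      simpa using hA 0 le_rfl p
    · have hb : ∀ i : ℕ, ∃ B, ∀ s ∈ Icc (-A) A, ‖iteratedFDeriv ℝ i Ψ s‖ ≤ B := fun i =>
        isCompact_Icc.exists_bound_of_continuousOn
          (hΨ.continuous_iteratedFDeriv (by exact_mod_cast le_top)).continuousOn
      choose B hB using hb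
      have hBle : ∀ i ≤ N, B i ≤ ∑ j ∈ Finset.range (N + 1), |B j| := fun i hi =>
        (le_abs_self _).trans (Finset.single_le_sum (f := fun j => |B j|)
          (fun j _ => abs_nonneg _) (Finset.mem_range.2 (Nat.lt_succ_of_le hi)))
      refine ⟨N.factorial * (∑ j ∈ Finset.range (N + 1), |B j|) * A ^ N, fun p => ?_⟩
      have hN0 : (N : ℝ) ≠ 0 := by exact_mod_cast hN.ne'
      have h := norm_iteratedFDeriv_comp_le hΨ hU.smooth (n := N) (by exact_mod_cast le_top) p
        (C := ∑ j ∈ Finset.range (N + 1), |B j|) (D := A * δ p ^ ((N : ℝ)⁻¹))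
        (fun i hi => (hB i _ (hUb p)).trans (hBle i hi)) (fun i hi1 hi => by
          refine (hA i hi p).trans ?_
          rw [mul_pow]
          refine mul_le_mul ?_ ?_ (hδ p) (by positivity)
          · exact le_self_pow₀ hA1 (by omega)
          · rw [← Real.rpow_natCast, ← Real.rpow_mul (hδ p)]
            rcases (hδ p).eq_or_lt with h0 | h0
            · rw [← h0]; exact Real.rpow_nonneg le_rfl _
            · have := Real.rpow_le_rpow_of_exponent_ge h0 (hδ1 p)
                (y := 1) (z := (N : ℝ)⁻¹ * i) (by
                  rw [inv_mul_le_iff₀ (by positivity), mul_one]; exact_mod_cast hi)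
              simpa using this)
      refine h.trans (le_of_eq ?_)
      rw [mul_pow, ← Real.rpow_natCast (δ p ^ _), ← Real.rpow_mul (hδ p), inv_mul_cancel₀ hN0,
        Real.rpow_one]
      ring

/-- Second directional derivatives of a smooth function commute. -/
theorem dirDeriv_comm {U : P → ℝ} (hU : ContDiff ℝ ∞ U) (a b : P) :
    dirDeriv a (dirDeriv b U) = dirDeriv b (dirDeriv a U) := by
  have key : ∀ a b : P, ∀ p, dirDeriv a (dirDeriv b U) p = fderiv ℝ (fderiv ℝ U) p a b := by
    intro a b p
    have hd : DifferentiableAt ℝ (fderiv ℝ U) p :=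
      (hU.fderiv_right (m := ∞) (by simp)).differentiable (by simp) p
    change fderiv ℝ (fun q => fderiv ℝ U q b) p a = _
    rw [fderiv_clm_apply hd (differentiableAt_const b)]
    simp
  ext p
  rw [key, key]
  exact (hU.contDiffAt.isSymmSndFDerivAt
    (by simpa using WithTop.coe_le_coe.2 (le_top : (2 : ℕ∞) ≤ ⊤))).eq a b

end Dominated

/-- Restricting a function of space-time to a time slice does not increase the norms of its
derivatives. -/
theorem norm_iteratedFDeriv_slice_le {U : ℝ × R3 → ℝ} (hU : ContDiff ℝ ∞ U) (n : ℕ) (t : ℝ)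
    (x : R3) : ‖iteratedFDeriv ℝ n (fun y => U (t, y)) x‖ ≤ ‖iteratedFDeriv ℝ n U (t, x)‖ := by
  have h1 : (fun y => U (t, y)) =
      (fun q => U (q + (t, 0))) ∘ (ContinuousLinearMap.inr ℝ ℝ R3) := by
    ext y; simp
  have hs : ContDiff ℝ ∞ (fun q => U (q + (t, 0))) := hU.comp (contDiff_id.add contDiff_const)
  rw [h1, ContinuousLinearMap.iteratedFDeriv_comp_right _ hs _ (by exact_mod_cast le_top),
    iteratedFDeriv_comp_add_right]
  refine (ContinuousMultilinearMap.norm_compContinuousLinearMap_le _ _).trans ?_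
  have : ‖ContinuousLinearMap.inr ℝ ℝ R3‖ ≤ 1 := ContinuousLinearMap.norm_inr_le_one ℝ ℝ R3
  simp only [ContinuousLinearMap.inr_apply, Prod.mk_add_mk, zero_add, add_zero]
  exact mul_le_of_le_one_right (norm_nonneg _) (Finset.prod_le_one (fun _ _ => norm_nonneg _)
    fun _ _ => this)

/-- The `k`-th time derivative as an iterated directional derivative in space-time. -/
theorem timeDeriv_eq_iterate_dirDeriv {U : ℝ × R3 → ℝ} (hU : ContDiff ℝ ∞ U) (k : ℕ) (t : ℝ)
    (x : R3) : timeDeriv k (fun s y => U (s, y)) t x =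
      (dirDeriv ((1 : ℝ), (0 : R3)))^[k] U (t, x) := by
  unfold timeDeriv
  induction k generalizing U with
  | zero => simp
  | succ k ih =>
    rw [iteratedDeriv_succ', Function.iterate_succ_apply, ← ih (hU.dirDeriv _)]
    congr 1
    ext s
    have h1 : HasDerivAt (fun s : ℝ => (s, x)) ((1 : ℝ), (0 : R3)) s :=
      (hasDerivAt_id s).prodMk (hasDerivAt_const s x)
    exact ((hU.differentiable (by simp) (s, x)).hasFDerivAt.comp_hasDerivAt s h1).deriv

theorem DominatedBy.iterate_dirDeriv {δ U : ℝ × R3 → ℝ} (hU : DominatedBy δ U) (e : ℝ × R3)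
    (k : ℕ) : DominatedBy δ ((_root_.dirDeriv e)^[k] U) := by
  induction k generalizing U with
  | zero => exact hU
  | succ k ih => exact ih (hU.dirDeriv e)

/-! ### Integrals depending smoothly on a parameter -/

/-- A continuous function need only be bounded on the compact set which carries the measure. -/
theorem integrable_of_continuous_of_compact {V : Type*} [TopologicalSpace V]
    [SecondCountableTopology V] [MeasurableSpace V] [OpensMeasurableSpace V]
    {μ : Measure V} [IsFiniteMeasure μ] {K : Set V} {E : Type*} [NormedAddCommGroup E]
    (hK : IsCompact K) (hμ : ∀ᵐ θ ∂μ, θ ∈ K) {g : V → E} (hg : Continuous g) : Integrable g μ := by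
  obtain ⟨C, hC⟩ := hK.exists_bound_of_continuousOn hg.continuousOn
  exact Integrable.of_bound hg.aestronglyMeasurable C (hμ.mono fun θ hθ => hC θ hθ)

section Parametric

universe w

variable {V : Type*} [NormedAddCommGroup V] [NormedSpace ℝ V]
  {P : Type w} [NormedAddCommGroup P] [NormedSpace ℝ P]

/-- The derivative of a function on `V × P` in the second variable. -/
noncomputable def fderivSnd {E : Type*} [NormedAddCommGroup E] [NormedSpace ℝ E] (G : V × P → E)
    (q : V × P) : P →L[ℝ] E :=
  (fderiv ℝ G q).comp (ContinuousLinearMap.inr ℝ V P)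

theorem contDiff_fderivSnd {E : Type*} [NormedAddCommGroup E] [NormedSpace ℝ E]
    {G : V × P → E} (hG : ContDiff ℝ ∞ G) : ContDiff ℝ ∞ (fderivSnd G) :=
  (hG.fderiv_right (m := ∞) (by simp)).clm_comp contDiff_const

theorem hasFDerivAt_fderivSnd {E : Type*} [NormedAddCommGroup E] [NormedSpace ℝ E]
    {G : V × P → E} (hG : ContDiff ℝ ∞ G) (θ : V) (p : P) :
    HasFDerivAt (fun p => G (θ, p)) (fderivSnd G (θ, p)) p :=
  (hG.differentiable (by simp) (θ, p)).hasFDerivAt.comp p (hasFDerivAt_prodMk_right θ p)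

variable [MeasurableSpace V] [BorelSpace V]
  [SecondCountableTopology V] {μ : Measure V} [IsFiniteMeasure μ] {K : Set V} [ProperSpace P]

theorem hasFDerivAt_parametric_integral {E : Type*} [NormedAddCommGroup E] [NormedSpace ℝ E]
    (hK : IsCompact K) (hμ : ∀ᵐ θ ∂μ, θ ∈ K) {G : V × P → E}
    (hG : ContDiff ℝ ∞ G) (p : P) :
    HasFDerivAt (fun p => ∫ θ, G (θ, p) ∂μ) (∫ θ, fderivSnd G (θ, p) ∂μ) p := by
  have hc : Continuous (fderivSnd G) := (contDiff_fderivSnd hG).continuous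
  obtain ⟨C, hC⟩ := (hK.prod (isCompact_closedBall p 1)).exists_bound_of_continuousOn
    hc.continuousOn
  refine hasFDerivAt_integral_of_dominated_of_fderiv_le (bound := fun _ => C)
    (Metric.closedBall_mem_nhds p one_pos) (Eventually.of_forall fun q => ?_) ?_ ?_ ?_
    (integrable_const C) (Eventually.of_forall fun θ q _ => hasFDerivAt_fderivSnd hG θ q)
  · exact (hG.continuous.comp (by fun_prop)).aestronglyMeasurable
  · exact integrable_of_continuous_of_compact hK hμ (hG.continuous.comp (by fun_prop))
  · exact (hc.comp (by fun_prop)).aestronglyMeasurable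
  · exact hμ.mono fun θ hθ q hq => hC (θ, q) ⟨hθ, hq⟩

theorem fderiv_parametric_integral {E : Type*} [NormedAddCommGroup E] [NormedSpace ℝ E]
    (hK : IsCompact K) (hμ : ∀ᵐ θ ∂μ, θ ∈ K) {G : V × P → E}
    (hG : ContDiff ℝ ∞ G) :
    fderiv ℝ (fun p => ∫ θ, G (θ, p) ∂μ) = fun p => ∫ θ, fderivSnd G (θ, p) ∂μ :=
  funext fun p => (hasFDerivAt_parametric_integral hK hμ hG p).fderiv

/-- An integral over a compactly supported finite measure of an integrand that is jointly smooth
in the variable of integration and the parameter depends smoothly on the parameter. -/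
theorem contDiff_parametric_integral (hK : IsCompact K) (hμ : ∀ᵐ θ ∂μ, θ ∈ K) {E : Type w}
    [NormedAddCommGroup E] [NormedSpace ℝ E] {G : V × P → E} (hG : ContDiff ℝ ∞ G) :
    ContDiff ℝ ∞ (fun p => ∫ θ, G (θ, p) ∂μ) := by
  rw [contDiff_infty]
  intro n
  induction n generalizing E with
  | zero =>
    exact contDiff_zero.2 (Differentiable.continuous (𝕜 := ℝ) fun p =>
      (hasFDerivAt_parametric_integral hK hμ hG p).differentiableAt)
  | succ n ih =>
    have := contDiff_succ_iff_fderiv (𝕜 := ℝ) (n := n) (f := fun p => ∫ θ, G (θ, p) ∂μ)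
    push_cast
    refine this.2 ⟨fun p => (hasFDerivAt_parametric_integral hK hμ hG p).differentiableAt,
      by simp, ?_⟩
    rw [fderiv_parametric_integral hK hμ hG]
    exact ih (contDiff_fderivSnd hG)

theorem norm_iteratedFDeriv_parametric_integral_le (hK : IsCompact K) (hμ : ∀ᵐ θ ∂μ, θ ∈ K)
    (n : ℕ) {E : Type w} [NormedAddCommGroup E] [NormedSpace ℝ E] {G : V × P → E}
    (hG : ContDiff ℝ ∞ G) (p : P) :
    ‖iteratedFDeriv ℝ n (fun p => ∫ θ, G (θ, p) ∂μ) p‖ ≤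
      ∫ θ, ‖iteratedFDeriv ℝ n (fun p => G (θ, p)) p‖ ∂μ := by
  induction n generalizing E with
  | zero => simpa using norm_integral_le_integral_norm _
  | succ n ih =>
    have h := ih (contDiff_fderivSnd hG)
    rw [← norm_iteratedFDeriv_fderiv, fderiv_parametric_integral hK hμ hG]
    refine h.trans (le_of_eq (integral_congr_ae (Eventually.of_forall fun θ => ?_)))
    have : fderiv ℝ (fun p => G (θ, p)) = fun p => fderivSnd G (θ, p) :=
      funext fun q => (hasFDerivAt_fderivSnd hG θ q).fderiv
    simp only
    rw [← norm_iteratedFDeriv_fderiv, this]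

theorem dirDeriv_parametric_integral (hK : IsCompact K) (hμ : ∀ᵐ θ ∂μ, θ ∈ K) {G : V × P → ℝ}
    (hG : ContDiff ℝ ∞ G) (e : P) (p : P) :
    dirDeriv e (fun p => ∫ θ, G (θ, p) ∂μ) p =
      ∫ θ, dirDeriv ((0 : V), e) G (θ, p) ∂μ := by
  have hc : Continuous (fderivSnd G) := (contDiff_fderivSnd hG).continuous
  have hi : Integrable (fun θ => fderivSnd G (θ, p)) μ :=
    integrable_of_continuous_of_compact hK hμ (hc.comp (by fun_prop))
  unfold dirDeriv
  rw [fderiv_parametric_integral hK hμ hG]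
  simp only
  rw [ContinuousLinearMap.integral_apply hi]
  simp [fderivSnd]

end Parametric

/-! ### The uniform measure on the unit sphere -/

/-- The rotation invariant probability measure on the unit sphere of `R3`, as a measure on `R3`. -/
noncomputable def sphereMeasure : Measure R3 :=
  ((volume : Measure R3).toSphere univ)⁻¹ •
    (volume : Measure R3).toSphere.map ((↑) : Metric.sphere (0 : R3) 1 → R3)

theorem toSphere_univ_ne_zero : (volume : Measure R3).toSphere univ ≠ 0 := by
  simp [Real.pi_pos]

theorem toSphere_univ_ne_top : (volume : Measure R3).toSphere univ ≠ ⊤ := measure_ne_top _ _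

instance : IsProbabilityMeasure sphereMeasure where
  measure_univ := by
    rw [sphereMeasure, Measure.smul_apply, Measure.map_apply measurable_subtype_coe .univ,
      preimage_univ, smul_eq_mul,
      ENNReal.inv_mul_cancel toSphere_univ_ne_zero toSphere_univ_ne_top]

theorem ae_sphereMeasure : ∀ᵐ θ ∂sphereMeasure, θ ∈ Metric.sphere (0 : R3) 1 := by
  rw [sphereMeasure]
  refine Measure.ae_smul_measure ?_ _
  refine (ae_map_iff (p := fun θ => θ ∈ Metric.sphere (0 : R3) 1)
    measurable_subtype_coe.aemeasurable Metric.isClosed_sphere.measurableSet).2 ?_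
  exact Eventually.of_forall fun θ => θ.2

theorem isCompact_unitSphere : IsCompact (Metric.sphere (0 : R3) 1) := isCompact_sphere _ _

open scoped Pointwise in
/-- The measure of a set of directions is the volume of the cone over it, which linear isometries
preserve. -/
theorem map_sphereMeasure (R : R3 ≃ₗᵢ[ℝ] R3) : sphereMeasure.map R = sphereMeasure := by
  have key : ∀ A : Set R3, MeasurableSet A → sphereMeasure A =
      ((volume : Measure R3).toSphere univ)⁻¹ *
        (3 * volume (Ioo (0 : ℝ) 1 • (A ∩ Metric.sphere 0 1))) := by
    intro A hA
    rw [sphereMeasure, Measure.smul_apply, Measure.map_apply measurable_subtype_coe hA,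
      Measure.toSphere_apply' _ (measurable_subtype_coe hA), smul_eq_mul]
    simp [Subtype.image_preimage_coe, inter_comm]
  ext A hA
  rw [Measure.map_apply R.continuous.measurable hA, key _ (R.continuous.measurable hA), key A hA]
  congr 2
  have : Ioo (0 : ℝ) 1 • (R ⁻¹' A ∩ Metric.sphere 0 1) =
      R ⁻¹' (Ioo (0 : ℝ) 1 • (A ∩ Metric.sphere 0 1)) := by
    ext y
    simp only [Set.mem_smul, mem_inter_iff, mem_preimage, mem_sphere_zero_iff_norm]
    constructor
    · rintro ⟨c, hc, z, ⟨hz, hz1⟩, rfl⟩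
      exact ⟨c, hc, R z, ⟨hz, by simpa using hz1⟩, by simp⟩
    · rintro ⟨c, hc, z, ⟨hz, hz1⟩, h⟩
      refine ⟨c, hc, R.symm z, ⟨by simpa using hz, by simpa using hz1⟩, ?_⟩
      apply R.injective
      simp [← h]
  rw [this]
  exact R.measurePreserving.measure_preimage_equiv (f := R.toMeasurableEquiv) _

theorem integral_sphereMeasure_comp (R : R3 ≃ₗᵢ[ℝ] R3) (φ : R3 → ℝ) :
    ∫ θ, φ (R θ) ∂sphereMeasure = ∫ θ, φ θ ∂sphereMeasure := by
  conv_rhs => rw [← map_sphereMeasure R]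
  exact (R.toHomeomorph.measurableEmbedding.integral_map φ).symm

/-- Polar coordinates: the integral of a nonnegative function over `R3`. -/
theorem lintegral_polar {F : R3 → ℝ≥0∞} (hF : Measurable F) :
    ∫⁻ y, F y = (volume : Measure R3).toSphere univ *
      ∫⁻ r in Ioi (0 : ℝ), ENNReal.ofReal (r ^ 2) * ∫⁻ θ, F (r • θ) ∂sphereMeasure := by
  have hdim : Module.finrank ℝ R3 - 1 = 2 := by simp
  have h1 := (volume : Measure R3).measurePreserving_homeomorphUnitSphereProd.symm
    (homeomorphUnitSphereProd R3).toMeasurableEquiv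
  have h0 : ∫⁻ y, F y = ∫⁻ y : ({(0 : R3)}ᶜ : Set R3), F y.1 ∂(volume.comap Subtype.val) := by
    rw [lintegral_subtype_comap (measurableSet_singleton _).compl, restrict_compl_singleton]
  rw [h0]
  have h2 := h1.lintegral_comp_emb (MeasurableEquiv.measurableEmbedding _) (fun y => F y.1)
  rw [← h2, hdim, lintegral_prod_symm _ (by
    refine (hF.comp ?_).aemeasurable
    exact measurable_subtype_coe.comp (MeasurableEquiv.measurable _))]
  simp only [Homeomorph.toMeasurableEquiv_symm_coe, homeomorphUnitSphereProd_symm_apply_coe]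
  have h3 : ∀ r : ℝ, ∫⁻ θ : Metric.sphere (0 : R3) 1, F (r • (θ : R3))
      ∂(volume : Measure R3).toSphere = (volume : Measure R3).toSphere univ *
        ∫⁻ θ, F (r • θ) ∂sphereMeasure := by
    intro r
    have hFr : Measurable fun θ : R3 => F (r • θ) := hF.comp (measurable_const_smul r)
    rw [sphereMeasure, lintegral_smul_measure, lintegral_map hFr measurable_subtype_coe,
      smul_eq_mul, ← mul_assoc,
      ENNReal.mul_inv_cancel toSphere_univ_ne_zero toSphere_univ_ne_top, one_mul]
  simp only [h3]
  have hm : Measurable fun r : ℝ => ∫⁻ θ, F (r • θ) ∂sphereMeasure :=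
    Measurable.lintegral_prod_right' (f := fun q : ℝ × R3 => F (q.1 • q.2))
      (hF.comp (by fun_prop))
  have hm' : Measurable fun r : Ioi (0 : ℝ) => (volume : Measure R3).toSphere univ *
      ∫⁻ θ, F ((r : ℝ) • θ) ∂sphereMeasure :=
    (hm.comp measurable_subtype_coe).const_mul _
  rw [Measure.volumeIoiPow, lintegral_withDensity_eq_lintegral_mul _ (by fun_prop) hm']
  simp only [Pi.mul_apply]
  rw [lintegral_subtype_comap measurableSet_Ioi (fun r : ℝ => ENNReal.ofReal (r ^ 2) *
    ((volume : Measure R3).toSphere univ * ∫⁻ θ, F (r • θ) ∂sphereMeasure)),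
    ← lintegral_const_mul _ (by fun_prop)]
  congr 1
  ext r
  ring

/-! ### Decay of spherical means -/

/-- The weight `(1 + |t|)⁻¹ (1 + ||t| - |x||)⁻ᵐ`, concentrated near the light cone. -/
noncomputable def coneWeight (m : ℕ) (p : ℝ × R3) : ℝ :=
  (1 + |p.1|)⁻¹ * ((1 + |(|p.1| - ‖p.2‖)|) ^ m)⁻¹

theorem coneWeight_pos (m : ℕ) (p : ℝ × R3) : 0 < coneWeight m p := by
  unfold coneWeight; positivity

theorem coneWeight_le_inv (m : ℕ) (p : ℝ × R3) : coneWeight m p ≤ (1 + |p.1|)⁻¹ := by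
  unfold coneWeight
  refine mul_le_of_le_one_right (by positivity) (inv_le_one_of_one_le₀ ?_)
  exact one_le_pow₀ (by linarith [abs_nonneg (|p.1| - ‖p.2‖)])

theorem coneWeight_le_one (m : ℕ) (p : ℝ × R3) : coneWeight m p ≤ 1 :=
  (coneWeight_le_inv m p).trans (inv_le_one_of_one_le₀ (by linarith [abs_nonneg p.1]))

theorem lintegral_inv_one_add_norm_pow_lt_top :
    ∫⁻ y : R3, ENNReal.ofReal (((1 + ‖y‖) ^ 4)⁻¹) < ⊤ := by
  have h := integrable_one_add_norm (E := R3) (μ := volume) (r := 4) (by simp; norm_num)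
  have h2 : (fun y : R3 => (1 + ‖y‖) ^ (-4 : ℝ)) = fun y => ((1 + ‖y‖) ^ 4)⁻¹ := by
    ext y
    rw [Real.rpow_neg (by positivity)]
    norm_cast
  rw [h2] at h
  exact h.lintegral_lt_top

/-- On scales smaller than one the weight `(1 + |y|)⁻⁴` is essentially constant, so its mean over
the sphere of radius `t` is controlled by its mean over the shell `t < |y| ≤ t + 1`, whose volume
is at least of order `t²`. -/
theorem exists_sphere_mean_le : ∃ C : ℝ, ∀ (t : ℝ) (x : R3),
    (1 + |t|) ^ 2 * ∫ θ, ((1 + ‖x + t • θ‖) ^ 4)⁻¹ ∂sphereMeasure ≤ C := by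
  set h : R3 → ℝ := fun y => ((1 + ‖y‖) ^ 4)⁻¹ with hh
  have h0 : ∀ y, 0 ≤ h y := fun y => by positivity
  have h1 : ∀ y, h y ≤ 1 := fun y =>
    inv_le_one_of_one_le₀ (one_le_pow₀ (by linarith [norm_nonneg y]))
  have hc : Continuous h := by
    rw [hh]
    exact Continuous.inv₀ (by fun_prop) fun y => by positivity
  have hslow : ∀ y z : R3, ‖z‖ ≤ 1 → h y ≤ 16 * h (y + z) := by
    intro y z hz
    have h3 : 1 + ‖y + z‖ ≤ 2 * (1 + ‖y‖) := by linarith [norm_add_le y z, norm_nonneg y]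
    have h4 : (1 + ‖y + z‖) ^ 4 ≤ 16 * (1 + ‖y‖) ^ 4 := by
      calc _ ≤ (2 * (1 + ‖y‖)) ^ 4 := by gcongr
        _ = _ := by ring
    simp only [hh]
    rw [inv_le_iff_one_le_mul₀ (by positivity), mul_comm, ← mul_assoc, ← div_eq_mul_inv,
      le_div_iff₀ (by positivity)]
    linarith
  set I : ℝ≥0∞ := ∫⁻ y, ENNReal.ofReal (h y)
  set S := (volume : Measure R3).toSphere univ with hS
  have hI : I ≠ ⊤ := lintegral_inv_one_add_norm_pow_lt_top.ne
  have hmean : ∀ (t : ℝ) (x : R3), ENNReal.ofReal (∫ θ, h (x + t • θ) ∂sphereMeasure) =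
      ∫⁻ θ, ENNReal.ofReal (h (x + t • θ)) ∂sphereMeasure := fun t x =>
    ofReal_integral_eq_lintegral_ofReal
      (Integrable.of_bound (by fun_prop) 1 (Eventually.of_forall fun θ => by
        rw [Real.norm_of_nonneg (h0 _)]; exact h1 _)) (Eventually.of_forall fun θ => h0 _)
  have hpos : ∀ (t : ℝ) (x : R3), 0 ≤ t →
      t ^ 2 * ∫ θ, h (x + t • θ) ∂sphereMeasure ≤ (S⁻¹ * (16 * I)).toReal := by
    intro t x ht
    have hfin : S⁻¹ * (16 * I) ≠ ⊤ := ENNReal.mul_ne_top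
      (ENNReal.inv_ne_top.2 toSphere_univ_ne_zero) (ENNReal.mul_ne_top (by simp) hI)
    rw [← ENNReal.ofReal_le_iff_le_toReal hfin, ENNReal.ofReal_mul (by positivity), hmean]
    have hIx : S * ∫⁻ r in Ioi (0 : ℝ), ENNReal.ofReal (r ^ 2) *
        ∫⁻ θ, ENNReal.ofReal (h (x + r • θ)) ∂sphereMeasure = I := by
      rw [hS, ← lintegral_polar (F := fun y => ENNReal.ofReal (h (x + y))) (by fun_prop)]
      exact lintegral_add_left_eq_self (fun y => ENNReal.ofReal (h y)) x
    have hA : ∀ s ∈ Ioc t (t + 1), ENNReal.ofReal (t ^ 2) *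
        ∫⁻ θ, ENNReal.ofReal (h (x + t • θ)) ∂sphereMeasure ≤ 16 * (ENNReal.ofReal (s ^ 2) *
        ∫⁻ θ, ENNReal.ofReal (h (x + s • θ)) ∂sphereMeasure) := by
      intro s hs
      rw [mul_left_comm, ← lintegral_const_mul' 16 _ (by simp)]
      refine mul_le_mul' (ENNReal.ofReal_le_ofReal ?_) (lintegral_mono_ae ?_)
      · exact pow_le_pow_left₀ ht hs.1.le 2
      · filter_upwards [ae_sphereMeasure] with θ hθ
        rw [show (16 : ℝ≥0∞) = ENNReal.ofReal 16 by norm_num, ← ENNReal.ofReal_mul (by norm_num)]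
        refine ENNReal.ofReal_le_ofReal ?_
        have := hslow (x + t • θ) ((s - t) • θ) (by
          rw [norm_smul, mem_sphere_zero_iff_norm.1 hθ, mul_one, Real.norm_eq_abs, abs_le]
          constructor <;> linarith [hs.1, hs.2])
        rwa [add_assoc, ← add_smul, add_sub_cancel] at this
    rw [← ENNReal.mul_le_iff_le_inv toSphere_univ_ne_zero toSphere_univ_ne_top, ← hIx,
      mul_left_comm 16 S]
    refine mul_le_mul' le_rfl ?_
    rw [← lintegral_const_mul' 16 _ (by simp)]
    calc _ = ∫⁻ _ in Ioc t (t + 1), ENNReal.ofReal (t ^ 2) *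
          ∫⁻ θ, ENNReal.ofReal (h (x + t • θ)) ∂sphereMeasure := by
            rw [setLIntegral_const]; simp
      _ ≤ ∫⁻ s in Ioc t (t + 1), 16 * (ENNReal.ofReal (s ^ 2) *
          ∫⁻ θ, ENNReal.ofReal (h (x + s • θ)) ∂sphereMeasure) :=
        setLIntegral_mono' measurableSet_Ioc hA
      _ ≤ _ := lintegral_mono_set fun s hs => mem_Ioi.2 (ht.trans_lt hs.1)
  refine ⟨2 + 2 * (S⁻¹ * (16 * I)).toReal, fun t x => ?_⟩
  have hsym : ∫ θ, h (x + t • θ) ∂sphereMeasure = ∫ θ, h (x + |t| • θ) ∂sphereMeasure := by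
    rcases abs_choice t with ht | ht
    · rw [ht]
    · rw [ht, ← integral_sphereMeasure_comp (LinearIsometryEquiv.neg ℝ)]
      simp
  have hle1 : ∫ θ, h (x + t • θ) ∂sphereMeasure ≤ 1 := by
    have := integral_mono_of_nonneg (μ := sphereMeasure) (f := fun θ => h (x + t • θ))
      (g := fun _ => (1 : ℝ))
      (Eventually.of_forall fun θ => h0 _) (integrable_const _) (Eventually.of_forall fun θ => h1 _)
    simpa using this
  have hge0 : 0 ≤ ∫ θ, h (x + t • θ) ∂sphereMeasure := integral_nonneg fun θ => h0 _
  have h2 := hpos |t| x (abs_nonneg t)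
  rw [← hsym] at h2
  have h5 : (1 + |t|) ^ 2 ≤ 2 + 2 * |t| ^ 2 := by nlinarith [sq_nonneg (1 - |t|)]
  calc _ ≤ (2 + 2 * |t| ^ 2) * ∫ θ, h (x + t • θ) ∂sphereMeasure := by gcongr
    _ ≤ _ := by linarith

/-- On the sphere `|x + t θ| ≥ ||t| - |x||`, so `m` of the powers of the integrand can be taken out
of the mean. -/
theorem exists_weighted_sphere_mean_le (m : ℕ) : ∃ C : ℝ, ∀ (t : ℝ) (x : R3),
    (1 + |t|) * ∫ θ, ((1 + ‖x + t • θ‖) ^ (4 + m))⁻¹ ∂sphereMeasure ≤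
      C * coneWeight m (t, x) := by
  obtain ⟨C, hC⟩ := exists_sphere_mean_le
  refine ⟨C, fun t x => ?_⟩
  have h1 : ∫ θ, ((1 + ‖x + t • θ‖) ^ (4 + m))⁻¹ ∂sphereMeasure ≤
      ((1 + |(|t| - ‖x‖)|) ^ m)⁻¹ * ∫ θ, ((1 + ‖x + t • θ‖) ^ 4)⁻¹ ∂sphereMeasure := by
    rw [← integral_const_mul]
    refine integral_mono_of_nonneg (Eventually.of_forall fun θ => by positivity) ?_ ?_
    · refine (Integrable.of_bound (C := 1) ?_ (Eventually.of_forall fun θ => ?_)).const_mul _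
      · exact (Continuous.inv₀ (by fun_prop) fun y => by positivity).aestronglyMeasurable
      · rw [Real.norm_of_nonneg (by positivity)]
        exact inv_le_one_of_one_le₀ (one_le_pow₀ (by linarith [norm_nonneg (x + t • θ)]))
    · filter_upwards [ae_sphereMeasure] with θ hθ
      rw [add_comm 4 m, pow_add, mul_inv]
      have h2 : |(|t| - ‖x‖)| ≤ ‖x + t • θ‖ := by
        have h3 : ‖t • θ‖ = |t| := by
          rw [norm_smul, mem_sphere_zero_iff_norm.1 hθ, mul_one, Real.norm_eq_abs]
        have h4 := abs_norm_sub_norm_le (t • θ) (-x)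
        rwa [h3, norm_neg, sub_neg_eq_add, add_comm] at h4
      gcongr
  have hp : 0 < 1 + |t| := by positivity
  calc _ ≤ (1 + |t|) * (((1 + |(|t| - ‖x‖)|) ^ m)⁻¹ *
        ∫ θ, ((1 + ‖x + t • θ‖) ^ 4)⁻¹ ∂sphereMeasure) := by gcongr
    _ = ((1 + |t|) ^ 2 * ∫ θ, ((1 + ‖x + t • θ‖) ^ 4)⁻¹ ∂sphereMeasure) *
        coneWeight m (t, x) := by
      simp only [coneWeight]; field_simp
    _ ≤ _ := mul_le_mul_of_nonneg_right (hC t x) (coneWeight_pos m _).le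

/-! ### Kirchhoff's formula -/

/-- The integrand `t g(x + t θ)` of Kirchhoff's formula, as a function of `(θ, (t, x))`. -/
noncomputable def kirchhoffIntegrand (g : R3 → ℝ) (q : R3 × (ℝ × R3)) : ℝ :=
  q.2.1 * g (q.2.2 + q.2.1 • q.1)

/-- Kirchhoff's solution `t ⨍ g(x + t θ) dθ` of the free wave equation with data `(0, g)`. -/
noncomputable def kirchhoff (g : R3 → ℝ) (p : ℝ × R3) : ℝ :=
  ∫ θ, kirchhoffIntegrand g (θ, p) ∂sphereMeasure

theorem contDiff_kirchhoffIntegrand {g : R3 → ℝ} (hg : ContDiff ℝ ∞ g) :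
    ContDiff ℝ ∞ (kirchhoffIntegrand g) := by
  unfold kirchhoffIntegrand
  exact (contDiff_fst.comp contDiff_snd).mul (hg.comp ((contDiff_snd.comp contDiff_snd).add
    ((contDiff_fst.comp contDiff_snd).smul contDiff_fst)))

theorem contDiff_kirchhoff {g : R3 → ℝ} (hg : ContDiff ℝ ∞ g) : ContDiff ℝ ∞ (kirchhoff g) :=
  contDiff_parametric_integral isCompact_unitSphere ae_sphereMeasure
    (contDiff_kirchhoffIntegrand hg)

theorem dirDeriv_kirchhoff {g : R3 → ℝ} (hg : ContDiff ℝ ∞ g) (e p : ℝ × R3) :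
    dirDeriv e (kirchhoff g) p =
      ∫ θ, dirDeriv ((0 : R3), e) (kirchhoffIntegrand g) (θ, p) ∂sphereMeasure :=
  dirDeriv_parametric_integral isCompact_unitSphere ae_sphereMeasure
    (contDiff_kirchhoffIntegrand hg) e p

theorem dirDeriv_dirDeriv_kirchhoff {g : R3 → ℝ} (hg : ContDiff ℝ ∞ g) (e p : ℝ × R3) :
    dirDeriv e (dirDeriv e (kirchhoff g)) p = ∫ θ, dirDeriv ((0 : R3), e)
      (dirDeriv ((0 : R3), e) (kirchhoffIntegrand g)) (θ, p) ∂sphereMeasure := by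
  have h : dirDeriv e (kirchhoff g) = fun p =>
      ∫ θ, dirDeriv ((0 : R3), e) (kirchhoffIntegrand g) (θ, p) ∂sphereMeasure :=
    funext (dirDeriv_kirchhoff hg e)
  rw [h]
  exact dirDeriv_parametric_integral isCompact_unitSphere ae_sphereMeasure
    ((contDiff_kirchhoffIntegrand hg).dirDeriv _) e p

/-- A directional derivative may be computed along any curve with the given velocity. -/
theorem dirDeriv_eq_of_hasDerivAt {P : Type*} [NormedAddCommGroup P] [NormedSpace ℝ P]
    {U : P → ℝ} {c : ℝ → P} {e : P} {s d : ℝ} (hU : DifferentiableAt ℝ U (c s))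
    (hc : HasDerivAt c e s) (hd : HasDerivAt (fun r => U (c r)) d s) : dirDeriv e U (c s) = d :=
  (hU.hasFDerivAt.comp_hasDerivAt s hc).unique hd

theorem dirDeriv_space_kirchhoffIntegrand {g : R3 → ℝ} (hg : ContDiff ℝ ∞ g) (v : R3) :
    dirDeriv ((0 : R3), ((0 : ℝ), v)) (kirchhoffIntegrand g) =
      kirchhoffIntegrand (dirDeriv v g) := by
  ext ⟨θ, t, x⟩
  have hc : HasDerivAt (fun s : ℝ => (θ, (t, x + s • v))) ((0 : R3), ((0 : ℝ), v)) 0 := by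
    refine (hasDerivAt_const _ _).prodMk ((hasDerivAt_const _ _).prodMk ?_)
    simpa using ((hasDerivAt_id (0 : ℝ)).smul_const v).const_add x
  have hd : HasDerivAt (fun s : ℝ => kirchhoffIntegrand g (θ, (t, x + s • v)))
      (t * fderiv ℝ g (x + t • θ) v) 0 := by
    have h1 : HasDerivAt (fun s : ℝ => x + s • v + t • θ) v 0 := by
      simpa using (((hasDerivAt_id (0 : ℝ)).smul_const v).const_add x).add_const (t • θ)
    have h2 : HasFDerivAt g (fderiv ℝ g (x + t • θ)) (x + (0 : ℝ) • v + t • θ) := by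
      simpa using (hg.differentiable (by simp) (x + t • θ)).hasFDerivAt
    exact (h2.comp_hasDerivAt 0 h1).const_mul t
  have := dirDeriv_eq_of_hasDerivAt
    ((contDiff_kirchhoffIntegrand hg).differentiable (by simp) _) hc hd
  simpa [kirchhoffIntegrand, dirDeriv] using this

theorem dirDeriv_time_kirchhoffIntegrand {g : R3 → ℝ} (hg : ContDiff ℝ ∞ g) (θ : R3) (t : ℝ)
    (x : R3) : dirDeriv ((0 : R3), ((1 : ℝ), (0 : R3))) (kirchhoffIntegrand g) (θ, (t, x)) =
      g (x + t • θ) + t * fderiv ℝ g (x + t • θ) θ := by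
  have hc : HasDerivAt (fun s : ℝ => (θ, (s, x))) ((0 : R3), ((1 : ℝ), (0 : R3))) t :=
    (hasDerivAt_const _ _).prodMk ((hasDerivAt_id t).prodMk (hasDerivAt_const _ _))
  refine dirDeriv_eq_of_hasDerivAt
    ((contDiff_kirchhoffIntegrand hg).differentiable (by simp) _) hc ?_
  have h1 : HasDerivAt (fun s : ℝ => x + s • θ) θ t := by
    simpa using ((hasDerivAt_id t).smul_const θ).const_add x
  have h2 := (hg.differentiable (by simp) (x + t • θ)).hasFDerivAt.comp_hasDerivAt t h1
  exact ((hasDerivAt_id t).mul h2).congr_deriv (by simp)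

theorem dirDeriv_time_time_kirchhoffIntegrand {g : R3 → ℝ} (hg : ContDiff ℝ ∞ g) (θ : R3) (t : ℝ)
    (x : R3) : dirDeriv ((0 : R3), ((1 : ℝ), (0 : R3)))
      (dirDeriv ((0 : R3), ((1 : ℝ), (0 : R3))) (kirchhoffIntegrand g)) (θ, (t, x)) =
      2 * fderiv ℝ g (x + t • θ) θ + t * fderiv ℝ (fderiv ℝ g) (x + t • θ) θ θ := by
  have hc : HasDerivAt (fun s : ℝ => (θ, (s, x))) ((0 : R3), ((1 : ℝ), (0 : R3))) t :=
    (hasDerivAt_const _ _).prodMk ((hasDerivAt_id t).prodMk (hasDerivAt_const _ _))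
  refine dirDeriv_eq_of_hasDerivAt
    (((contDiff_kirchhoffIntegrand hg).dirDeriv _).differentiable (by simp) _) hc ?_
  simp only [dirDeriv_time_kirchhoffIntegrand hg]
  have h1 : HasDerivAt (fun s : ℝ => x + s • θ) θ t := by
    simpa using ((hasDerivAt_id t).smul_const θ).const_add x
  have h2 := (hg.differentiable (by simp) (x + t • θ)).hasFDerivAt.comp_hasDerivAt t h1
  have h3 := ((hg.fderiv_right (m := ∞) (by simp)).differentiable (by simp)
    (x + t • θ)).hasFDerivAt.comp_hasDerivAt t h1
  have h4 := h3.clm_apply (hasDerivAt_const t θ)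
  have h5 := h2.add ((hasDerivAt_id t).mul h4)
  refine h5.congr_deriv ?_
  simp
  ring

/-! ### Rotations, and the spherical Laplacian -/

/-- The standard orthonormal basis vector `eᵢ`. -/
noncomputable abbrev stdVec (i : Fin 3) : R3 := EuclideanSpace.single i 1

/-- The generator of rotations in the `(i, j)`-plane. -/
noncomputable def rotGen (i j : Fin 3) : R3 →L[ℝ] R3 :=
  (EuclideanSpace.proj i : R3 →L[ℝ] ℝ).smulRight (stdVec j) -
    (EuclideanSpace.proj j : R3 →L[ℝ] ℝ).smulRight (stdVec i)

/-- The orthogonal projection onto the `(i, j)`-plane, for `i ≠ j`. -/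
noncomputable def planeProj (i j : Fin 3) : R3 →L[ℝ] R3 :=
  (EuclideanSpace.proj i : R3 →L[ℝ] ℝ).smulRight (stdVec i) +
    (EuclideanSpace.proj j : R3 →L[ℝ] ℝ).smulRight (stdVec j)

/-- Rotation by the angle `s` in the `(i, j)`-plane. -/
noncomputable def rot (i j : Fin 3) (s : ℝ) : R3 →L[ℝ] R3 :=
  ContinuousLinearMap.id ℝ R3 + (Real.cos s - 1) • planeProj i j + Real.sin s • rotGen i j

theorem rot_apply (i j : Fin 3) (s : ℝ) (y : R3) :
    rot i j s y = y + (Real.cos s - 1) • planeProj i j y + Real.sin s • rotGen i j y := rfl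

theorem norm_rot {i j : Fin 3} (hij : i ≠ j) (s : ℝ) (y : R3) : ‖rot i j s y‖ = ‖y‖ := by
  have h : ‖rot i j s y‖ ^ 2 = ‖y‖ ^ 2 := by
    rw [EuclideanSpace.real_norm_sq_eq, EuclideanSpace.real_norm_sq_eq, Fin.sum_univ_three,
      Fin.sum_univ_three]
    have hs := Real.sin_sq_add_cos_sq s
    fin_cases i <;> fin_cases j <;> first | exact absurd rfl hij | skip
    all_goals
      simp [rot, rotGen, planeProj]
      first
        | linear_combination (y 0 ^ 2 + y 1 ^ 2) * hs
        | linear_combination (y 0 ^ 2 + y 2 ^ 2) * hs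
        | linear_combination (y 1 ^ 2 + y 2 ^ 2) * hs
  exact (sq_eq_sq₀ (norm_nonneg _) (norm_nonneg _)).1 h

theorem integral_sphereMeasure_comp_rot {i j : Fin 3} (hij : i ≠ j) (s : ℝ) (φ : R3 → ℝ) :
    ∫ θ, φ (rot i j s θ) ∂sphereMeasure = ∫ θ, φ θ ∂sphereMeasure := by
  let L : R3 →ₗᵢ[ℝ] R3 := ⟨(rot i j s : R3 →ₗ[ℝ] R3), norm_rot hij s⟩
  exact integral_sphereMeasure_comp (L.toLinearIsometryEquiv rfl) φ

/-- Rotation invariance of the sphere measure in infinitesimal form. -/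
theorem integral_fderiv_rotGen {i j : Fin 3} (hij : i ≠ j) {φ : R3 → ℝ} (hφ : ContDiff ℝ ∞ φ) :
    ∫ θ, fderiv ℝ φ θ (rotGen i j θ) ∂sphereMeasure = 0 := by
  have hrot : ContDiff ℝ ∞ (fun q : R3 × ℝ => rot i j q.2 q.1) := by
    simp only [rot_apply]
    exact (contDiff_fst.add (((Real.contDiff_cos.comp contDiff_snd).sub contDiff_const).smul
      ((planeProj i j).contDiff.comp contDiff_fst))).add
        ((Real.contDiff_sin.comp contDiff_snd).smul ((rotGen i j).contDiff.comp contDiff_fst))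
  have hG : ContDiff ℝ ∞ (fun q : R3 × ℝ => φ (rot i j q.2 q.1)) := hφ.comp hrot
  have h := dirDeriv_parametric_integral (P := ℝ) isCompact_unitSphere ae_sphereMeasure hG 1 0
  simp only [integral_sphereMeasure_comp_rot hij] at h
  have h0 : dirDeriv (1 : ℝ) (fun _ : ℝ => ∫ θ, φ θ ∂sphereMeasure) 0 = 0 := by simp [dirDeriv]
  rw [h0] at h
  rw [h]
  refine integral_congr_ae (Eventually.of_forall fun θ => ?_)
  have hc : HasDerivAt (fun s : ℝ => (θ, s)) ((0 : R3), (1 : ℝ)) 0 :=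
    (hasDerivAt_const _ _).prodMk (hasDerivAt_id _)
  refine (dirDeriv_eq_of_hasDerivAt (hG.differentiable (by simp) _) hc ?_).symm
  have hr : HasDerivAt (fun s : ℝ => rot i j s θ) (rotGen i j θ) 0 := by
    have h1 := ((Real.hasDerivAt_cos 0).sub_const 1).smul_const (planeProj i j θ)
    have h2 := (Real.hasDerivAt_sin 0).smul_const (rotGen i j θ)
    have h3 := (h1.const_add θ).add h2
    refine h3.congr_deriv ?_
    simp
  have hr0 : rot i j 0 θ = θ := by simp [rot]
  have h4 : HasFDerivAt φ (fderiv ℝ φ θ) (rot i j 0 θ) := by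
    rw [hr0]; exact (hφ.differentiable (by simp) θ).hasFDerivAt
  exact h4.comp_hasDerivAt 0 hr

/-! ### The wave equation for Kirchhoff's solution -/

/-- The d'Alembertian `∂ₜ² - Δ` of a function on space-time. -/
noncomputable def dalembertian (U : ℝ × R3 → ℝ) (p : ℝ × R3) : ℝ :=
  dirDeriv ((1 : ℝ), (0 : R3)) (dirDeriv ((1 : ℝ), (0 : R3)) U) p -
    ∑ i, dirDeriv ((0 : ℝ), stdVec i) (dirDeriv ((0 : ℝ), stdVec i) U) p

theorem eq_sum_stdVec (y : R3) : y = y 0 • stdVec 0 + y 1 • stdVec 1 + y 2 • stdVec 2 := by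
  ext k
  fin_cases k <;> simp

/-- In terms of the rotation generators `Lᵢⱼ`, the Laplacian on a sphere is `∑ Lᵢⱼ²`; here this is
applied to `θ ↦ g(x + t θ)`, and each `Lᵢⱼ²` integrates to zero. -/
theorem integral_spherical_laplacian {g : R3 → ℝ} (hg : ContDiff ℝ ∞ g) (t : ℝ) (x : R3) :
    ∫ θ, (2 * fderiv ℝ g (x + t • θ) θ + t * fderiv ℝ (fderiv ℝ g) (x + t • θ) θ θ -
      ∑ i, t * fderiv ℝ (fderiv ℝ g) (x + t • θ) (stdVec i) (stdVec i)) ∂sphereMeasure = 0 := by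
  have hg1 : ContDiff ℝ ∞ (fderiv ℝ g) := hg.fderiv_right (m := ∞) (by simp)
  have haff : ContDiff ℝ ∞ (fun θ : R3 => x + t • θ) :=
    contDiff_const.add (contDiff_id.const_smul t)
  have hφ : ∀ i j : Fin 3, ContDiff ℝ ∞ (fun θ : R3 => fderiv ℝ g (x + t • θ) (rotGen i j θ)) :=
    fun i j => (hg1.comp haff).clm_apply (rotGen i j).contDiff
  have hder : ∀ (i j : Fin 3) (θ : R3),
      fderiv ℝ (fun θ : R3 => fderiv ℝ g (x + t • θ) (rotGen i j θ)) θ (rotGen i j θ) =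
        t * fderiv ℝ (fderiv ℝ g) (x + t • θ) (rotGen i j θ) (rotGen i j θ) +
          fderiv ℝ g (x + t • θ) (rotGen i j (rotGen i j θ)) := by
    intro i j θ
    have h1 : HasFDerivAt (fun θ : R3 => x + t • θ) (t • ContinuousLinearMap.id ℝ R3) θ :=
      ((hasFDerivAt_id θ).const_smul t).const_add x
    have h2 := ((hg1.differentiable (by simp) (x + t • θ)).hasFDerivAt.comp θ h1).clm_apply
      (rotGen i j).hasFDerivAt
    have h3 := h2.fderiv
    simp only [Function.comp_def] at h3
    rw [h3]
    simp
    ring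
  have hI : ∀ i j : Fin 3, Integrable (fun θ : R3 =>
      fderiv ℝ (fun θ : R3 => fderiv ℝ g (x + t • θ) (rotGen i j θ)) θ (rotGen i j θ))
      sphereMeasure := fun i j =>
    integrable_of_continuous_of_compact isCompact_unitSphere ae_sphereMeasure
      (((hφ i j).continuous_fderiv (by simp)).clm_apply (rotGen i j).continuous)
  have h01 := integral_fderiv_rotGen (i := 0) (j := 1) (by decide) (hφ 0 1)
  have h02 := integral_fderiv_rotGen (i := 0) (j := 2) (by decide) (hφ 0 2)
  have h12 := integral_fderiv_rotGen (i := 1) (j := 2) (by decide) (hφ 1 2)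
  have hsum := integral_add ((hI 0 1).add (hI 0 2)) (hI 1 2)
  have hsum' := integral_add (hI 0 1) (hI 0 2)
  simp only [Pi.add_apply] at hsum
  rw [hsum', h01, h02, h12] at hsum
  rw [← neg_eq_zero, ← integral_neg]
  refine Eq.trans (integral_congr_ae ?_) (hsum.trans (by simp))
  filter_upwards [ae_sphereMeasure] with θ hθ
  rw [hder, hder, hder]
  have hsymm : ∀ a b, fderiv ℝ (fderiv ℝ g) (x + t • θ) a b =
      fderiv ℝ (fderiv ℝ g) (x + t • θ) b a := fun a b =>
    (hg.contDiffAt.isSymmSndFDerivAt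
      (by simpa using WithTop.coe_le_coe.2 (le_top : (2 : ℕ∞) ≤ ⊤))).eq a b
  set B := fderiv ℝ (fderiv ℝ g) (x + t • θ)
  set A := fderiv ℝ g (x + t • θ)
  have hn : θ 0 ^ 2 + θ 1 ^ 2 + θ 2 ^ 2 = 1 := by
    have := EuclideanSpace.real_norm_sq_eq θ
    rw [mem_sphere_zero_iff_norm.1 hθ, Fin.sum_univ_three] at this
    linarith
  have hBθ : B θ θ = B (θ 0 • stdVec 0 + θ 1 • stdVec 1 + θ 2 • stdVec 2)
      (θ 0 • stdVec 0 + θ 1 • stdVec 1 + θ 2 • stdVec 2) := by rw [← eq_sum_stdVec θ]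
  have hAθ : A θ = A (θ 0 • stdVec 0 + θ 1 • stdVec 1 + θ 2 • stdVec 2) := by
    rw [← eq_sum_stdVec θ]
  rw [hBθ, hAθ, Fin.sum_univ_three]
  simp only [rotGen, sub_apply, ContinuousLinearMap.smulRight_apply,
    PiLp.proj_apply, map_add, map_sub, map_smul, add_apply, smul_apply, smul_eq_mul]
  rw [hsymm (stdVec 1) (stdVec 0), hsymm (stdVec 2) (stdVec 0), hsymm (stdVec 2) (stdVec 1)]
  simp
  linear_combination (-t * (B (stdVec 0) (stdVec 0) + B (stdVec 1) (stdVec 1) +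
    B (stdVec 2) (stdVec 2))) * hn

/-- Under the integral sign, the wave equation is the vanishing of the mean of the spherical
Laplacian. -/
theorem dalembertian_kirchhoff {g : R3 → ℝ} (hg : ContDiff ℝ ∞ g) (p : ℝ × R3) :
    dalembertian (kirchhoff g) p = 0 := by
  obtain ⟨t, x⟩ := p
  have hc := contDiff_kirchhoffIntegrand hg
  have hI : ∀ e : ℝ × R3, Integrable (fun θ => dirDeriv ((0 : R3), e)
      (dirDeriv ((0 : R3), e) (kirchhoffIntegrand g)) (θ, (t, x))) sphereMeasure := fun e =>
    integrable_of_continuous_of_compact isCompact_unitSphere ae_sphereMeasure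
      (((hc.dirDeriv _).dirDeriv _).continuous.comp (by fun_prop))
  unfold dalembertian
  simp only [dirDeriv_dirDeriv_kirchhoff hg]
  rw [← integral_finsetSum _ fun i _ => hI _, ← integral_sub (hI _)
    (integrable_finsetSum _ fun i _ => hI _)]
  refine Eq.trans ?_ (integral_spherical_laplacian hg t x)
  refine integral_congr_ae (Eventually.of_forall fun θ => ?_)
  simp only
  rw [dirDeriv_time_time_kirchhoffIntegrand hg]
  congr 1
  refine Finset.sum_congr rfl fun i _ => ?_
  have hgi : ContDiff ℝ ∞ (dirDeriv (stdVec i) g) := hg.dirDeriv _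
  have hd : DifferentiableAt ℝ (fderiv ℝ g) (x + t • θ) :=
    (hg.fderiv_right (m := ∞) (by simp)).differentiable (by simp) _
  rw [dirDeriv_space_kirchhoffIntegrand hg, dirDeriv_space_kirchhoffIntegrand hgi]
  simp only [kirchhoffIntegrand]
  congr 1
  change fderiv ℝ (fun q => fderiv ℝ g q (stdVec i)) (x + t • θ) (stdVec i) = _
  rw [fderiv_clm_apply hd (differentiableAt_const _)]
  simp

theorem kirchhoff_initial (g : R3 → ℝ) (x : R3) : kirchhoff g (0, x) = 0 := by
  simp [kirchhoff, kirchhoffIntegrand]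

theorem dirDeriv_kirchhoff_initial {g : R3 → ℝ} (hg : ContDiff ℝ ∞ g) (x : R3) :
    dirDeriv ((1 : ℝ), (0 : R3)) (kirchhoff g) (0, x) = g x := by
  rw [dirDeriv_kirchhoff hg]
  simp [dirDeriv_time_kirchhoffIntegrand hg]

theorem norm_iteratedFDeriv_fst_le (i : ℕ) (p : ℝ × R3) :
    ‖iteratedFDeriv ℝ i (fun q : ℝ × R3 => q.1) p‖ ≤ 1 + |p.1| := by
  rcases i with _ | i
  · simp
  · have h : fderiv ℝ (fun q : ℝ × R3 => q.1) = fun _ => ContinuousLinearMap.fst ℝ ℝ R3 :=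
      funext fun q => fderiv_fst
    rw [← norm_iteratedFDeriv_fderiv, h]
    have h1 : ‖ContinuousLinearMap.fst ℝ ℝ R3‖ ≤ 1 := ContinuousLinearMap.norm_fst_le ℝ ℝ R3
    rcases i with _ | i
    · rw [norm_iteratedFDeriv_zero]
      linarith [abs_nonneg p.1]
    · rw [iteratedFDeriv_const_of_ne (by omega)]
      simp only [Pi.zero_apply, norm_zero]
      positivity

theorem SchwartzMap.exists_bound_inv (g : 𝓢(R3, ℝ)) (k N : ℕ) : ∃ A : ℝ, 0 ≤ A ∧
    ∀ i ≤ N, ∀ y, ‖iteratedFDeriv ℝ i g y‖ ≤ A * ((1 + ‖y‖) ^ k)⁻¹ := by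
  refine ⟨2 ^ k * ((Finset.Iic (k, N)).sup fun m => SchwartzMap.seminorm ℝ m.1 m.2) g,
    by positivity, fun i hi y => ?_⟩
  rw [← div_eq_mul_inv, le_div_iff₀ (by positivity), mul_comm]
  exact SchwartzMap.one_add_le_sup_seminorm_apply (𝕜 := ℝ) (m := (k, N)) le_rfl hi g y

/-- All derivatives of Kirchhoff's solution are concentrated near the light cone and decay like
`1 / t`. -/
theorem dominatedBy_kirchhoff (g : 𝓢(R3, ℝ)) (m : ℕ) :
    DominatedBy (coneWeight m) (kirchhoff g) where
  smooth := contDiff_kirchhoff (g.smooth ⊤)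
  bound N := by
    obtain ⟨A, hA0, hA⟩ := g.exists_bound_inv (4 + m) N
    obtain ⟨C, hC⟩ := exists_weighted_sphere_mean_le m
    refine ⟨(∑ i ∈ Finset.range (N + 1), (N.choose i : ℝ) * A * 2 ^ (N - i)) * C,
      fun p => ?_⟩
    obtain ⟨t, x⟩ := p
    have hg : ContDiff ℝ ∞ g := g.smooth ⊤
    have hpt : ∀ᵐ θ ∂sphereMeasure,
        ‖iteratedFDeriv ℝ N (fun p => kirchhoffIntegrand g (θ, p)) (t, x)‖ ≤
        (∑ i ∈ Finset.range (N + 1), (N.choose i : ℝ) * A * 2 ^ (N - i)) *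
          ((1 + |t|) * ((1 + ‖x + t • θ‖) ^ (4 + m))⁻¹) := by
      filter_upwards [ae_sphereMeasure] with θ hθ
      set L : ℝ × R3 →L[ℝ] R3 := ContinuousLinearMap.snd ℝ ℝ R3 +
        (ContinuousLinearMap.fst ℝ ℝ R3).smulRight θ with hL
      have hLn : ‖L‖ ≤ 2 := by
        refine (norm_add_le _ _).trans ?_
        rw [ContinuousLinearMap.norm_smulRight_apply, mem_sphere_zero_iff_norm.1 hθ, mul_one]
        linarith [ContinuousLinearMap.norm_fst_le ℝ ℝ R3, ContinuousLinearMap.norm_snd_le ℝ ℝ R3]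
      have hgL : ContDiff ℝ ∞ (fun p => g (L p)) := hg.comp L.contDiff
      have h1 : ∀ i ≤ N, ‖iteratedFDeriv ℝ i (fun p => g (L p)) (t, x)‖ ≤
          A * ((1 + ‖x + t • θ‖) ^ (4 + m))⁻¹ * 2 ^ i := by
        intro i hi
        have h2 : iteratedFDeriv ℝ i (g ∘ L) (t, x) = _ :=
          L.iteratedFDeriv_comp_right hg _ (i := i) (by exact_mod_cast le_top)
        change ‖iteratedFDeriv ℝ i (g ∘ L) (t, x)‖ ≤ _
        rw [h2]
        refine (ContinuousMultilinearMap.norm_compContinuousLinearMap_le _ _).trans ?_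
        refine mul_le_mul ?_ ?_ (by positivity) (by positivity)
        · have := hA i hi (L (t, x))
          simpa [hL] using this
        · simp only [Finset.prod_const, Finset.card_univ, Fintype.card_fin]
          exact pow_le_pow_left₀ (norm_nonneg _) hLn i
      have h3 := norm_iteratedFDeriv_mul_le (f := fun q : ℝ × R3 => q.1) contDiff_fst hgL (t, x)
        (n := N) (by exact_mod_cast le_top)
      have h4 : (fun p => kirchhoffIntegrand g (θ, p)) = fun p : ℝ × R3 => p.1 * g (L p) := by
        ext p; simp [kirchhoffIntegrand, hL]
      rw [h4]
      refine h3.trans ?_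
      rw [Finset.sum_mul]
      refine Finset.sum_le_sum fun i hi => ?_
      calc _ ≤ (N.choose i : ℝ) * (1 + |t|) *
            (A * ((1 + ‖x + t • θ‖) ^ (4 + m))⁻¹ * 2 ^ (N - i)) := by
            gcongr
            · exact norm_iteratedFDeriv_fst_le i (t, x)
            · exact h1 _ (Nat.sub_le _ _)
        _ = _ := by ring
    refine (norm_iteratedFDeriv_parametric_integral_le isCompact_unitSphere ae_sphereMeasure N
      (contDiff_kirchhoffIntegrand hg) (t, x)).trans ?_
    refine (integral_mono_of_nonneg (Eventually.of_forall fun θ => norm_nonneg _) ?_ hpt).trans ?_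
    · refine (((Integrable.of_bound (C := 1) ?_ (Eventually.of_forall fun θ => ?_)).const_mul
        _).const_mul _)
      · exact (Continuous.inv₀ (by fun_prop) fun y => by positivity).aestronglyMeasurable
      · rw [Real.norm_of_nonneg (by positivity)]
        exact inv_le_one_of_one_le₀ (one_le_pow₀ (by linarith [norm_nonneg (x + t • θ)]))
    · rw [integral_const_mul, integral_const_mul, mul_assoc]
      exact mul_le_mul_of_nonneg_left (hC t x) (by positivity)

/-! ### Rules for directional derivatives and for the d'Alembertian -/

theorem dirDeriv_add {P : Type*} [NormedAddCommGroup P] [NormedSpace ℝ P] {U V : P → ℝ}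
    (hU : ContDiff ℝ ∞ U) (hV : ContDiff ℝ ∞ V) (e : P) :
    dirDeriv e (fun p => U p + V p) = fun p => dirDeriv e U p + dirDeriv e V p := by
  ext p
  unfold dirDeriv
  rw [fderiv_fun_add (hU.differentiable (by simp) p) (hV.differentiable (by simp) p)]
  simp

theorem dirDeriv_sub {P : Type*} [NormedAddCommGroup P] [NormedSpace ℝ P] {U V : P → ℝ}
    (hU : ContDiff ℝ ∞ U) (hV : ContDiff ℝ ∞ V) (e : P) :
    dirDeriv e (fun p => U p - V p) = fun p => dirDeriv e U p - dirDeriv e V p := by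
  ext p
  unfold dirDeriv
  rw [fderiv_fun_sub (hU.differentiable (by simp) p) (hV.differentiable (by simp) p)]
  simp

theorem dirDeriv_comp {P : Type*} [NormedAddCommGroup P] [NormedSpace ℝ P] {Ψ : ℝ → ℝ} {U : P → ℝ}
    (hΨ : ContDiff ℝ ∞ Ψ) (hU : ContDiff ℝ ∞ U) (e : P) :
    dirDeriv e (fun p => Ψ (U p)) = fun p => deriv Ψ (U p) * dirDeriv e U p := by
  ext p
  have h := (hΨ.differentiable (by simp) (U p)).hasDerivAt.comp_hasFDerivAt p
    (hU.differentiable (by simp) p).hasFDerivAt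
  have h2 : fderiv ℝ (fun p => Ψ (U p)) p = _ := h.fderiv
  unfold dirDeriv
  rw [h2]
  simp

theorem dirDeriv_dirDeriv_comp {P : Type*} [NormedAddCommGroup P] [NormedSpace ℝ P] {Ψ : ℝ → ℝ}
    {U : P → ℝ} (hΨ : ContDiff ℝ ∞ Ψ) (hU : ContDiff ℝ ∞ U) (e p : P) :
    dirDeriv e (dirDeriv e (fun p => Ψ (U p))) p =
      deriv (deriv Ψ) (U p) * dirDeriv e U p ^ 2 +
        deriv Ψ (U p) * dirDeriv e (dirDeriv e U) p := by
  have hΨ' : ContDiff ℝ ∞ (deriv Ψ) := ((contDiff_infty_iff_deriv).1 hΨ).2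
  rw [dirDeriv_comp hΨ hU]
  have h1 := congrFun (dirDeriv_comp hΨ' hU e) p
  have hA : DifferentiableAt ℝ (fun p => deriv Ψ (U p)) p :=
    (hΨ'.comp hU).differentiable (by simp) p
  have hB : DifferentiableAt ℝ (fun p => dirDeriv e U p) p :=
    (hU.dirDeriv e).differentiable (by simp) p
  change fderiv ℝ (fun p => deriv Ψ (U p) * dirDeriv e U p) p e = _
  change fderiv ℝ (fun p => deriv Ψ (U p)) p e = _ at h1
  rw [fderiv_fun_mul hA hB]
  simp only [add_apply, smul_apply, smul_eq_mul]
  rw [h1]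
  change _ * dirDeriv e (dirDeriv e U) p + _ = _
  ring

/-- The second-order part of the chain rule is a multiple of the null form
`U_t² - |∇U|²`. -/
theorem dalembertian_comp {Ψ : ℝ → ℝ} {U : ℝ × R3 → ℝ}
    (hΨ : ContDiff ℝ ∞ Ψ) (hU : ContDiff ℝ ∞ U) (p : ℝ × R3) :
    dalembertian (fun p => Ψ (U p)) p = deriv (deriv Ψ) (U p) *
      (dirDeriv ((1 : ℝ), (0 : R3)) U p ^ 2 - ∑ i, dirDeriv ((0 : ℝ), stdVec i) U p ^ 2) +
        deriv Ψ (U p) * dalembertian U p := by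
  unfold dalembertian
  simp only [dirDeriv_dirDeriv_comp hΨ hU, Finset.sum_add_distrib, ← Finset.mul_sum]
  ring

theorem dalembertian_add {U V : ℝ × R3 → ℝ} (hU : ContDiff ℝ ∞ U) (hV : ContDiff ℝ ∞ V)
    (p : ℝ × R3) :
    dalembertian (fun p => U p + V p) p = dalembertian U p + dalembertian V p := by
  unfold dalembertian
  simp only [dirDeriv_add hU hV, dirDeriv_add (hU.dirDeriv _) (hV.dirDeriv _),
    Finset.sum_add_distrib]
  ring

/-- Derivatives of free waves are free waves. -/
theorem dalembertian_dirDeriv_eq_zero {U : ℝ × R3 → ℝ} (hU : ContDiff ℝ ∞ U)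
    (h : ∀ p, dalembertian U p = 0) (e p : ℝ × R3) : dalembertian (dirDeriv e U) p = 0 := by
  have hcomm : ∀ a : ℝ × R3, dirDeriv a (dirDeriv a (dirDeriv e U)) =
      dirDeriv e (dirDeriv a (dirDeriv a U)) := fun a => by
    rw [dirDeriv_comm hU a e, dirDeriv_comm (hU.dirDeriv a) a e]
  unfold dalembertian
  simp only [hcomm]
  have h0 : dirDeriv e (dalembertian U) p = 0 := by
    rw [show dalembertian U = fun _ => 0 from funext h]
    simp [dirDeriv]
  refine Eq.trans ?_ h0
  have hd : ∀ a : ℝ × R3, DifferentiableAt ℝ (dirDeriv a (dirDeriv a U)) p := fun a =>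
    ((hU.dirDeriv a).dirDeriv a).differentiable (by simp) p
  change _ = fderiv ℝ (fun q => dalembertian U q) p e
  unfold dalembertian
  rw [fderiv_fun_sub (hd _) (DifferentiableAt.fun_sum fun i _ => hd _),
    fderiv_fun_sum fun i _ => hd _]
  simp [dirDeriv]

/-! ### Derivatives of time slices -/

theorem dirDeriv_slice {U : ℝ × R3 → ℝ} (hU : ContDiff ℝ ∞ U) (t : ℝ) (e : R3) :
    dirDeriv e (fun y => U (t, y)) = fun y => dirDeriv ((0 : ℝ), e) U (t, y) := by
  ext y
  have h1 : HasFDerivAt (fun y => U (t, y)) _ y :=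
    (hU.differentiable (by simp) (t, y)).hasFDerivAt.comp y (hasFDerivAt_prodMk_right t y)
  unfold dirDeriv
  rw [h1.fderiv]
  simp

theorem waveOp_eq_dalembertian {U : ℝ × R3 → ℝ} (hU : ContDiff ℝ ∞ U) (t : ℝ) (x : R3) :
    waveOp (fun s y => U (s, y)) t x = dalembertian U (t, x) := by
  unfold waveOp dalembertian
  rw [timeDeriv_eq_iterate_dirDeriv hU,
    InnerProductSpace.laplacian_eq_iteratedFDeriv_orthonormalBasis _
      (EuclideanSpace.basisFun (Fin 3) ℝ)]
  congr 1
  refine Finset.sum_congr rfl fun i _ => ?_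
  have hs : ContDiff ℝ ∞ (fun y => U (t, y)) := hU.comp (contDiff_prodMk_right t)
  have hd : DifferentiableAt ℝ (fderiv ℝ (fun y => U (t, y))) x :=
    (hs.fderiv_right (m := ∞) (by simp)).differentiable (by simp) x
  have h2 : dirDeriv (stdVec i) (dirDeriv (stdVec i) (fun y => U (t, y))) x =
      fderiv ℝ (fderiv ℝ (fun y => U (t, y))) x (stdVec i) (stdVec i) := by
    change fderiv ℝ (fun q => fderiv ℝ (fun y => U (t, y)) q (stdVec i)) x (stdVec i) = _
    rw [fderiv_clm_apply hd (differentiableAt_const _)]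
    simp
  rw [iteratedFDeriv_two_apply]
  simp only [EuclideanSpace.basisFun_apply, Matrix.cons_val_zero, Matrix.cons_val_one]
  rw [← h2, dirDeriv_slice hU, dirDeriv_slice (hU.dirDeriv _)]

theorem norm_gradient_sq {g : R3 → ℝ} (x : R3) (hg : DifferentiableAt ℝ g x) :
    ‖gradient g x‖ ^ 2 = ∑ i, dirDeriv (stdVec i) g x ^ 2 := by
  rw [EuclideanSpace.real_norm_sq_eq]
  refine Finset.sum_congr rfl fun i _ => ?_
  congr 1
  have h := congrArg (fun L : R3 →L[ℝ] ℝ => L (stdVec i)) hg.hasGradientAt.hasFDerivAt.fderiv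
  simp only [InnerProductSpace.toDual_apply_apply] at h
  unfold dirDeriv
  rw [h, EuclideanSpace.inner_single_right]
  simp only [conj_trivial, one_mul]

/-! ### The free wave with given Schwartz data -/

/-- The solution of the free wave equation with data `(g₀, g₁)`, by Kirchhoff's formula. -/
noncomputable def freeWave (g₀ g₁ : R3 → ℝ) (p : ℝ × R3) : ℝ :=
  dirDeriv ((1 : ℝ), (0 : R3)) (kirchhoff g₀) p + kirchhoff g₁ p

theorem dominatedBy_freeWave (g₀ g₁ : 𝓢(R3, ℝ)) (m : ℕ) :
    DominatedBy (coneWeight m) (freeWave g₀ g₁) :=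
  ((dominatedBy_kirchhoff g₀ m).dirDeriv _).add (dominatedBy_kirchhoff g₁ m)

theorem dalembertian_freeWave {g₀ g₁ : R3 → ℝ} (h₀ : ContDiff ℝ ∞ g₀) (h₁ : ContDiff ℝ ∞ g₁)
    (p : ℝ × R3) : dalembertian (freeWave g₀ g₁) p = 0 := by
  unfold freeWave
  rw [dalembertian_add ((contDiff_kirchhoff h₀).dirDeriv _) (contDiff_kirchhoff h₁),
    dalembertian_dirDeriv_eq_zero (contDiff_kirchhoff h₀) (dalembertian_kirchhoff h₀),
    dalembertian_kirchhoff h₁, add_zero]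

theorem freeWave_initial {g₀ : R3 → ℝ} (g₁ : R3 → ℝ) (h₀ : ContDiff ℝ ∞ g₀) (x : R3) :
    freeWave g₀ g₁ (0, x) = g₀ x := by
  simp [freeWave, dirDeriv_kirchhoff_initial h₀, kirchhoff_initial]

/-- At time zero the wave equation gives `∂ₜ² (kirchhoff g₀) = Δ (kirchhoff g₀) = 0`. -/
theorem dirDeriv_freeWave_initial {g₀ g₁ : R3 → ℝ} (h₀ : ContDiff ℝ ∞ g₀) (h₁ : ContDiff ℝ ∞ g₁)
    (x : R3) : dirDeriv ((1 : ℝ), (0 : R3)) (freeWave g₀ g₁) (0, x) = g₁ x := by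
  have hk := contDiff_kirchhoff h₀
  have h2 : ∀ i : Fin 3, dirDeriv ((0 : ℝ), stdVec i)
      (dirDeriv ((0 : ℝ), stdVec i) (kirchhoff g₀)) (0, x) = 0 := fun i => by
    have h3 : dirDeriv (stdVec i) (fun y => kirchhoff g₀ (0, y)) = fun _ => 0 := by
      ext y; simp [kirchhoff_initial, dirDeriv]
    rw [dirDeriv_slice hk] at h3
    have h4 := congrFun (dirDeriv_slice (hk.dirDeriv ((0 : ℝ), stdVec i)) 0 (stdVec i)) x
    rw [h3] at h4
    rw [← h4]
    simp [dirDeriv]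
  have h5 := dalembertian_kirchhoff h₀ (0, x)
  unfold dalembertian at h5
  simp only [h2, Finset.sum_const_zero, sub_zero] at h5
  change dirDeriv _ (fun p => dirDeriv ((1 : ℝ), (0 : R3)) (kirchhoff g₀) p + kirchhoff g₁ p) _ = _
  rw [dirDeriv_add (hk.dirDeriv _) (contDiff_kirchhoff h₁)]
  simp only
  rw [h5, dirDeriv_kirchhoff_initial h₁, zero_add]

theorem isFreeWave_freeWave (g₀ g₁ : 𝓢(R3, ℝ)) :
    IsFreeWave (fun t x => freeWave g₀ g₁ (t, x)) where
  smooth := (dominatedBy_freeWave g₀ g₁ 0).smooth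
  equation t x := by
    rw [waveOp_eq_dalembertian (dominatedBy_freeWave g₀ g₁ 0).smooth]
    exact dalembertian_freeWave (g₀.smooth ⊤) (g₁.smooth ⊤) _
  initial := ⟨g₀, fun x => freeWave_initial _ (g₀.smooth ⊤) x⟩
  initial_deriv := ⟨g₁, fun x => by
    rw [timeDeriv_eq_iterate_dirDeriv (dominatedBy_freeWave g₀ g₁ 0).smooth]
    exact dirDeriv_freeWave_initial (g₀.smooth ⊤) (g₁.smooth ⊤) x⟩

/-! ### Sobolev bounds and Schwartz slices -/

/-- In polar coordinates the Jacobian `r²` is absorbed by `r ≤ (1 + |t|) (1 + ||t| - r|)`, which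
leaves the integral of `(1 + |s|)⁻²` over the line. -/
theorem exists_lintegral_coneWeight_sq_le : ∃ C : ℝ≥0∞, C ≠ ⊤ ∧ ∀ t : ℝ,
    ∫⁻ x, ENNReal.ofReal (coneWeight 2 (t, x)) ^ 2 ≤ C := by
  have hint : ∫⁻ s : ℝ, ENNReal.ofReal (((1 + |s|) ^ 2)⁻¹) < ⊤ := by
    have h := integrable_one_add_norm (E := ℝ) (μ := volume) (r := 2) (by simp)
    have h2 : (fun y : ℝ => (1 + ‖y‖) ^ (-2 : ℝ)) = fun y => ((1 + |y|) ^ 2)⁻¹ := by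
      ext y
      rw [Real.rpow_neg (by positivity), Real.norm_eq_abs]
      norm_cast
    rw [h2] at h
    exact h.lintegral_lt_top
  refine ⟨(volume : Measure R3).toSphere univ * ∫⁻ s : ℝ, ENNReal.ofReal (((1 + |s|) ^ 2)⁻¹),
    ENNReal.mul_ne_top toSphere_univ_ne_top hint.ne, fun t => ?_⟩
  have hm : Measurable fun x => ENNReal.ofReal (coneWeight 2 (t, x)) ^ 2 := by
    unfold coneWeight
    fun_prop
  rw [lintegral_polar hm]
  refine mul_le_mul' le_rfl ?_
  have hshift := lintegral_sub_left_eq_self (μ := (volume : Measure ℝ))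
    (fun s : ℝ => ENNReal.ofReal (((1 + |s|) ^ 2)⁻¹)) |t|
  rw [← hshift]
  refine (setLIntegral_mono' measurableSet_Ioi fun r hr => ?_).trans (setLIntegral_le_lintegral _ _)
  have hr0 : 0 < r := hr
  have h1 : ∫⁻ θ, ENNReal.ofReal (coneWeight 2 (t, r • θ)) ^ 2 ∂sphereMeasure =
      ∫⁻ _, ENNReal.ofReal (((1 + |t|)⁻¹ * ((1 + |(|t| - r)|) ^ 2)⁻¹) ^ 2) ∂sphereMeasure := by
    refine lintegral_congr_ae ?_
    filter_upwards [ae_sphereMeasure] with θ hθ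
    simp only [coneWeight]
    rw [norm_smul, mem_sphere_zero_iff_norm.1 hθ, mul_one, Real.norm_of_nonneg hr0.le,
      ENNReal.ofReal_pow (by positivity)]
  rw [h1, lintegral_const, measure_univ, mul_one, ← ENNReal.ofReal_mul (by positivity)]
  refine ENNReal.ofReal_le_ofReal ?_
  set a := |(|t| - r)| with ha
  have hr1 : r ≤ (1 + |t|) * (1 + a) := by
    have : r - |t| ≤ a := by rw [ha, abs_sub_comm]; exact le_abs_self _
    nlinarith [abs_nonneg t, abs_nonneg (|t| - r)]
  have ha0 : 0 ≤ a := abs_nonneg _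
  have ht0 : 0 < 1 + |t| := by positivity
  calc r ^ 2 * ((1 + |t|)⁻¹ * ((1 + a) ^ 2)⁻¹) ^ 2
      ≤ ((1 + |t|) * (1 + a)) ^ 2 * ((1 + |t|)⁻¹ * ((1 + a) ^ 2)⁻¹) ^ 2 := by gcongr
    _ = ((1 + a) ^ 2)⁻¹ := by field_simp

/-- The `L²` norms of the light cone weights are bounded uniformly in time. -/
theorem exists_sobolevNorm_le (n : ℕ) : ∃ B : ℝ≥0∞, B ≠ ⊤ ∧ ∀ (t A : ℝ) (g : R3 → ℝ), 0 ≤ A →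
    (∀ k ≤ n, ∀ x, ‖iteratedFDeriv ℝ k g x‖ ≤ A * coneWeight 2 (t, x)) →
    sobolevNorm n g ≤ ENNReal.ofReal A * B := by
  obtain ⟨C, hC, hCt⟩ := exists_lintegral_coneWeight_sq_le
  refine ⟨((n + 1 : ℕ) * C) ^ (1 / 2 : ℝ), ENNReal.rpow_ne_top_of_nonneg (by norm_num)
    (ENNReal.mul_ne_top (by simp) hC), fun t A g hA h => ?_⟩
  have h1 : ∀ k ∈ Finset.range (n + 1), ∫⁻ x, ‖iteratedFDeriv ℝ k g x‖ₑ ^ 2 ≤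
      ENNReal.ofReal A ^ 2 * C := fun k hk => by
    calc _ ≤ ∫⁻ x, ENNReal.ofReal A ^ 2 * ENNReal.ofReal (coneWeight 2 (t, x)) ^ 2 := by
          refine lintegral_mono fun x => ?_
          rw [← mul_pow, ← ENNReal.ofReal_mul hA, ← ofReal_norm]
          gcongr
          exact h k (Nat.lt_succ_iff.1 (Finset.mem_range.1 hk)) x
      _ = ENNReal.ofReal A ^ 2 * ∫⁻ x, ENNReal.ofReal (coneWeight 2 (t, x)) ^ 2 :=
          lintegral_const_mul' _ _ (by simp)
      _ ≤ _ := by gcongr; exact hCt t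
  have h2 : ENNReal.ofReal A = (ENNReal.ofReal A ^ 2) ^ (1 / 2 : ℝ) := by
    rw [← ENNReal.rpow_natCast, ← ENNReal.rpow_mul]
    norm_num
  rw [h2, ← ENNReal.mul_rpow_of_nonneg _ _ (by norm_num)]
  unfold sobolevNorm
  refine ENNReal.rpow_le_rpow ((Finset.sum_le_sum h1).trans (le_of_eq ?_)) (by norm_num)
  rw [Finset.sum_const, Finset.card_range, nsmul_eq_mul]
  ring

theorem one_add_norm_le_mul_coneWeight (m : ℕ) (t : ℝ) (x : R3) :
    (1 + ‖x‖) ^ m * coneWeight m (t, x) ≤ (1 + |t|) ^ m := by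
  have h1 : 1 + ‖x‖ ≤ (1 + |t|) * (1 + |(|t| - ‖x‖)|) := by
    have : ‖x‖ - |t| ≤ |(|t| - ‖x‖)| := by rw [abs_sub_comm]; exact le_abs_self _
    nlinarith [abs_nonneg t, abs_nonneg (|t| - ‖x‖)]
  have h2 : coneWeight m (t, x) ≤ ((1 + |(|t| - ‖x‖)|) ^ m)⁻¹ :=
    mul_le_of_le_one_left (by positivity) (inv_le_one_of_one_le₀ (by simp))
  calc _ ≤ ((1 + |t|) * (1 + |(|t| - ‖x‖)|)) ^ m * ((1 + |(|t| - ‖x‖)|) ^ m)⁻¹ := by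
        gcongr
        exact (coneWeight_pos _ _).le
    _ = _ := by rw [mul_pow]; field_simp

theorem exists_schwartz_slice {U : ℝ × R3 → ℝ} (hU : ∀ m, DominatedBy (coneWeight m) U) (t : ℝ) :
    ∃ φ : 𝓢(R3, ℝ), ∀ x, U (t, x) = φ x := by
  refine ⟨⟨fun x => U (t, x), (hU 0).smooth.comp (contDiff_prodMk_right t), fun k n => ?_⟩,
    fun x => rfl⟩
  obtain ⟨A, hA1, hA⟩ := (hU k).exists_uniform_bound (fun p => (coneWeight_pos k p).le) n
  refine ⟨A * (1 + |t|) ^ k, fun x => ?_⟩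
  have h1 := (norm_iteratedFDeriv_slice_le (hU 0).smooth n t x).trans (hA n le_rfl (t, x))
  calc ‖x‖ ^ k * _ ≤ (1 + ‖x‖) ^ k * (A * coneWeight k (t, x)) := by
        gcongr
        linarith
    _ = A * ((1 + ‖x‖) ^ k * coneWeight k (t, x)) := by ring
    _ ≤ _ := by
        gcongr
        exact one_add_norm_le_mul_coneWeight k t x

theorem DominatedBy.iSup_sobolevNorm_lt_top {U : ℝ × R3 → ℝ} (hU : DominatedBy (coneWeight 2) U)
    (n : ℕ) : (⨆ t : ℝ, sobolevNorm n (fun x => U (t, x))) < ⊤ := by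
  obtain ⟨B, hB, h⟩ := exists_sobolevNorm_le n
  obtain ⟨A, hA1, hA⟩ := hU.exists_uniform_bound (fun p => (coneWeight_pos 2 p).le) n
  refine (iSup_le fun t => h t A _ (by linarith) fun k hk x =>
    (norm_iteratedFDeriv_slice_le hU.smooth k t x).trans (hA k hk _)).trans_lt ?_
  exact ENNReal.mul_lt_top (by simp) hB.lt_top

theorem DominatedBy.exists_decay {U : ℝ × R3 → ℝ} (hU : DominatedBy (coneWeight 0) U) (k n : ℕ) :
    ∃ C : ℝ, ∀ t : ℝ, t ≠ 0 → ∀ x : R3,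
      ‖iteratedFDeriv ℝ n (timeDeriv k (fun s y => U (s, y)) t) x‖ ≤ C * |t|⁻¹ := by
  have hk := hU.iterate_dirDeriv ((1 : ℝ), (0 : R3)) k
  obtain ⟨A, hA1, hA⟩ := hk.exists_uniform_bound (fun p => (coneWeight_pos 0 p).le) n
  refine ⟨A, fun t ht x => ?_⟩
  rw [show timeDeriv k (fun s y => U (s, y)) t = fun y => _ from
    funext fun y => timeDeriv_eq_iterate_dirDeriv hU.smooth k t y]
  refine ((norm_iteratedFDeriv_slice_le hk.smooth n t x).trans (hA n le_rfl _)).trans ?_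
  have h1 : coneWeight 0 (t, x) ≤ |t|⁻¹ := (coneWeight_le_inv 0 (t, x)).trans
    (inv_anti₀ (abs_pos.2 ht) (by simp))
  gcongr

theorem tendsto_sobolevNorm_of_dominatedBy {R : ℝ × R3 → ℝ}
    (hR : DominatedBy (fun p => coneWeight 2 p * coneWeight 2 p) R) (n : ℕ) {l : Filter ℝ}
    (hl : Tendsto (fun t : ℝ => |t|) l atTop) :
    Tendsto (fun t => sobolevNorm n (fun x => R (t, x))) l (𝓝 0) := by
  obtain ⟨B, hB, h⟩ := exists_sobolevNorm_le n
  obtain ⟨A, hA1, hA⟩ := hR.exists_uniform_bound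
    (fun p => mul_nonneg (coneWeight_pos 2 p).le (coneWeight_pos 2 p).le) n
  have hle : ∀ t, sobolevNorm n (fun x => R (t, x)) ≤ ENNReal.ofReal (A * (1 + |t|)⁻¹) * B := by
    intro t
    refine h t _ _ (by positivity) fun k hk x =>
      (norm_iteratedFDeriv_slice_le hR.smooth k t x).trans ((hA k hk _).trans ?_)
    rw [mul_assoc]
    gcongr
    · exact (coneWeight_pos 2 _).le
    · exact coneWeight_le_inv 2 (t, x)
  have hlim : Tendsto (fun t => ENNReal.ofReal (A * (1 + |t|)⁻¹) * B) l (𝓝 0) := by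
    have h1 : Tendsto (fun t : ℝ => A * (1 + |t|)⁻¹) l (𝓝 0) := by
      have := (tendsto_inv_atTop_zero.comp (tendsto_atTop_add_const_left l 1 hl)).const_mul A
      simpa using this
    have h2 := ENNReal.tendsto_ofReal h1
    rw [ENNReal.ofReal_zero] at h2
    have h3 := ENNReal.Tendsto.mul_const (b := B) h2 (Or.inr hB)
    simpa using h3
  exact tendsto_of_tendsto_of_tendsto_of_le_of_le tendsto_const_nhds hlim (fun _ => zero_le) hle

/-- Hadamard's lemma: a smooth function on the line vanishing at zero is a smooth multiple of the
variable. -/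
theorem exists_smooth_quotient {R : ℝ → ℝ} (hR : ContDiff ℝ ∞ R) (h0 : R 0 = 0) :
    ∃ Q : ℝ → ℝ, ContDiff ℝ ∞ Q ∧ Q 0 = deriv R 0 ∧ ∀ s, R s = s * Q s := by
  have hR' : ContDiff ℝ ∞ (deriv R) := ((contDiff_infty_iff_deriv).1 hR).2
  have hG : ContDiff ℝ ∞ (fun q : ℝ × ℝ => deriv R (q.1 * q.2)) :=
    hR'.comp (contDiff_fst.mul contDiff_snd)
  have hint : ∀ s, ∫ r in Icc (0 : ℝ) 1, deriv R (r * s) = ∫ r in (0 : ℝ)..1, deriv R (r * s) :=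
    fun s => by rw [intervalIntegral.integral_of_le zero_le_one, integral_Icc_eq_integral_Ioc]
  refine ⟨fun s => ∫ r in Icc (0 : ℝ) 1, deriv R (r * s),
    contDiff_parametric_integral (μ := volume.restrict (Icc (0 : ℝ) 1)) isCompact_Icc
      (ae_restrict_mem measurableSet_Icc) hG, by simp, fun s => ?_⟩
  simp only
  rw [hint, ← intervalIntegral.integral_const_mul]
  have h1 : ∀ r ∈ uIcc (0 : ℝ) 1, HasDerivAt (fun r => R (r * s)) (s * deriv R (r * s)) r := by
    intro r _
    have h2 := (hR.differentiable (by simp) (r * s)).hasDerivAt.comp r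
      ((hasDerivAt_id r).mul_const s)
    refine h2.congr_deriv ?_
    simp [mul_comm]
  rw [intervalIntegral.integral_eq_sub_of_hasDerivAt h1
    ((continuous_const.mul (hR'.continuous.comp (by fun_prop))).intervalIntegrable _ _)]
  simp [h0]

/-- If `Ψ(s) = s + O(s²)` at zero, then `Ψ(V) - V` is quadratic in `V`, so its Sobolev norms decay
like the sup norm of `V`. -/
theorem scatters_comp {g₀ g₁ : 𝓢(R3, ℝ)} {Ψ : ℝ → ℝ} (hΨ : ContDiff ℝ ∞ Ψ) (h0 : Ψ 0 = 0)
    (h1 : deriv Ψ 0 = 1) : Scatters (fun t x => Ψ (freeWave g₀ g₁ (t, x))) := by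
  set V := freeWave g₀ g₁
  have hV : DominatedBy (coneWeight 2) V := dominatedBy_freeWave g₀ g₁ 2
  refine ⟨fun t x => V (t, x), isFreeWave_freeWave g₀ g₁, fun n l hl => ?_⟩
  have habs : Tendsto (fun t : ℝ => |t|) l atTop := by
    rcases hl with rfl | rfl
    · exact tendsto_abs_atTop_atTop
    · exact tendsto_abs_atBot_atTop
  have hRs : ContDiff ℝ ∞ (fun s => Ψ s - s) := hΨ.sub contDiff_id
  obtain ⟨Q, hQ, hQ0, hQR⟩ := exists_smooth_quotient hRs (by simp [h0])
  have hQ0' : Q 0 = 0 := by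
    rw [hQ0, deriv_fun_sub (hΨ.differentiable (by simp) 0) differentiableAt_fun_id, h1]
    simp
  have hpos : ∀ p, 0 ≤ coneWeight 2 p := fun p => (coneWeight_pos 2 p).le
  have hR : DominatedBy (fun p => coneWeight 2 p * coneWeight 2 p) (fun p => Ψ (V p) - V p) := by
    have := hV.mul hpos hpos (hV.comp hpos (coneWeight_le_one 2) hQ hQ0')
    simpa only [← hQR] using this
  have hU : ContDiff ℝ ∞ (fun p => Ψ (V p)) := hΨ.comp hV.smooth
  refine ⟨tendsto_sobolevNorm_of_dominatedBy hR n habs, ?_⟩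
  have h2 := tendsto_sobolevNorm_of_dominatedBy (hR.dirDeriv ((1 : ℝ), (0 : R3))) n habs
  refine h2.congr fun t => ?_
  congr 1
  ext x
  rw [timeDeriv_eq_iterate_dirDeriv hU, timeDeriv_eq_iterate_dirDeriv hV.smooth,
    dirDeriv_sub hU hV.smooth]
  rfl

/-! ### The linearizing change of variable -/

/-- The integrating factor `exp (-∫₀ˢ f)`. -/
noncomputable def nirenbergWeight (f : ℝ → ℝ) (s : ℝ) : ℝ := Real.exp (-∫ r in (0 : ℝ)..s, f r)

/-- Nirenberg's change of variable `Φ`, with `Φ(0) = 0`, `Φ'(0) = 1` and `Φ'' + f Φ' = 0`. -/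
noncomputable def nirenberg (f : ℝ → ℝ) (s : ℝ) : ℝ := ∫ r in (0 : ℝ)..s, nirenbergWeight f r

/-- The inverse of `nirenberg f`; it is only meaningful on the range of `nirenberg f`. -/
noncomputable def nirenbergInv (f : ℝ → ℝ) : ℝ → ℝ := Function.invFun (nirenberg f)

theorem nirenbergWeight_pos (f : ℝ → ℝ) (s : ℝ) : 0 < nirenbergWeight f s := Real.exp_pos _

theorem nirenbergWeight_zero (f : ℝ → ℝ) : nirenbergWeight f 0 = 1 := by simp [nirenbergWeight]

theorem nirenberg_zero (f : ℝ → ℝ) : nirenberg f 0 = 0 := by simp [nirenberg]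

section

variable {f : ℝ → ℝ}

theorem hasDerivAt_nirenbergWeight (hf : Continuous f) (s : ℝ) :
    HasDerivAt (nirenbergWeight f) (-f s * nirenbergWeight f s) s := by
  have h := (intervalIntegral.integral_hasDerivAt_right (hf.intervalIntegrable 0 s)
    hf.stronglyMeasurable.stronglyMeasurableAtFilter hf.continuousAt).neg.exp
  exact h.congr_deriv (mul_comm _ _)

theorem continuous_nirenbergWeight (hf : Continuous f) : Continuous (nirenbergWeight f) :=
  continuous_iff_continuousAt.2 fun s => (hasDerivAt_nirenbergWeight hf s).continuousAt

theorem hasDerivAt_nirenberg (hf : Continuous f) (s : ℝ) :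
    HasDerivAt (nirenberg f) (nirenbergWeight f s) s :=
  intervalIntegral.integral_hasDerivAt_right
    ((continuous_nirenbergWeight hf).intervalIntegrable 0 s)
    (continuous_nirenbergWeight hf).stronglyMeasurable.stronglyMeasurableAtFilter
    (continuous_nirenbergWeight hf).continuousAt

theorem contDiff_nirenbergWeight (hf : ContDiff ℝ ∞ f) : ContDiff ℝ ∞ (nirenbergWeight f) := by
  have h : ContDiff ℝ ∞ (fun s => ∫ r in (0 : ℝ)..s, f r) := by
    refine contDiff_infty_iff_deriv.2 ⟨fun s => ?_, ?_⟩
    · exact (intervalIntegral.integral_hasDerivAt_right (hf.continuous.intervalIntegrable 0 s)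
        hf.continuous.stronglyMeasurable.stronglyMeasurableAtFilter
        hf.continuous.continuousAt).differentiableAt
    · rwa [show deriv (fun s => ∫ r in (0 : ℝ)..s, f r) = f from
        funext fun s => hf.continuous.deriv_integral f 0 s]
  exact h.neg.exp

theorem contDiff_nirenberg (hf : ContDiff ℝ ∞ f) : ContDiff ℝ ∞ (nirenberg f) := by
  refine contDiff_infty_iff_deriv.2
    ⟨fun s => (hasDerivAt_nirenberg hf.continuous s).differentiableAt, ?_⟩
  rw [show deriv (nirenberg f) = nirenbergWeight f from
    funext fun s => (hasDerivAt_nirenberg hf.continuous s).deriv]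
  exact contDiff_nirenbergWeight hf

theorem strictMono_nirenberg (hf : Continuous f) : StrictMono (nirenberg f) :=
  strictMono_of_hasDerivAt_pos (hasDerivAt_nirenberg hf) fun s => nirenbergWeight_pos f s

theorem isOpenEmbedding_nirenberg (hf : ContDiff ℝ ∞ f) : IsOpenEmbedding (nirenberg f) := by
  refine .of_continuous_injective_isOpenMap (contDiff_nirenberg hf).continuous
    (strictMono_nirenberg hf.continuous).injective ?_
  refine isOpenMap_iff_nhds_le.2 fun s => ?_
  exact (((contDiff_nirenberg hf).contDiffAt.hasStrictDerivAt'
    (hasDerivAt_nirenberg hf.continuous s) (by simp)).map_nhds_eq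
      (nirenbergWeight_pos f s).ne').ge

theorem nirenbergInv_nirenberg (hf : Continuous f) (s : ℝ) :
    nirenbergInv f (nirenberg f s) = s :=
  Function.leftInverse_invFun (strictMono_nirenberg hf).injective s

theorem nirenbergInv_zero (hf : Continuous f) : nirenbergInv f 0 = 0 := by
  simpa [nirenberg_zero] using nirenbergInv_nirenberg hf 0

theorem zero_mem_range_nirenberg (f : ℝ → ℝ) : (0 : ℝ) ∈ range (nirenberg f) :=
  ⟨0, nirenberg_zero f⟩

theorem contDiffAt_nirenbergInv (hf : ContDiff ℝ ∞ f) {y : ℝ} (hy : y ∈ range (nirenberg f)) :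
    ContDiffAt ℝ ∞ (nirenbergInv f) y := by
  have ho := isOpenEmbedding_nirenberg hf
  let e := ho.toOpenPartialHomeomorph
  obtain ⟨s, rfl⟩ := hy
  have hs : e.symm (nirenberg f s) = s := ho.toOpenPartialHomeomorph_left_inv
  have hc : ContDiffAt ℝ ∞ e.symm (nirenberg f s) := by
    refine e.contDiffAt_symm_deriv (nirenbergWeight_pos f s).ne' (by simp [e]) ?_ ?_
    · rw [hs]; simpa [e] using hasDerivAt_nirenberg hf.continuous s
    · rw [hs]; simpa [e] using (contDiff_nirenberg hf).contDiffAt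
  refine hc.congr_of_eventuallyEq ?_
  filter_upwards [ho.isOpen_range.mem_nhds ⟨s, rfl⟩] with z hz
  obtain ⟨r, rfl⟩ := hz
  rw [nirenbergInv_nirenberg hf.continuous]
  exact (ho.toOpenPartialHomeomorph_left_inv (x := r)).symm

theorem deriv_nirenbergInv (hf : ContDiff ℝ ∞ f) {y : ℝ} (hy : y ∈ range (nirenberg f)) :
    deriv (nirenbergInv f) y = (nirenbergWeight f (nirenbergInv f y))⁻¹ := by
  have hd := ((contDiffAt_nirenbergInv hf hy).differentiableAt (by simp)).hasDerivAt
  obtain ⟨s, rfl⟩ := hy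
  have h1 := hd.comp s (hasDerivAt_nirenberg hf.continuous s)
  have h2 : nirenbergInv f ∘ nirenberg f = id :=
    funext fun s => nirenbergInv_nirenberg hf.continuous s
  rw [h2] at h1
  rw [nirenbergInv_nirenberg hf.continuous]
  exact eq_inv_of_mul_eq_one_left (h1.unique (hasDerivAt_id s))

theorem deriv_deriv_nirenbergInv (hf : ContDiff ℝ ∞ f) {y : ℝ} (hy : y ∈ range (nirenberg f)) :
    deriv (deriv (nirenbergInv f)) y = f (nirenbergInv f y) * deriv (nirenbergInv f) y ^ 2 := by
  have h1 : deriv (nirenbergInv f) =ᶠ[𝓝 y] fun y => (nirenbergWeight f (nirenbergInv f y))⁻¹ := by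
    filter_upwards [(isOpenEmbedding_nirenberg hf).isOpen_range.mem_nhds hy] with z hz
    exact deriv_nirenbergInv hf hz
  have hd := ((contDiffAt_nirenbergInv hf hy).differentiableAt (by simp)).hasDerivAt
  have hw := nirenbergWeight_pos f (nirenbergInv f y)
  have h2 := ((hasDerivAt_nirenbergWeight hf.continuous (nirenbergInv f y)).comp y hd).inv hw.ne'
  rw [h1.deriv_eq]
  refine (h2.deriv).trans ?_
  rw [deriv_nirenbergInv hf hy]
  simp only [Function.comp_apply]
  field_simp

/-- Near a compact subset of the range, the inverse of the change of variable agrees with a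
function that is smooth on the whole line. -/
theorem exists_extension_nirenbergInv (hf : ContDiff ℝ ∞ f) {K : Set ℝ} (hK : IsCompact K)
    (hKr : K ⊆ range (nirenberg f)) :
    ∃ Ψ : ℝ → ℝ, ContDiff ℝ ∞ Ψ ∧ ∀ y ∈ K, Ψ =ᶠ[𝓝 y] nirenbergInv f := by
  have ho := (isOpenEmbedding_nirenberg hf).isOpen_range
  obtain ⟨χ, h0, h1, -⟩ := exists_contMDiffMap_zero_one_nhds_of_isClosed (n := (⊤ : ℕ∞))
    (modelWithCornersSelf ℝ ℝ) ho.isClosed_compl hK.isClosed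
    (disjoint_compl_left_iff_subset.2 hKr)
  have hχ : ContDiff ℝ ∞ χ := χ.contMDiff.contDiff
  refine ⟨fun y => χ y * nirenbergInv f y, contDiff_iff_contDiffAt.2 fun y => ?_, fun y hy => ?_⟩
  · by_cases hy : y ∈ range (nirenberg f)
    · exact hχ.contDiffAt.mul (contDiffAt_nirenbergInv hf hy)
    · refine contDiffAt_const (c := (0 : ℝ)) |>.congr_of_eventuallyEq ?_
      filter_upwards [(eventually_nhdsSet_iff_forall.1 h0) y hy] with z hz
      rw [hz, zero_mul]
  · filter_upwards [(eventually_nhdsSet_iff_forall.1 h1) y hy] with z hz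
    rw [hz, one_mul]

/-- A free wave with values in the range of the change of variable is transformed into a solution
of the nonlinear equation. -/
theorem isSmoothSolution_nirenbergInv (hf : ContDiff ℝ ∞ f) {u₀ u₁ : R3 → ℝ} {V : ℝ × R3 → ℝ}
    (hV : ContDiff ℝ ∞ V) (hbox : ∀ p, dalembertian V p = 0)
    (h₀ : ∀ x, V (0, x) = nirenberg f (u₀ x))
    (h₁ : ∀ x, dirDeriv ((1 : ℝ), (0 : R3)) V (0, x) = nirenbergWeight f (u₀ x) * u₁ x)
    {I : Set ℝ} (hI : ∀ t ∈ I, ∀ x, V (t, x) ∈ range (nirenberg f)) :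
    IsSmoothSolution f u₀ u₁ I (fun t x => nirenbergInv f (V (t, x))) := by
  have hloc : ∀ (t : ℝ) (x : R3), V (t, x) ∈ range (nirenberg f) → ∃ Ψ : ℝ → ℝ,
      ContDiff ℝ ∞ Ψ ∧ Ψ =ᶠ[𝓝 (V (t, x))] nirenbergInv f ∧
      (fun p : ℝ × R3 => nirenbergInv f (V p)) =ᶠ[𝓝 (t, x)] fun p => Ψ (V p) := by
    intro t x h
    obtain ⟨Ψ, hΨ, hΨe⟩ := exists_extension_nirenbergInv hf (isCompact_singleton (x := V (t, x)))
      (singleton_subset_iff.2 h)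
    have h2 := hΨe _ rfl
    exact ⟨Ψ, hΨ, h2, (hV.continuous.continuousAt.eventually h2).mono fun p hp => hp.symm⟩
  have hmem₀ : ∀ x, V (0, x) ∈ range (nirenberg f) := fun x => ⟨u₀ x, (h₀ x).symm⟩
  have htime : ∀ (k : ℕ) (t : ℝ) (x : R3) {Ψ : ℝ → ℝ},
      (fun p : ℝ × R3 => nirenbergInv f (V p)) =ᶠ[𝓝 (t, x)] (fun p => Ψ (V p)) →
      timeDeriv k (fun t x => nirenbergInv f (V (t, x))) t x =
        timeDeriv k (fun t x => Ψ (V (t, x))) t x := by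
    intro k t x Ψ h
    have hc : ContinuousAt (fun s : ℝ => (s, x)) t := by fun_prop
    exact Filter.EventuallyEq.iteratedDeriv_eq k (hc.eventually h)
  have hspace : ∀ (t : ℝ) (x : R3) {Ψ : ℝ → ℝ},
      (fun p : ℝ × R3 => nirenbergInv f (V p)) =ᶠ[𝓝 (t, x)] (fun p => Ψ (V p)) →
      (fun y => nirenbergInv f (V (t, y))) =ᶠ[𝓝 x] fun y => Ψ (V (t, y)) := by
    intro t x Ψ h
    have hc : ContinuousAt (fun y : R3 => (t, y)) x := by fun_prop
    exact hc.eventually h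
  refine ⟨fun p hp => ?_, fun t ht x => ?_, fun x => ?_, fun x => ?_⟩
  · exact ((contDiffAt_nirenbergInv hf (hI p.1 hp.1 p.2)).comp p
      hV.contDiffAt).contDiffWithinAt
  · obtain ⟨Ψ, hΨ, hΨe, hUe⟩ := hloc t x (hI t ht x)
    have hU : ContDiff ℝ ∞ (fun p => Ψ (V p)) := hΨ.comp hV
    have hw : waveOp (fun t x => nirenbergInv f (V (t, x))) t x =
        waveOp (fun t x => Ψ (V (t, x))) t x := by
      unfold waveOp
      rw [htime 2 t x hUe]
      congr 1
      exact (InnerProductSpace.laplacian_congr_nhds (hspace t x hUe)).self_of_nhds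
    have hg : gradient (fun y => nirenbergInv f (V (t, y))) x =
        gradient (fun y => Ψ (V (t, y))) x := by
      unfold gradient
      rw [(hspace t x hUe).fderiv_eq]
    have hs : ContDiff ℝ ∞ (fun y => Ψ (V (t, y))) := hU.comp (contDiff_prodMk_right t)
    rw [hw, hg, htime 1 t x hUe, waveOp_eq_dalembertian hU, dalembertian_comp hΨ hV, hbox,
      timeDeriv_eq_iterate_dirDeriv hU, norm_gradient_sq x (hs.differentiable (by simp) x),
      hΨe.deriv.deriv_eq, hΨe.deriv_eq, deriv_deriv_nirenbergInv hf (hI t ht x)]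
    simp only [Function.iterate_one, dirDeriv_slice hU, dirDeriv_comp hΨ hV, hΨe.deriv_eq]
    simp only [mul_pow, ← Finset.mul_sum]
    ring
  · simp only [h₀]
    exact nirenbergInv_nirenberg hf.continuous _
  · obtain ⟨Ψ, hΨ, hΨe, hUe⟩ := hloc 0 x (hmem₀ x)
    have hU : ContDiff ℝ ∞ (fun p => Ψ (V p)) := hΨ.comp hV
    rw [htime 1 0 x hUe, timeDeriv_eq_iterate_dirDeriv hU]
    simp only [Function.iterate_one, dirDeriv_comp hΨ hV, hΨe.deriv_eq]
    rw [deriv_nirenbergInv hf (hmem₀ x), h₁, h₀, nirenbergInv_nirenberg hf.continuous,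
      inv_mul_cancel_left₀ (nirenbergWeight_pos f _).ne']

end

/-! ### Nonlinear functions of Schwartz functions -/

theorem SchwartzMap.dominatedBy (g : 𝓢(R3, ℝ)) (k : ℕ) :
    DominatedBy (fun x => ((1 + ‖x‖) ^ k)⁻¹) g where
  smooth := g.smooth ⊤
  bound N := by
    obtain ⟨A, -, hA⟩ := g.exists_bound_inv k N
    exact ⟨A, hA N le_rfl⟩

theorem exists_schwartz_of_dominatedBy {g : R3 → ℝ}
    (hg : ∀ k : ℕ, DominatedBy (fun x => ((1 + ‖x‖) ^ k)⁻¹) g) : ∃ φ : 𝓢(R3, ℝ), ⇑φ = g := by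
  refine ⟨⟨g, (hg 0).smooth, fun k n => ?_⟩, rfl⟩
  obtain ⟨A, hA1, hA⟩ := (hg k).exists_uniform_bound (fun p => by positivity) n
  refine ⟨A, fun x => ?_⟩
  calc ‖x‖ ^ k * _ ≤ (1 + ‖x‖) ^ k * (A * ((1 + ‖x‖) ^ k)⁻¹) := by
        gcongr
        · linarith
        · exact hA n le_rfl x
    _ = A := by field_simp

theorem inv_one_add_norm_pow_le_one (k : ℕ) (x : R3) : ((1 + ‖x‖) ^ k)⁻¹ ≤ 1 :=
  inv_le_one_of_one_le₀ (one_le_pow₀ (by linarith [norm_nonneg x]))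

theorem exists_schwartz_comp {Φ : ℝ → ℝ} (hΦ : ContDiff ℝ ∞ Φ) (h0 : Φ 0 = 0) (g : 𝓢(R3, ℝ)) :
    ∃ φ : 𝓢(R3, ℝ), ⇑φ = fun x => Φ (g x) :=
  exists_schwartz_of_dominatedBy fun k => (g.dominatedBy k).comp (fun x => by positivity)
    (inv_one_add_norm_pow_le_one k) hΦ h0

/-- Here `w` need not vanish at zero, so its value there is split off before
`exists_schwartz_comp` is used. -/
theorem exists_schwartz_comp_mul {w : ℝ → ℝ} (hw : ContDiff ℝ ∞ w) (g h : 𝓢(R3, ℝ)) :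
    ∃ φ : 𝓢(R3, ℝ), ⇑φ = fun x => w (g x) * h x := by
  have hw' : ContDiff ℝ ∞ (fun s => w s - w 0) := hw.sub contDiff_const
  obtain ⟨φ, hφ⟩ := exists_schwartz_comp hw' (by simp) g
  have h1 : ∃ ψ : 𝓢(R3, ℝ), ⇑ψ = fun x => φ x * h x :=
    exists_schwartz_of_dominatedBy fun k => by
      have := (φ.dominatedBy 0).mul (fun x => by positivity) (fun x => by positivity)
        (h.dominatedBy k)
      simpa using this
  obtain ⟨ψ, hψ⟩ := h1
  refine ⟨ψ + w 0 • h, ?_⟩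
  ext x
  have e1 := congrFun hψ x
  have e2 := congrFun hφ x
  simp only [add_apply, smul_apply, smul_eq_mul] at *
  rw [e1, e2]
  ring

/-! ### Global solutions -/

theorem coneWeight_one_le (p : ℝ × R3) : coneWeight 1 p ≤ (1 + ‖p‖)⁻¹ := by
  obtain ⟨t, x⟩ := p
  have h1 : ‖x‖ - |t| ≤ |(|t| - ‖x‖)| := by rw [abs_sub_comm]; exact le_abs_self _
  have ht := abs_nonneg t
  have ha := abs_nonneg (|t| - ‖x‖)
  have h2 : ‖((t, x) : ℝ × R3)‖ ≤ |t| + |(|t| - ‖x‖)| + |t| * |(|t| - ‖x‖)| := by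
    rw [Prod.norm_def]
    refine max_le ?_ ?_
    · rw [Real.norm_eq_abs]; nlinarith
    · change ‖x‖ ≤ _; nlinarith
  simp only [coneWeight, pow_one]
  rw [← mul_inv]
  refine inv_anti₀ (by positivity) ?_
  nlinarith

/-- Decay in time and away from the light cone together give decay at infinity of space-time. -/
theorem DominatedBy.tendsto_cocompact {U : ℝ × R3 → ℝ} (hU : DominatedBy (coneWeight 1) U) :
    Tendsto U (cocompact (ℝ × R3)) (𝓝 0) := by
  obtain ⟨C, hC⟩ := hU.bound 0
  have hC' : ∀ p, ‖U p‖ ≤ |C| * (1 + ‖p‖)⁻¹ := fun p => by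
    have := hC p
    rw [norm_iteratedFDeriv_zero] at this
    refine this.trans
      ((mul_le_mul_of_nonneg_right (le_abs_self C) (coneWeight_pos 1 p).le).trans ?_)
    exact mul_le_mul_of_nonneg_left (coneWeight_one_le p) (abs_nonneg C)
  refine squeeze_zero_norm hC' ?_
  have := (tendsto_inv_atTop_zero.comp (tendsto_atTop_add_const_left _ 1
    (tendsto_norm_cocompact_atTop (E := ℝ × R3)))).const_mul |C|
  simpa using this

/-- If the free wave stays in the range of the change of variable, then it stays in a compact
subset of it, and the transformed solution is global and disperses. -/
theorem global_solution_properties {f : ℝ → ℝ} (hf : ContDiff ℝ ∞ f) (g₀ g₁ : 𝓢(R3, ℝ))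
    (hr : ∀ p, freeWave g₀ g₁ p ∈ range (nirenberg f)) :
    (∀ t : ℝ, ∃ φ : 𝓢(R3, ℝ), ∀ x, nirenbergInv f (freeWave g₀ g₁ (t, x)) = φ x) ∧
    (∀ n : ℕ, (⨆ t : ℝ, sobolevNorm n (fun x => nirenbergInv f (freeWave g₀ g₁ (t, x)))) < ⊤) ∧
    (∀ k n : ℕ, ∃ C : ℝ, ∀ t : ℝ, t ≠ 0 → ∀ x : R3, ‖iteratedFDeriv ℝ n
      (timeDeriv k (fun s y => nirenbergInv f (freeWave g₀ g₁ (s, y))) t) x‖ ≤ C * |t|⁻¹) ∧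
    Scatters (fun t x => nirenbergInv f (freeWave g₀ g₁ (t, x))) := by
  have hV : ∀ m, DominatedBy (coneWeight m) (freeWave g₀ g₁) := dominatedBy_freeWave g₀ g₁
  have hK : IsCompact (insert 0 (range (freeWave g₀ g₁))) :=
    (hV 1).tendsto_cocompact.isCompact_insert_range_of_cocompact (hV 1).smooth.continuous
  obtain ⟨Ψ, hΨ, hΨe⟩ := exists_extension_nirenbergInv hf hK
    (insert_subset (zero_mem_range_nirenberg f) (range_subset_iff.2 hr))
  have h0 := hΨe 0 (mem_insert _ _)
  have hΨ0 : Ψ 0 = 0 := h0.self_of_nhds.trans (nirenbergInv_zero hf.continuous)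
  have hΨ1 : deriv Ψ 0 = 1 := by
    rw [h0.deriv_eq, deriv_nirenbergInv hf (zero_mem_range_nirenberg f),
      nirenbergInv_zero hf.continuous, nirenbergWeight_zero, inv_one]
  have heq : ∀ p, nirenbergInv f (freeWave g₀ g₁ p) = Ψ (freeWave g₀ g₁ p) := fun p =>
    (hΨe _ (mem_insert_of_mem _ (mem_range_self p))).self_of_nhds.symm
  have hU : ∀ m, DominatedBy (coneWeight m) (fun p => Ψ (freeWave g₀ g₁ p)) := fun m =>
    (hV m).comp (fun p => (coneWeight_pos m p).le) (coneWeight_le_one m) hΨ hΨ0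
  simp only [heq]
  exact ⟨exists_schwartz_slice hU, (hU 2).iSup_sobolevNorm_lt_top, (hU 0).exists_decay,
    scatters_comp hΨ hΨ0 hΨ1⟩

/-! ### The maximal interval of existence -/

/-- A nonempty compact set of times not containing `0` determines an open interval around `0`
which avoids it and whose finite end points belong to it. -/
theorem exists_timeInterval {B : Set ℝ} (hB : IsCompact B) (hne : B.Nonempty) (h0 : (0 : ℝ) ∉ B) :
    ∃ Tm Tp : EReal, Tm < 0 ∧ 0 < Tp ∧ (Tm ≠ ⊥ ∨ Tp ≠ ⊤) ∧
      (∀ t ∈ timeInterval Tm Tp, t ∉ B) ∧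
      ∀ T : ℝ, ((T : EReal) = Tm ∨ (T : EReal) = Tp) → T ∈ B := by
  have hright : ∃ Tp : EReal, 0 < Tp ∧ ((B ∩ Ici 0).Nonempty → Tp ≠ ⊤) ∧
      (∀ t : ℝ, 0 ≤ t → (t : EReal) < Tp → t ∉ B) ∧ ∀ T : ℝ, (T : EReal) = Tp → T ∈ B := by
    by_cases hn : (B ∩ Ici 0).Nonempty
    · obtain ⟨T, hT⟩ := (hB.inter_right isClosed_Ici).exists_isLeast hn
      have hT0 : 0 < T := lt_of_le_of_ne hT.1.2 fun h => h0 (h ▸ hT.1.1)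
      refine ⟨T, by exact_mod_cast hT0, fun _ => EReal.coe_ne_top T, fun t ht htT htB => ?_,
        fun S hS => ?_⟩
      · exact absurd (hT.2 ⟨htB, ht⟩) (not_le.2 (by exact_mod_cast htT))
      · rw [EReal.coe_injective hS]; exact hT.1.1
    · exact ⟨⊤, EReal.zero_lt_top, fun h => absurd h hn, fun t ht _ htB => hn ⟨t, htB, ht⟩,
        fun T hT => absurd hT (EReal.coe_ne_top T)⟩
  have hleft : ∃ Tm : EReal, Tm < 0 ∧ ((B ∩ Iic 0).Nonempty → Tm ≠ ⊥) ∧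
      (∀ t : ℝ, t ≤ 0 → Tm < (t : EReal) → t ∉ B) ∧ ∀ T : ℝ, (T : EReal) = Tm → T ∈ B := by
    by_cases hn : (B ∩ Iic 0).Nonempty
    · obtain ⟨T, hT⟩ := (hB.inter_right isClosed_Iic).exists_isGreatest hn
      have hT0 : T < 0 := lt_of_le_of_ne hT.1.2 fun h => h0 (h ▸ hT.1.1)
      refine ⟨T, by exact_mod_cast hT0, fun _ => EReal.coe_ne_bot T, fun t ht htT htB => ?_,
        fun S hS => ?_⟩
      · exact absurd (hT.2 ⟨htB, ht⟩) (not_le.2 (by exact_mod_cast htT))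
      · rw [EReal.coe_injective hS]; exact hT.1.1
    · exact ⟨⊥, EReal.bot_lt_zero, fun h => absurd h hn, fun t ht _ htB => hn ⟨t, htB, ht⟩,
        fun T hT => absurd hT (EReal.coe_ne_bot T)⟩
  obtain ⟨Tp, hp0, hpt, hpB, hpT⟩ := hright
  obtain ⟨Tm, hm0, hmt, hmB, hmT⟩ := hleft
  refine ⟨Tm, Tp, hm0, hp0, ?_, fun t ht => ?_, fun T hT => hT.elim (hmT T) (hpT T)⟩
  · obtain ⟨b, hb⟩ := hne
    rcases le_total 0 b with h | h
    · exact Or.inr (hpt ⟨b, hb, h⟩)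
    · exact Or.inl (hmt ⟨b, hb, h⟩)
  · rcases le_total 0 t with h | h
    · exact hpB t h ht.2
    · exact hmB t h ht.1

/-- The times at which the free wave leaves a neighbourhood of zero somewhere in space form a
compact set. -/
theorem DominatedBy.isCompact_exit_times {U : ℝ × R3 → ℝ} (hU : DominatedBy (coneWeight 1) U)
    {J : Set ℝ} (hJ : IsOpen J) (h0 : (0 : ℝ) ∈ J) : IsCompact {t : ℝ | ∃ x, U (t, x) ∉ J} := by
  have hZ : IsCompact {p : ℝ × R3 | U p ∉ J} := by
    have hcl : IsClosed {p : ℝ × R3 | U p ∉ J} :=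
      hJ.isClosed_compl.preimage hU.smooth.continuous
    have h1 : {p : ℝ × R3 | U p ∈ J} ∈ cocompact (ℝ × R3) :=
      hU.tendsto_cocompact (hJ.mem_nhds h0)
    obtain ⟨K, hK, hKs⟩ := mem_cocompact.1 h1
    refine hK.of_isClosed_subset hcl fun p hp => ?_
    by_contra hpK
    exact hp (hKs hpK)
  have h2 : {t : ℝ | ∃ x, U (t, x) ∉ J} = Prod.fst '' {p : ℝ × R3 | U p ∉ J} := by
    ext t
    simp
  rw [h2]
  exact hZ.image continuous_fst

/-! ### Ball averages and the `H^{3/2}` norm -/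

theorem setLIntegral_closedBall_scale {F : R3 → ℝ≥0∞} (hF : Measurable F) (x₀ : R3) {r : ℝ}
    (hr : 0 < r) : ∫⁻ y in Metric.closedBall (0 : R3) 1, F (x₀ + r • y) =
      ENNReal.ofReal (r ^ 3)⁻¹ * ∫⁻ x in Metric.closedBall x₀ r, F x := by
  rw [← lintegral_indicator Metric.isClosed_closedBall.measurableSet,
    ← lintegral_indicator Metric.isClosed_closedBall.measurableSet]
  set G : R3 → ℝ≥0∞ := (Metric.closedBall x₀ r).indicator F with hG
  have hGm : Measurable G := hF.indicator Metric.isClosed_closedBall.measurableSet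
  have h1 : ∀ y, (Metric.closedBall (0 : R3) 1).indicator (fun y => F (x₀ + r • y)) y =
      G (x₀ + r • y) := fun y => by
    have hiff : y ∈ Metric.closedBall (0 : R3) 1 ↔ x₀ + r • y ∈ Metric.closedBall x₀ r := by
      rw [mem_closedBall_zero_iff, mem_closedBall_iff_norm, add_sub_cancel_left, norm_smul,
        Real.norm_of_nonneg hr.le]
      exact ⟨fun h => by nlinarith, fun h => by nlinarith⟩
    by_cases hy : y ∈ Metric.closedBall (0 : R3) 1
    · rw [indicator_of_mem hy, hG, indicator_of_mem (hiff.1 hy)]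
    · rw [indicator_of_notMem hy, hG, indicator_of_notMem fun h => hy (hiff.2 h)]
  simp only [h1]
  have h2 : ∫⁻ y, G (x₀ + r • y) = ∫⁻ z, G (x₀ + z) ∂(Measure.map (r • ·) volume) := by
    rw [lintegral_map (by fun_prop) (by fun_prop)]
  rw [h2, Measure.map_addHaar_smul _ hr.ne', lintegral_smul_measure,
    lintegral_add_left_eq_self G x₀, smul_eq_mul]
  simp [abs_of_pos hr]

/-- The integral of `g(x₀ + r y)` over the unit ball: up to a constant factor, the average of `g`
over the ball of radius `r` around `x₀`. -/
noncomputable def ballIntegral (g : R3 → ℝ) (x₀ : R3) (r : ℝ) : ℝ :=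
  ∫ y in Metric.closedBall (0 : R3) 1, g (x₀ + r • y)

section

variable {g : R3 → ℝ} (x₀ : R3)

instance : IsFiniteMeasure ((volume : Measure R3).restrict (Metric.closedBall 0 1)) :=
  isFiniteMeasure_restrict.2 measure_closedBall_lt_top.ne

theorem ae_closedBall : ∀ᵐ y ∂(volume : Measure R3).restrict (Metric.closedBall 0 1),
    y ∈ Metric.closedBall (0 : R3) 1 :=
  ae_restrict_mem Metric.isClosed_closedBall.measurableSet

theorem integrableOn_closedBall_of_continuous {E : Type*} [NormedAddCommGroup E] {h : R3 → E}
    (hh : Continuous h) : Integrable h (volume.restrict (Metric.closedBall (0 : R3) 1)) :=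
  integrable_of_continuous_of_compact (isCompact_closedBall 0 1) ae_closedBall hh

theorem contDiff_ballIntegral (hg : ContDiff ℝ ∞ g) : ContDiff ℝ ∞ (ballIntegral g x₀) := by
  have hG : ContDiff ℝ ∞ (fun q : R3 × ℝ => g (x₀ + q.2 • q.1)) :=
    hg.comp (contDiff_const.add (contDiff_snd.smul contDiff_fst))
  exact contDiff_parametric_integral (isCompact_closedBall (0 : R3) 1) ae_closedBall hG

theorem deriv_ballIntegral (hg : ContDiff ℝ ∞ g) (r : ℝ) :
    deriv (ballIntegral g x₀) r =
      ∫ y in Metric.closedBall (0 : R3) 1, fderiv ℝ g (x₀ + r • y) y := by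
  have hG : ContDiff ℝ ∞ (fun q : R3 × ℝ => g (x₀ + q.2 • q.1)) :=
    hg.comp (contDiff_const.add (contDiff_snd.smul contDiff_fst))
  have h := dirDeriv_parametric_integral (isCompact_closedBall (0 : R3) 1) ae_closedBall hG
    (1 : ℝ) r
  change deriv (fun r => _) r = _
  rw [← fderiv_apply_one_eq_deriv]
  refine h.trans (integral_congr_ae (Eventually.of_forall fun y => ?_))
  have hc : HasDerivAt (fun s : ℝ => (y, s)) ((0 : R3), (1 : ℝ)) r :=
    (hasDerivAt_const _ _).prodMk (hasDerivAt_id _)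
  refine dirDeriv_eq_of_hasDerivAt (hG.differentiable (by simp) _) hc ?_
  have h1 : HasDerivAt (fun s : ℝ => x₀ + s • y) y r := by
    simpa using ((hasDerivAt_id r).smul_const y).const_add x₀
  exact (hg.differentiable (by simp) (x₀ + r • y)).hasFDerivAt.comp_hasDerivAt r h1

theorem integral_closedBall_clm (L : R3 →L[ℝ] ℝ) :
    ∫ y in Metric.closedBall (0 : R3) 1, L y = 0 := by
  have h : ∫ y in Metric.closedBall (0 : R3) 1, L y =
      ∫ y in Metric.closedBall (0 : R3) 1, L (-y) := by
    rw [← integral_indicator Metric.isClosed_closedBall.measurableSet,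
      ← integral_indicator Metric.isClosed_closedBall.measurableSet,
      ← integral_neg_eq_self]
    congr 1
    ext y
    simp [indicator]
  simp only [map_neg, integral_neg] at h
  linarith

/-- The Cauchy-Schwarz inequality against the constant function one. -/
theorem sq_lintegral_le {α : Type*} [MeasurableSpace α] {μ : Measure α} {h : α → ℝ≥0∞}
    (hh : AEMeasurable h μ) : (∫⁻ a, h a ∂μ) ^ 2 ≤ μ univ * ∫⁻ a, h a ^ 2 ∂μ := by
  have h1 := ENNReal.lintegral_mul_le_Lp_mul_Lq μ Real.HolderConjugate.two_two
    (f := fun _ => 1) (g := h) aemeasurable_const hh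
  simp only [Pi.mul_apply, one_mul, ENNReal.one_rpow, lintegral_const] at h1
  rw [← ENNReal.mul_rpow_of_nonneg _ _ (by norm_num)] at h1
  calc _ ≤ ((μ univ * ∫⁻ a, h a ^ (2 : ℝ) ∂μ) ^ (1 / 2 : ℝ)) ^ 2 := by gcongr
    _ = μ univ * ∫⁻ a, h a ^ (2 : ℝ) ∂μ := by
      rw [← ENNReal.rpow_natCast, ← ENNReal.rpow_mul]; norm_num
    _ = _ := by norm_cast

/-- Since `y` has mean zero over the unit ball, any constant may be subtracted from the gradient in
the formula for the radial derivative of the ball average. Averaging over the values of the gradient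
bounds the radial derivative by gradient differences. -/
theorem enorm_deriv_ballIntegral_sq_le (hg : ContDiff ℝ ∞ g) (r : ℝ) :
    ‖deriv (ballIntegral g x₀) r‖ₑ ^ 2 ≤ ∫⁻ z in Metric.closedBall (0 : R3) 1,
      ∫⁻ y in Metric.closedBall (0 : R3) 1,
        ‖fderiv ℝ g (x₀ + r • z) - fderiv ℝ g (x₀ + r • y)‖ₑ ^ 2 := by
  set κ := (volume : Measure R3) (Metric.closedBall 0 1) with hκ
  have hκ0 : κ ≠ 0 := (Metric.measure_closedBall_pos _ _ one_pos).ne'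
  have hκt : κ ≠ ⊤ := measure_closedBall_lt_top.ne
  have hD : Continuous (fderiv ℝ g) := hg.continuous_fderiv (by simp)
  have hz : ∀ z : R3, ‖deriv (ballIntegral g x₀) r‖ₑ ^ 2 ≤
      κ * ∫⁻ y in Metric.closedBall (0 : R3) 1,
        ‖fderiv ℝ g (x₀ + r • z) - fderiv ℝ g (x₀ + r • y)‖ₑ ^ 2 := by
    intro z
    have h1 : deriv (ballIntegral g x₀) r = ∫ y in Metric.closedBall (0 : R3) 1,
        (fderiv ℝ g (x₀ + r • y) - fderiv ℝ g (x₀ + r • z)) y := by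
      rw [deriv_ballIntegral x₀ hg]
      simp only [sub_apply]
      rw [integral_sub, integral_closedBall_clm, sub_zero]
      · exact integrableOn_closedBall_of_continuous (by fun_prop)
      · exact integrableOn_closedBall_of_continuous (by fun_prop)
    have h2 : ‖deriv (ballIntegral g x₀) r‖ₑ ≤ ∫⁻ y in Metric.closedBall (0 : R3) 1,
        ‖fderiv ℝ g (x₀ + r • z) - fderiv ℝ g (x₀ + r • y)‖ₑ := by
      rw [h1]
      refine (enorm_integral_le_lintegral_enorm _).trans (lintegral_mono_ae ?_)
      filter_upwards [ae_closedBall] with y hy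
      rw [← ofReal_norm, ← ofReal_norm]
      refine ENNReal.ofReal_le_ofReal ((ContinuousLinearMap.le_opNorm _ _).trans ?_)
      rw [norm_sub_rev]
      exact mul_le_of_le_one_right (norm_nonneg _) (mem_closedBall_zero_iff.1 hy)
    have h3 := sq_lintegral_le (μ := volume.restrict (Metric.closedBall (0 : R3) 1))
      (h := fun y => ‖fderiv ℝ g (x₀ + r • z) - fderiv ℝ g (x₀ + r • y)‖ₑ)
      (Continuous.aemeasurable (by fun_prop))
    rw [Measure.restrict_apply_univ] at h3
    exact (pow_le_pow_left₀ zero_le h2 2).trans h3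
  have h4 : κ * ‖deriv (ballIntegral g x₀) r‖ₑ ^ 2 ≤
      κ * ∫⁻ z in Metric.closedBall (0 : R3) 1, ∫⁻ y in Metric.closedBall (0 : R3) 1,
        ‖fderiv ℝ g (x₀ + r • z) - fderiv ℝ g (x₀ + r • y)‖ₑ ^ 2 := by
    rw [← lintegral_const_mul' κ _ hκt]
    calc _ = ∫⁻ _ in Metric.closedBall (0 : R3) 1, ‖deriv (ballIntegral g x₀) r‖ₑ ^ 2 := by
          rw [setLIntegral_const, mul_comm]
      _ ≤ _ := lintegral_mono fun z => hz z
  exact (ENNReal.mul_le_mul_iff_right hκ0 hκt).1 h4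

/-- The weight `r⁻⁵` collects the pairs of points in the balls of radius `r` into the kernel
`|x - y|⁻⁴`. -/
theorem lintegral_indicator_inv_pow_le (p q : R3) (hpq : p ≠ q) (ρ : ℝ) :
    ∫⁻ r in Ioc 0 ρ, {r : ℝ | ‖p - x₀‖ ≤ r ∧ ‖q - x₀‖ ≤ r}.indicator
      (fun r => ENNReal.ofReal ((r ^ 5)⁻¹)) r ≤ 64 / ‖p - q‖ₑ ^ 4 := by
  have hd : 0 < ‖p - q‖ := norm_pos_iff.2 (sub_ne_zero.2 hpq)
  set d := ‖p - q‖ with hd'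
  have h1 : ∫⁻ r in Ioc 0 ρ, {r : ℝ | ‖p - x₀‖ ≤ r ∧ ‖q - x₀‖ ≤ r}.indicator
      (fun r => ENNReal.ofReal ((r ^ 5)⁻¹)) r ≤
      ∫⁻ r in Ioi (d / 4), ENNReal.ofReal (r ^ (-5 : ℝ)) := by
    refine (setLIntegral_le_lintegral _ _).trans ?_
    rw [← lintegral_indicator measurableSet_Ioi]
    refine lintegral_mono fun r => ?_
    refine indicator_le (s := {r : ℝ | ‖p - x₀‖ ≤ r ∧ ‖q - x₀‖ ≤ r}) (fun r hr => ?_) r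
    have h2 : d ≤ ‖p - x₀‖ + ‖q - x₀‖ := by
      rw [hd', ← sub_sub_sub_cancel_right p q x₀]; exact norm_sub_le _ _
    have h3 : r ∈ Ioi (d / 4) := by
      have := hr.1; have := hr.2
      exact mem_Ioi.2 (by linarith)
    have hr0 : 0 < r := lt_trans (by positivity) (mem_Ioi.1 h3)
    rw [indicator_of_mem h3]
    refine le_of_eq (congrArg _ ?_)
    rw [Real.rpow_neg hr0.le]
    norm_cast
  refine h1.trans ?_
  rw [← ofReal_integral_eq_lintegral_ofReal (integrableOn_Ioi_rpow_of_lt (by norm_num)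
    (by positivity)) ((ae_restrict_mem measurableSet_Ioi).mono fun r hr =>
      Real.rpow_nonneg (lt_trans (by positivity) (mem_Ioi.1 hr)).le _),
    integral_Ioi_rpow_of_lt (by norm_num) (by positivity), ← ofReal_norm, ← hd',
    ← ENNReal.ofReal_pow hd.le, show (64 : ℝ≥0∞) = ENNReal.ofReal 64 by norm_num,
    ← ENNReal.ofReal_div_of_pos (by positivity)]
  refine ENNReal.ofReal_le_ofReal (le_of_eq ?_)
  rw [show (-5 : ℝ) + 1 = -((4 : ℕ) : ℝ) by norm_num, Real.rpow_neg (by positivity),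
    Real.rpow_natCast]
  field_simp
  norm_num

/-- The square of the `H^{3/2}` norm on a ball, as in `threeHalvesNormBall`. -/
noncomputable def threeHalvesSq (x₀ : R3) (ρ : ℝ) (g : R3 → ℝ) : ℝ≥0∞ :=
  (∫⁻ x in Metric.closedBall x₀ ρ, ‖g x‖ₑ ^ 2) +
    (∫⁻ x in Metric.closedBall x₀ ρ, ‖fderiv ℝ g x‖ₑ ^ 2) +
    ∫⁻ x in Metric.closedBall x₀ ρ, ∫⁻ y in Metric.closedBall x₀ ρ,
      ‖fderiv ℝ g x - fderiv ℝ g y‖ₑ ^ 2 / ‖x - y‖ₑ ^ 4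

/-- The scale invariant energy of the ball averages is controlled by the `H^{3/2}` norm. -/
theorem lintegral_deriv_ballIntegral_le (hg : ContDiff ℝ ∞ g) (ρ : ℝ) :
    ∫⁻ r in Ioc 0 ρ, ENNReal.ofReal r * ‖deriv (ballIntegral g x₀) r‖ₑ ^ 2 ≤
      64 * threeHalvesSq x₀ ρ g := by
  have hD : Continuous (fderiv ℝ g) := hg.continuous_fderiv (by simp)
  set H : R3 × R3 → ℝ≥0∞ := fun q => ‖fderiv ℝ g q.1 - fderiv ℝ g q.2‖ₑ ^ 2 with hH
  have hHm : Measurable H := by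
    have : Continuous H := by simp only [hH]; fun_prop
    exact this.measurable
  set S : ℝ → Set (R3 × R3) := fun r => Metric.closedBall x₀ r ×ˢ Metric.closedBall x₀ r with hS
  have hSm : ∀ r, MeasurableSet (S r) := fun r =>
    Metric.isClosed_closedBall.measurableSet.prod Metric.isClosed_closedBall.measurableSet
  set E : ℝ × (R3 × R3) → ℝ≥0∞ := {p | p.2 ∈ S p.1}.indicator
    (fun p => ENNReal.ofReal ((p.1 ^ 5)⁻¹) * H p.2) with hE
  have hEm : Measurable E := by
    refine Measurable.indicator (by fun_prop) ?_
    have : {p : ℝ × (R3 × R3) | p.2 ∈ S p.1} = {p | dist p.2.1 x₀ ≤ p.1} ∩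
        {p | dist p.2.2 x₀ ≤ p.1} := by
      ext p; simp [hS, mem_prod]
    rw [this]
    exact (measurableSet_le (by fun_prop) (by fun_prop)).inter
      (measurableSet_le (by fun_prop) (by fun_prop))
  have h1 : ∀ r ∈ Ioc 0 ρ, ENNReal.ofReal r * ‖deriv (ballIntegral g x₀) r‖ₑ ^ 2 ≤
      ∫⁻ q in S ρ, E (r, q) := by
    intro r hr
    have hcv : ∫⁻ z in Metric.closedBall (0 : R3) 1, ∫⁻ y in Metric.closedBall (0 : R3) 1,
        H (x₀ + r • z, x₀ + r • y) = ENNReal.ofReal (r ^ 3)⁻¹ * (ENNReal.ofReal (r ^ 3)⁻¹ *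
          ∫⁻ q in S r, H q) := by
      have h2 : ∀ z : R3, ∫⁻ y in Metric.closedBall (0 : R3) 1, H (x₀ + r • z, x₀ + r • y) =
          ENNReal.ofReal (r ^ 3)⁻¹ * ∫⁻ y in Metric.closedBall x₀ r, H (x₀ + r • z, y) := fun z =>
        setLIntegral_closedBall_scale (F := fun y => H (x₀ + r • z, y)) (by fun_prop) x₀ hr.1
      simp only [h2]
      rw [lintegral_const_mul' _ _ ENNReal.ofReal_ne_top,
        setLIntegral_closedBall_scale (F := fun x => ∫⁻ y in Metric.closedBall x₀ r, H (x, y))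
          hHm.lintegral_prod_right' x₀ hr.1, hS]
      simp only
      rw [Measure.volume_eq_prod, ← Measure.prod_restrict, lintegral_prod _ hHm.aemeasurable]
    calc _ ≤ ENNReal.ofReal r * (ENNReal.ofReal (r ^ 3)⁻¹ * (ENNReal.ofReal (r ^ 3)⁻¹ *
          ∫⁻ q in S r, H q)) := by
          rw [← hcv]
          gcongr
          exact enorm_deriv_ballIntegral_sq_le x₀ hg r
      _ = ENNReal.ofReal ((r ^ 5)⁻¹) * ∫⁻ q in S r, H q := by
          rw [← mul_assoc, ← mul_assoc, ← ENNReal.ofReal_mul hr.1.le,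
            ← ENNReal.ofReal_mul (by have := hr.1; positivity)]
          congr 2
          have := hr.1.ne'
          field_simp
      _ = ∫⁻ q in S r, E (r, q) := by
          rw [← lintegral_const_mul' _ _ ENNReal.ofReal_ne_top]
          refine setLIntegral_congr_fun (hSm r) fun q hq => ?_
          have : (r, q) ∈ {p : ℝ × (R3 × R3) | p.2 ∈ S p.1} := hq
          simp only [hE]
          rw [indicator_of_mem this]
      _ ≤ _ := lintegral_mono_set (prod_mono (Metric.closedBall_subset_closedBall hr.2)
          (Metric.closedBall_subset_closedBall hr.2))
  have h3 : ∀ q : R3 × R3, ∫⁻ r in Ioc 0 ρ, E (r, q) ≤ 64 * (H q / ‖q.1 - q.2‖ₑ ^ 4) := by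
    intro q
    have h4 : ∀ r, E (r, q) = H q * {r : ℝ | ‖q.1 - x₀‖ ≤ r ∧ ‖q.2 - x₀‖ ≤ r}.indicator
        (fun r => ENNReal.ofReal ((r ^ 5)⁻¹)) r := by
      intro r
      have hiff : (r, q) ∈ {p : ℝ × (R3 × R3) | p.2 ∈ S p.1} ↔
          r ∈ {r : ℝ | ‖q.1 - x₀‖ ≤ r ∧ ‖q.2 - x₀‖ ≤ r} := by
        simp [hS, mem_prod, dist_eq_norm]
      simp only [hE]
      by_cases hr : r ∈ {r : ℝ | ‖q.1 - x₀‖ ≤ r ∧ ‖q.2 - x₀‖ ≤ r}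
      · rw [indicator_of_mem (hiff.2 hr), indicator_of_mem hr, mul_comm]
      · rw [indicator_of_notMem fun h => hr (hiff.1 h), indicator_of_notMem hr, mul_zero]
    simp only [h4]
    rw [lintegral_const_mul' _ _ (by simp [hH])]
    by_cases hq : q.1 = q.2
    · have : H q = 0 := by simp only [hH, hq, sub_self, ← ofReal_norm]; simp
      rw [this]; simp
    · refine (mul_le_mul' le_rfl (lintegral_indicator_inv_pow_le x₀ q.1 q.2 hq ρ)).trans
        (le_of_eq ?_)
      rw [div_eq_mul_inv, div_eq_mul_inv]
      ring
  calc _ ≤ ∫⁻ r in Ioc 0 ρ, ∫⁻ q in S ρ, E (r, q) := setLIntegral_mono' measurableSet_Ioc h1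
    _ = ∫⁻ q in S ρ, ∫⁻ r in Ioc 0 ρ, E (r, q) := lintegral_lintegral_swap hEm.aemeasurable
    _ ≤ ∫⁻ q in S ρ, 64 * (H q / ‖q.1 - q.2‖ₑ ^ 4) := lintegral_mono h3
    _ = 64 * ∫⁻ q in S ρ, H q / ‖q.1 - q.2‖ₑ ^ 4 := lintegral_const_mul' _ _ (by simp)
    _ ≤ _ := by
      gcongr
      have hm : Measurable fun q : R3 × R3 => H q / ‖q.1 - q.2‖ₑ ^ 4 := by fun_prop
      rw [hS]
      simp only
      rw [Measure.volume_eq_prod, ← Measure.prod_restrict, lintegral_prod _ hm.aemeasurable]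
      exact le_add_left le_rfl

theorem integral_deriv_ballIntegral_le (hg : ContDiff ℝ ∞ g) {ρ ε R : ℝ} (hε : 0 < ε)
    (hεR : ε ≤ R) (hR : R ≤ ρ) (hfin : threeHalvesSq x₀ ρ g ≠ ⊤) :
    ∫ r in ε..R, r * deriv (ballIntegral g x₀) r ^ 2 ≤ 64 * (threeHalvesSq x₀ ρ g).toReal := by
  have hc : Continuous (deriv (ballIntegral g x₀)) :=
    (contDiff_ballIntegral x₀ hg).continuous_deriv (by simp)
  have h1 : ENNReal.ofReal (∫ r in ε..R, r * deriv (ballIntegral g x₀) r ^ 2) ≤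
      64 * threeHalvesSq x₀ ρ g := by
    refine le_trans ?_ (lintegral_deriv_ballIntegral_le x₀ hg ρ)
    rw [intervalIntegral.integral_of_le hεR, ofReal_integral_eq_lintegral_ofReal]
    · refine le_trans (setLIntegral_mono' measurableSet_Ioc fun r hr => ?_)
        (lintegral_mono_set (Ioc_subset_Ioc hε.le hR))
      rw [ENNReal.ofReal_mul (hε.trans hr.1).le, ← ofReal_norm, ← ENNReal.ofReal_pow
        (norm_nonneg _), Real.norm_eq_abs, sq_abs]
    · exact ((continuous_id.mul (hc.pow 2)).integrableOn_Icc (a := ε) (b := R)).mono_set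
        Ioc_subset_Icc_self
    · filter_upwards [ae_restrict_mem measurableSet_Ioc] with r hr
      exact mul_nonneg (hε.trans hr.1).le (sq_nonneg _)
  have h2 := (ENNReal.ofReal_le_iff_le_toReal (ENNReal.mul_ne_top (by simp) hfin)).1 h1
  simpa using h2

theorem ballIntegral_le (hg : ContDiff ℝ ∞ g) {ρ R : ℝ} (hR0 : 0 < R) (hR : R ≤ ρ)
    (hfin : threeHalvesSq x₀ ρ g ≠ ⊤) :
    ballIntegral g x₀ R ≤ volume.real (Metric.closedBall (0 : R3) 1) +
      (R ^ 3)⁻¹ * (threeHalvesSq x₀ ρ g).toReal := by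
  have hgc : Continuous (fun y => g (x₀ + R • y)) := hg.continuous.comp (by fun_prop)
  have h1 : ballIntegral g x₀ R ≤
      ∫ y in Metric.closedBall (0 : R3) 1, (1 + g (x₀ + R • y) ^ 2) := by
    refine integral_mono (integrableOn_closedBall_of_continuous hgc)
      (integrableOn_closedBall_of_continuous (by fun_prop)) fun y => ?_
    simp only
    -- The elementary bound `v ≤ 1 + v²` allows the `L²` part of the norm to be used.
    nlinarith [sq_nonneg (g (x₀ + R • y) - 1)]
  rw [integral_add (integrable_const _) (integrableOn_closedBall_of_continuous (by fun_prop))] at h1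
  have h2 : ENNReal.ofReal (∫ y in Metric.closedBall (0 : R3) 1, g (x₀ + R • y) ^ 2) ≤
      ENNReal.ofReal (R ^ 3)⁻¹ * threeHalvesSq x₀ ρ g := by
    rw [ofReal_integral_eq_lintegral_ofReal
      (integrableOn_closedBall_of_continuous (by fun_prop)) (Eventually.of_forall fun y =>
        sq_nonneg _)]
    have h3 : ∀ y, ENNReal.ofReal (g (x₀ + R • y) ^ 2) = ‖g (x₀ + R • y)‖ₑ ^ 2 := fun y => by
      rw [← ofReal_norm, ← ENNReal.ofReal_pow (norm_nonneg _), Real.norm_eq_abs, sq_abs]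
    simp only [h3]
    have hm : Measurable fun x => ‖g x‖ₑ ^ 2 := by
      have := hg.continuous
      exact Continuous.measurable (by fun_prop)
    rw [setLIntegral_closedBall_scale (F := fun x => ‖g x‖ₑ ^ 2) hm x₀ hR0]
    gcongr
    refine (lintegral_mono_set (Metric.closedBall_subset_closedBall hR)).trans ?_
    unfold threeHalvesSq
    rw [add_assoc]
    exact le_self_add
  have h4 := (ENNReal.ofReal_le_iff_le_toReal
    (ENNReal.mul_ne_top ENNReal.ofReal_ne_top hfin)).1 h2
  rw [ENNReal.toReal_mul, ENNReal.toReal_ofReal (by positivity)] at h4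
  refine h1.trans (add_le_add (le_of_eq ?_) h4)
  simp

end

/-! ### Growth of functions of finite scale invariant energy -/

/-- A function on `[ε, R]` whose energy `∫ r m'(r)² dr` is finite grows at most like the square root
of the logarithm. -/
theorem sub_le_energy_add_log {m : ℝ → ℝ} (hm : ContDiff ℝ ∞ m) {ε R a : ℝ} (hε : 0 < ε)
    (hεR : ε ≤ R) (ha : 0 < a) :
    m ε - m R ≤ a⁻¹ * (∫ r in ε..R, r * deriv m r ^ 2) + a / 4 * (Real.log R - Real.log ε) := by
  have hc : Continuous fun r => r * deriv m r ^ 2 :=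
    continuous_id.mul ((hm.continuous_deriv (by simp)).pow 2)
  have hder : ∀ r, 0 < r → HasDerivAt (fun r => m r + a⁻¹ * (∫ s in ε..r, s * deriv m s ^ 2) +
      a / 4 * Real.log r) (deriv m r + a⁻¹ * (r * deriv m r ^ 2) + a / 4 * r⁻¹) r := fun r hr =>
    ((hm.differentiable (by simp) r).hasDerivAt.add
      ((intervalIntegral.integral_hasDerivAt_right (hc.intervalIntegrable ε r)
        hc.stronglyMeasurable.stronglyMeasurableAtFilter hc.continuousAt).const_mul a⁻¹)).add
      ((Real.hasDerivAt_log hr.ne').const_mul (a / 4))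
  have hmono : MonotoneOn (fun r => m r + a⁻¹ * (∫ s in ε..r, s * deriv m s ^ 2) +
      a / 4 * Real.log r) (Icc ε R) := by
    refine monotoneOn_of_deriv_nonneg (convex_Icc _ _)
      (fun r hr => (hder r (hε.trans_le hr.1)).continuousAt.continuousWithinAt) (fun r hr => ?_)
      fun r hr => ?_
    · rw [interior_Icc] at hr
      exact (hder r (hε.trans hr.1)).differentiableAt.differentiableWithinAt
    · rw [interior_Icc] at hr
      have hr0 : 0 < r := hε.trans hr.1
      rw [(hder r hr0).deriv]
      -- Completing the square.
      have : deriv m r + a⁻¹ * (r * deriv m r ^ 2) + a / 4 * r⁻¹ =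
          a⁻¹ * r⁻¹ * (r * deriv m r + a / 2) ^ 2 := by field_simp; ring
      rw [this]
      positivity
  have h := hmono (left_mem_Icc.2 hεR) (right_mem_Icc.2 hεR) hεR
  simp only [intervalIntegral.integral_same] at h
  linarith

/-- A function on `[ε, R]` that is at least of order `√(ln (1 / r))` has energy at least of order
`ln ln (1 / ε)`: this is Hardy's inequality in logarithmic coordinates, with the weight
`(ln (1 / r))^{-1/2}`. -/
theorem loglog_le_energy {m : ℝ → ℝ} (hm : ContDiff ℝ ∞ m) {ε R a : ℝ} (hε : 0 < ε)
    (hεR : ε ≤ R) (hR : R < 1) (ha : 0 < a)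
    (hlow : ∀ r ∈ Icc ε R, a * √(-Real.log r) ≤ m r) :
    a / 4 * (Real.log (-Real.log ε) - Real.log (-Real.log R)) ≤
      (√(-Real.log R))⁻¹ * m R + a⁻¹ * ∫ r in ε..R, r * deriv m r ^ 2 := by
  have hc : Continuous fun r => r * deriv m r ^ 2 :=
    continuous_id.mul ((hm.continuous_deriv (by simp)).pow 2)
  have hL : ∀ r, 0 < r → r < 1 → 0 < -Real.log r := fun r h0 h1 =>
    neg_pos.2 (Real.log_neg h0 h1)
  set Θ : ℝ → ℝ := fun r => (√(-Real.log r))⁻¹ * m r +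
    a⁻¹ * (∫ s in ε..r, s * deriv m s ^ 2) + a / 4 * Real.log (-Real.log r) with hΘ
  have hder : ∀ r, 0 < r → r < 1 → HasDerivAt Θ
      ((-(-r⁻¹ / (2 * √(-Real.log r))) / √(-Real.log r) ^ 2) * m r + (√(-Real.log r))⁻¹ * deriv m r
        + a⁻¹ * (r * deriv m r ^ 2) + a / 4 * (-r⁻¹ / -Real.log r)) r := fun r h0 h1 => by
    have hl := (Real.hasDerivAt_log h0.ne').neg
    have hw := (hl.sqrt (hL r h0 h1).ne').inv (Real.sqrt_pos.2 (hL r h0 h1)).ne'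
    exact ((hw.mul (hm.differentiable (by simp) r).hasDerivAt).add
      ((intervalIntegral.integral_hasDerivAt_right (hc.intervalIntegrable ε r)
        hc.stronglyMeasurable.stronglyMeasurableAtFilter hc.continuousAt).const_mul a⁻¹)).add
      ((hl.log (hL r h0 h1).ne').const_mul (a / 4))
  have hmono : MonotoneOn Θ (Icc ε R) := by
    refine monotoneOn_of_deriv_nonneg (convex_Icc _ _)
      (fun r hr => (hder r (hε.trans_le hr.1)
        (hr.2.trans_lt hR)).continuousAt.continuousWithinAt) (fun r hr => ?_) fun r hr => ?_
    · rw [interior_Icc] at hr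
      exact (hder r (hε.trans hr.1) (hr.2.trans hR)).differentiableAt.differentiableWithinAt
    · rw [interior_Icc] at hr
      have h0 : 0 < r := hε.trans hr.1
      have h1 : r < 1 := hr.2.trans hR
      rw [(hder r h0 h1).deriv]
      have hlow' := hlow r (Ioo_subset_Icc_self hr)
      have hs := Real.sqrt_pos.2 (hL r h0 h1)
      have hsq : -Real.log r = √(-Real.log r) ^ 2 := (Real.sq_sqrt (hL r h0 h1).le).symm
      set l := √(-Real.log r)
      rw [hsq]
      -- Completing the square; the lower bound for `m` controls the derivative of the weight.
      have : (-(-r⁻¹ / (2 * l)) / l ^ 2) * m r + l⁻¹ * deriv m r +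
          a⁻¹ * (r * deriv m r ^ 2) + a / 4 * (-r⁻¹ / l ^ 2) =
          a⁻¹ * r⁻¹ * (r * deriv m r + a / (2 * l)) ^ 2 +
            r⁻¹ / (2 * l ^ 3) * (m r - a * l) := by field_simp; ring
      rw [this]
      have : 0 ≤ m r - a * l := sub_nonneg.2 hlow'
      positivity
  have h := hmono (left_mem_Icc.2 hεR) (right_mem_Icc.2 hεR) hεR
  simp only [hΘ, intervalIntegral.integral_same] at h
  have hpos : 0 ≤ (√(-Real.log ε))⁻¹ * m ε := by
    have := hlow ε (left_mem_Icc.2 hεR)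
    have : 0 ≤ m ε := le_trans (by positivity) this
    positivity
  linarith

/-! ### Quantitative bounds for the change of variable near the end of its range -/

section

variable {f : ℝ → ℝ} {b : ℝ}

/-- The distance of `Φ(s)` to an upper bound of `Φ` is at least `∫ₛ^∞ Φ'`, and `Φ'(r) ≥ exp (-K r)`
if `f ≤ K` on the positive half line. -/
theorem exp_div_le_of_nirenberg_lt (hf : Continuous f) (hb : ∀ s, nirenberg f s < b) {K : ℝ}
    (hK : 0 < K) (hfK : ∀ s, 0 ≤ s → f s ≤ K) {s : ℝ} (hs : 0 ≤ s) :
    Real.exp (-K * s) / K ≤ b - nirenberg f s := by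
  have hw : ∀ r, 0 ≤ r → Real.exp (-K * r) ≤ nirenbergWeight f r := fun r hr => by
    refine Real.exp_le_exp.2 ?_
    have h1 : ∫ x in (0 : ℝ)..r, f x ≤ ∫ _ in (0 : ℝ)..r, K :=
      intervalIntegral.integral_mono_on hr (hf.intervalIntegrable _ _) (by simp)
        fun x hx => hfK x hx.1
    rw [intervalIntegral.integral_const, sub_zero, smul_eq_mul] at h1
    linarith
  have hder : ∀ r, HasDerivAt (fun r => nirenberg f r + Real.exp (-K * r) / K)
      (nirenbergWeight f r - Real.exp (-K * r)) r := fun r => by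
    have h1 := (((hasDerivAt_id r).const_mul (-K)).exp.div_const K)
    refine ((hasDerivAt_nirenberg hf r).add h1).congr_deriv ?_
    simp only [id]
    field_simp
    ring
  have hmono : MonotoneOn (fun r => nirenberg f r + Real.exp (-K * r) / K) (Ici 0) := by
    refine monotoneOn_of_deriv_nonneg (convex_Ici 0)
      (fun r _ => (hder r).continuousAt.continuousWithinAt)
      (fun r _ => (hder r).differentiableAt.differentiableWithinAt) fun r hr => ?_
    rw [interior_Ici] at hr
    rw [(hder r).deriv]
    exact sub_nonneg.2 (hw r (le_of_lt hr))
  have hlim : Tendsto (fun r => b + Real.exp (-K * r) / K) atTop (𝓝 (b + 0 / K)) := by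
    refine (Tendsto.div_const ?_ K).const_add b
    refine Real.tendsto_exp_atBot.comp ?_
    exact tendsto_id.const_mul_atTop_of_neg (by linarith)
  have h := ge_of_tendsto hlim (b := nirenberg f s + Real.exp (-K * s) / K) (by
    filter_upwards [eventually_ge_atTop s] with r hr
    have h1 := hmono hs (hs.trans hr) hr
    have h2 := hb r
    simp only at h1
    linarith)
  rw [zero_div, add_zero] at h
  linarith

/-- If `f ≤ K` on the positive half line, then values of the change of variable within `y` of the
end of its range are only attained beyond `K⁻¹ ln (1 / (K y))`. -/
theorem neg_log_div_le_of_le_nirenberg (hf : Continuous f) (hb : ∀ s, nirenberg f s < b) {K : ℝ}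
    (hK : 0 < K) (hfK : ∀ s, 0 ≤ s → f s ≤ K) {s y : ℝ} (hy : 0 < y) (hy1 : K * y ≤ 1)
    (hs : b - y ≤ nirenberg f s) : -Real.log (K * y) / K ≤ s := by
  by_contra! h
  have hσ : 0 ≤ -Real.log (K * y) / K :=
    div_nonneg (neg_nonneg.2 (Real.log_nonpos (by positivity) hy1)) hK.le
  have h1 := exp_div_le_of_nirenberg_lt hf hb hK hfK hσ
  have h2 : Real.exp (-K * (-Real.log (K * y) / K)) / K = y := by
    rw [show -K * (-Real.log (K * y) / K) = Real.log (K * y) by field_simp,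
      Real.exp_log (by positivity)]
    field_simp
  have h3 := strictMono_nirenberg hf h
  linarith

/-- The distance of `Φ(s)` to an upper bound of `Φ` is at least the integral of `Φ'` over
`[s, s + 1]`, and the growth condition gives a Gaussian lower bound for `Φ'`. -/
theorem exists_exp_sq_le_of_nirenberg_lt (hf : Continuous f) (hb : ∀ s, nirenberg f s < b) {K : ℝ}
    (hfK : ∀ s, s * f s ≤ K * (1 + s ^ 2)) :
    ∃ A : ℝ, 0 < A ∧ ∀ s, 0 ≤ s → Real.exp (-A * (1 + s) ^ 2) ≤ b - nirenberg f s := by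
  obtain ⟨A₁, hA₁⟩ := (isCompact_Icc (a := (0 : ℝ)) (b := 1)).exists_bound_of_continuousOn
    hf.continuousOn
  have hA₁0 : 0 ≤ A₁ := (norm_nonneg _).trans (hA₁ 0 ⟨le_rfl, zero_le_one⟩)
  have hlin : ∀ s, 0 ≤ s → f s ≤ A₁ + 2 * |K| * s := fun s hs => by
    rcases le_total s 1 with h1 | h1
    · have := (le_abs_self _).trans (hA₁ s ⟨hs, h1⟩)
      have : 0 ≤ 2 * |K| * s := by positivity
      linarith
    · have h2 : s * f s ≤ s * (2 * |K| * s) := by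
        refine (hfK s).trans ?_
        have : K * (1 + s ^ 2) ≤ |K| * (1 + s ^ 2) :=
          mul_le_mul_of_nonneg_right (le_abs_self K) (by positivity)
        have h5 : |K| * (1 + s ^ 2) ≤ |K| * (2 * s ^ 2) :=
          mul_le_mul_of_nonneg_left (by nlinarith) (abs_nonneg K)
        linarith
      have := le_of_mul_le_mul_left h2 (by linarith)
      linarith
  have hF : ∀ r, 0 ≤ r → ∫ x in (0 : ℝ)..r, f x ≤ (A₁ + |K|) * (1 + r) ^ 2 := fun r hr => by
    have h1 : ∫ x in (0 : ℝ)..r, f x ≤ ∫ x in (0 : ℝ)..r, (A₁ + 2 * |K| * x) :=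
      intervalIntegral.integral_mono_on hr (hf.intervalIntegrable _ _)
        (Continuous.intervalIntegrable (by fun_prop) _ _) fun x hx => hlin x hx.1
    rw [intervalIntegral.integral_add (by simp)
      (Continuous.intervalIntegrable (by fun_prop) _ _), intervalIntegral.integral_const,
      intervalIntegral.integral_const_mul, integral_id] at h1
    simp only [sub_zero, smul_eq_mul] at h1
    nlinarith [abs_nonneg K, mul_nonneg hA₁0 hr, mul_nonneg (abs_nonneg K) hr,
      mul_nonneg hA₁0 (sq_nonneg r)]
  refine ⟨4 * (A₁ + |K|) + 1, by positivity, fun s hs => ?_⟩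
  have hw : ∀ r ∈ Icc s (s + 1),
      Real.exp (-(4 * (A₁ + |K|) + 1) * (1 + s) ^ 2) ≤ nirenbergWeight f r := fun r hr => by
    refine Real.exp_le_exp.2 ?_
    have h1 := hF r (hs.trans hr.1)
    have h2 : (1 + r) ^ 2 ≤ 4 * (1 + s) ^ 2 := by nlinarith [hr.1, hr.2]
    have h3 := mul_le_mul_of_nonneg_left h2 (by positivity : 0 ≤ A₁ + |K|)
    nlinarith [sq_nonneg (1 + s)]
  have h4 := (convex_Icc s (s + 1)).mul_sub_le_image_sub_of_le_deriv
    (f := nirenberg f) (C := Real.exp (-(4 * (A₁ + |K|) + 1) * (1 + s) ^ 2))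
    (fun r _ => (hasDerivAt_nirenberg hf r).continuousAt.continuousWithinAt)
    (fun r _ => (hasDerivAt_nirenberg hf r).differentiableAt.differentiableWithinAt)
    (fun r hr => by
      rw [(hasDerivAt_nirenberg hf r).deriv]
      exact hw r (interior_subset hr)) s ⟨le_rfl, by linarith⟩ (s + 1) ⟨by linarith, le_rfl⟩
      (by linarith)
  have h5 := hb (s + 1)
  rw [add_sub_cancel_left, mul_one] at h4
  linarith

/-- If `s f(s)` grows at most quadratically, then values of the change of variable within `y` of
the end of its range are only attained beyond a multiple of `√(ln (1 / y))`. -/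
theorem exists_sqrt_log_le_of_le_nirenberg (hf : Continuous f) (hb : ∀ s, nirenberg f s < b) {K : ℝ}
    (hfK : ∀ s, s * f s ≤ K * (1 + s ^ 2)) :
    ∃ A : ℝ, 0 < A ∧ ∀ s y : ℝ, 0 < y → A ≤ -Real.log y → b - y ≤ nirenberg f s →
      √(-Real.log y / A) - 1 ≤ s := by
  obtain ⟨A, hA, hAs⟩ := exists_exp_sq_le_of_nirenberg_lt hf hb hfK
  refine ⟨A, hA, fun s y hy hAy hs => ?_⟩
  by_contra! h
  have hσ : 1 ≤ √(-Real.log y / A) := by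
    rw [Real.one_le_sqrt, le_div_iff₀ hA, one_mul]; exact hAy
  have h1 := hAs (√(-Real.log y / A) - 1) (by linarith)
  have h2 : Real.exp (-A * (1 + (√(-Real.log y / A) - 1)) ^ 2) = y := by
    rw [add_sub_cancel, Real.sq_sqrt (div_nonneg (hA.le.trans hAy) hA.le),
      show -A * (-Real.log y / A) = Real.log y by field_simp, Real.exp_log hy]
  have h3 := strictMono_nirenberg hf h
  linarith

end

/-! ### Blow-up -/

theorem enorm_le_supNormBall {g : R3 → ℝ} (hg : Continuous g) (x₀ : R3) {ρ : ℝ} (hρ : 0 < ρ) :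
    ‖g x₀‖ₑ ≤ supNormBall x₀ ρ g := by
  by_contra! h
  set E := supNormBall x₀ ρ g with hE
  have hae : ∀ᵐ x ∂volume.restrict (Metric.closedBall x₀ ρ), ‖g x‖ₑ ≤ E := by
    rw [hE, supNormBall, eLpNorm_exponent_top]
    exact ae_le_eLpNormEssSup
  have hopen : IsOpen ({x | E < ‖g x‖ₑ} ∩ Metric.ball x₀ ρ) :=
    (isOpen_lt continuous_const (by fun_prop)).inter Metric.isOpen_ball
  have hpos := hopen.measure_pos (volume : Measure R3) ⟨x₀, h, Metric.mem_ball_self hρ⟩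
  refine hpos.ne' (measure_mono_null (fun x hx => ?_)
    ((ae_restrict_iff' Metric.isClosed_closedBall.measurableSet).1 hae))
  exact fun h' => absurd (h' (Metric.ball_subset_closedBall hx.2)) (not_le.2 hx.1)

theorem volume_real_closedBall_pos : 0 < volume.real (Metric.closedBall (0 : R3) 1) :=
  ENNReal.toReal_pos (Metric.measure_closedBall_pos _ _ one_pos).ne' measure_closedBall_lt_top.ne

theorem mul_le_ballIntegral {g : R3 → ℝ} (hg : Continuous g) (x₀ : R3) {r l : ℝ}
    (h : ∀ y : R3, ‖y‖ ≤ 1 → l ≤ g (x₀ + r • y)) :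
    volume.real (Metric.closedBall (0 : R3) 1) * l ≤ ballIntegral g x₀ r := by
  have h1 : ∫ _ in Metric.closedBall (0 : R3) 1, l ≤ ballIntegral g x₀ r :=
    integral_mono_ae (integrable_const _)
      (integrableOn_closedBall_of_continuous (by fun_prop)) (by
        filter_upwards [ae_closedBall] with y hy
        exact h y (mem_closedBall_zero_iff.1 hy))
  rwa [integral_const, measureReal_restrict_apply_univ, smul_eq_mul] at h1

theorem threeHalvesNormBall_eq (x₀ : R3) (ρ : ℝ) (g : R3 → ℝ) :
    threeHalvesNormBall x₀ ρ g = threeHalvesSq x₀ ρ g ^ (1 / 2 : ℝ) := rfl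

theorem eventually_mem_and_abs_sub_lt (I : Set ℝ) (T : ℝ) {η : ℝ} (hη : 0 < η) :
    ∀ᶠ t in 𝓝[I] T, t ∈ I ∧ |t - T| < η := by
  filter_upwards [self_mem_nhdsWithin, nhdsWithin_le_nhds (Metric.ball_mem_nhds T hη)] with t h1 h2
  exact ⟨h1, by rwa [Metric.mem_ball, Real.dist_eq] at h2⟩

section

variable {f : ℝ → ℝ} {b : ℝ} {x₀ : R3}

/-- The logarithmic lower bound for the `H^{3/2}` norm of a function whose values at distance at
most `ε` from `x₀` are within `2 M ε` of the end of the range of the change of variable. -/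
theorem log_le_threeHalvesSq (hf : Continuous f) (hb : ∀ s, nirenberg f s < b) {K : ℝ}
    (hK : 0 < K) (hfK : ∀ s, 0 ≤ s → f s ≤ K) {M : ℝ} (hM : 0 < M) {R ρ : ℝ}
    (hR : 0 < R) (hR1 : R ≤ 1) (hRρ : R ≤ ρ) :
    ∃ c η : ℝ, 0 < c ∧ 0 < η ∧ ∀ (g : R3 → ℝ) (ε : ℝ), ContDiff ℝ ∞ g → 0 < ε → ε < η →
      (∀ x, ‖x - x₀‖ ≤ ε → b - 2 * M * ε ≤ nirenberg f (g x)) →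
      ENNReal.ofReal (c * -Real.log ε) ≤ threeHalvesSq x₀ ρ g := by
  set κ := volume.real (Metric.closedBall (0 : R3) 1) with hκ
  have hκ0 : 0 < κ := volume_real_closedBall_pos
  set a := κ / K with ha
  have ha0 : 0 < a := by positivity
  set D := (R ^ 3)⁻¹ + 64 * a⁻¹ with hD
  have hD0 : 0 < D := by positivity
  set L₀ := 4 / a * (a * Real.log (2 * K * M) + κ) with hL₀
  refine ⟨a / 2 / D, min R (min (2 * K * M)⁻¹ (Real.exp (-L₀))), by positivity,
    lt_min hR (lt_min (by positivity) (Real.exp_pos _)), fun g ε hg hε hεη hlow => ?_⟩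
  by_cases hfin : threeHalvesSq x₀ ρ g = ⊤
  · rw [hfin]; exact le_top
  have hεR : ε ≤ R := (hεη.trans_le (min_le_left _ _)).le
  have hε1 : ε ≤ (2 * K * M)⁻¹ :=
    (hεη.trans_le ((min_le_right _ _).trans (min_le_left _ _))).le
  have hεL : L₀ ≤ -Real.log ε := by
    have h1 := (hεη.trans_le ((min_le_right _ _).trans (min_le_right _ _))).le
    have h2 := Real.log_le_log hε h1
    rw [Real.log_exp] at h2
    linarith
  have hKε : K * (2 * M * ε) ≤ 1 := by
    rw [← mul_inv_cancel₀ (show 2 * K * M ≠ 0 by positivity)]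
    calc K * (2 * M * ε) = 2 * K * M * ε := by ring
      _ ≤ _ := by gcongr
  have hm : κ * (-Real.log (K * (2 * M * ε)) / K) ≤ ballIntegral g x₀ ε := by
    refine mul_le_ballIntegral hg.continuous x₀ fun y hy => ?_
    refine neg_log_div_le_of_le_nirenberg hf hb hK hfK (by positivity) hKε (hlow _ ?_)
    rw [add_sub_cancel_left, norm_smul, Real.norm_of_nonneg hε.le]
    exact mul_le_of_le_one_right hε.le hy
  have hm' : a * (-Real.log ε) - a * Real.log (2 * K * M) ≤ ballIntegral g x₀ ε := by
    refine le_trans (le_of_eq ?_) hm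
    rw [show K * (2 * M * ε) = 2 * K * M * ε by ring, Real.log_mul (by positivity) hε.ne', ha]
    ring
  -- Of the main term `a ln (1 / ε)`, one quarter is lost here, and one quarter absorbs the
  -- additive constants in `h6`.
  have h1 := sub_le_energy_add_log (contDiff_ballIntegral x₀ hg) hε hεR ha0
  have h2 := integral_deriv_ballIntegral_le x₀ hg hε hεR hRρ hfin
  have h3 := ballIntegral_le x₀ hg hR hRρ hfin
  have h4 := mul_le_mul_of_nonneg_left h2 (inv_pos.2 ha0).le
  have h5 : Real.log R ≤ 0 := Real.log_nonpos hR.le hR1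
  have h6 : a * Real.log (2 * K * M) + κ ≤ a / 4 * (-Real.log ε) := by
    have := mul_le_mul_of_nonneg_left hεL (by positivity : 0 ≤ a / 4)
    rw [hL₀] at this
    calc _ = a / 4 * (4 / a * (a * Real.log (2 * K * M) + κ)) := by field_simp
      _ ≤ _ := this
  set S := (threeHalvesSq x₀ ρ g).toReal with hS
  have h7 : a / 2 * (-Real.log ε) ≤ D * S := by
    rw [hD]
    have h8 : a / 4 * Real.log R ≤ 0 := mul_nonpos_of_nonneg_of_nonpos (by positivity) h5
    linarith
  refine (ENNReal.ofReal_le_iff_le_toReal hfin).2 ?_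
  rw [div_mul_eq_mul_div, div_le_iff₀ hD0, ← hS]
  linarith

/-- Under the quadratic growth condition the `H^{3/2}` norm still tends to infinity: here the
hypothesis is used at all scales between `ε` and `R`. -/
theorem loglog_le_threeHalvesSq (hf : Continuous f) (hb : ∀ s, nirenberg f s < b) {K : ℝ}
    (hfK : ∀ s, s * f s ≤ K * (1 + s ^ 2)) {M : ℝ} (hM : 0 < M) {R₀ ρ : ℝ}
    (hR₀ : 0 < R₀) (hRρ : R₀ ≤ ρ) (X : ℝ) :
    ∃ η : ℝ, 0 < η ∧ ∀ (g : R3 → ℝ) (ε : ℝ), ContDiff ℝ ∞ g → 0 < ε → ε < η →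
      (∀ r x, ε ≤ r → r ≤ R₀ → ‖x - x₀‖ ≤ r → b - 2 * M * r ≤ nirenberg f (g x)) →
      ENNReal.ofReal X ≤ threeHalvesSq x₀ ρ g := by
  obtain ⟨A, hA, hAs⟩ := exists_sqrt_log_le_of_le_nirenberg hf hb hfK
  set κ := volume.real (Metric.closedBall (0 : R3) 1) with hκ
  have hκ0 : 0 < κ := volume_real_closedBall_pos
  -- Below the scale `exp (-Λ)` the additive constants are absorbed by the logarithm.
  set Λ := max 1 (max (8 * A) (2 * Real.log (2 * M))) with hΛ
  have hΛ1 : 1 ≤ Λ := le_max_left _ _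
  have hΛA : 8 * A ≤ Λ := (le_max_left _ _).trans (le_max_right _ _)
  have hΛM : 2 * Real.log (2 * M) ≤ Λ := (le_max_right _ _).trans (le_max_right _ _)
  set R := min R₀ (Real.exp (-Λ)) with hR
  have hR0 : 0 < R := lt_min hR₀ (Real.exp_pos _)
  have hRΛ : R ≤ Real.exp (-Λ) := min_le_right _ _
  have hR1 : R < 1 := hRΛ.trans_lt (by rw [Real.exp_lt_one_iff]; linarith)
  set a := κ * (2⁻¹ * (√(2 * A))⁻¹) with ha
  have ha0 : 0 < a := by positivity
  have hlogr : ∀ r, 0 < r → r ≤ R → Λ ≤ -Real.log r := fun r h0 h1 => by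
    have h2 := Real.log_le_log h0 (h1.trans hRΛ)
    rw [Real.log_exp] at h2
    linarith
  set W := (√(-Real.log R))⁻¹ with hW
  have hW0 : 0 ≤ W := by positivity
  set D := W * (R ^ 3)⁻¹ + a⁻¹ * 64 with hD
  have hD0 : 0 < D := by positivity
  set Y := 4 / a * (D * X + W * κ) + Real.log (-Real.log R) with hY
  refine ⟨min R (Real.exp (-Real.exp Y)), lt_min hR0 (Real.exp_pos _),
    fun g ε hg hε hεη hlow => ?_⟩
  by_cases hfin : threeHalvesSq x₀ ρ g = ⊤
  · rw [hfin]; exact le_top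
  have hεR : ε ≤ R := (hεη.trans_le (min_le_left _ _)).le
  have hYε : Y ≤ Real.log (-Real.log ε) := by
    have h1 := Real.log_le_log hε (hεη.trans_le (min_le_right _ _)).le
    rw [Real.log_exp] at h1
    have h2 : Real.exp Y ≤ -Real.log ε := by linarith
    exact (Real.le_log_iff_exp_le ((Real.exp_pos Y).trans_le h2)).2 h2
  have hm : ∀ r ∈ Icc ε R, a * √(-Real.log r) ≤ ballIntegral g x₀ r := by
    intro r hr
    have hr0 : 0 < r := hε.trans_le hr.1
    have hl := hlogr r hr0 hr.2
    rw [ha, mul_assoc]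
    refine mul_le_ballIntegral hg.continuous x₀ fun y hy => ?_
    have h1 : -Real.log r / 2 ≤ -Real.log (2 * M * r) := by
      rw [Real.log_mul (by positivity) hr0.ne']
      linarith
    have h2 := hAs (g (x₀ + r • y)) (2 * M * r) (by positivity) (by linarith)
      (hlow r _ hr.1 (hr.2.trans (min_le_left _ _)) (by
        rw [add_sub_cancel_left, norm_smul, Real.norm_of_nonneg hr0.le]
        exact mul_le_of_le_one_right hr0.le hy))
    refine le_trans ?_ h2
    have h3 : √(-Real.log r / (2 * A)) ≤ √(-Real.log (2 * M * r) / A) := by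
      refine Real.sqrt_le_sqrt ?_
      rw [← div_div]
      exact div_le_div_of_nonneg_right h1 hA.le
    have h4 : 2 ≤ √(-Real.log r / (2 * A)) := by
      refine Real.le_sqrt_of_sq_le ?_
      rw [le_div_iff₀ (by positivity)]
      linarith
    have h5 : 2⁻¹ * (√(2 * A))⁻¹ * √(-Real.log r) = 2⁻¹ * √(-Real.log r / (2 * A)) := by
      rw [Real.sqrt_div (by linarith)]
      ring
    rw [h5]
    linarith
  have h1 := loglog_le_energy (contDiff_ballIntegral x₀ hg) hε hεR hR1 ha0 hm
  have hRρ' : R ≤ ρ := (min_le_left _ _).trans hRρ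
  have h2 := mul_le_mul_of_nonneg_left
    (integral_deriv_ballIntegral_le x₀ hg hε hεR hRρ' hfin) (inv_pos.2 ha0).le
  have h3 := mul_le_mul_of_nonneg_left (ballIntegral_le x₀ hg hR0 hRρ' hfin) hW0
  refine (ENNReal.ofReal_le_iff_le_toReal hfin).2 ?_
  set S := (threeHalvesSq x₀ ρ g).toReal with hS
  have h4 : a / 4 * (4 / a * (D * X + W * κ)) ≤
      a / 4 * (Real.log (-Real.log ε) - Real.log (-Real.log R)) :=
    mul_le_mul_of_nonneg_left (by rw [hY] at hYε; linarith) (by positivity)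
  have h5 : a / 4 * (4 / a * (D * X + W * κ)) = D * X + W * κ := by field_simp
  have h6 : D * X ≤ D * S := by
    have h7 : D * S = W * ((R ^ 3)⁻¹ * S) + a⁻¹ * (64 * S) := by rw [hD]; ring
    rw [h7]
    linarith
  exact le_of_mul_le_mul_left h6 hD0

/-- Blow-up at `(T, x₀)`, if `Φ(u)` approaches an upper bound `b` of `Φ` at least linearly there. At
the point `x₀` this gives the bounds for the sup norm. For the `H^{3/2}` norm it is used on balls of
radius `r ≥ |t - T|` around `x₀`, on which the distance of `Φ(u)` to `b` is at most `2 M r`. -/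
theorem blowsUpAt_of_lower_bound (hf : Continuous f) (hb : ∀ s, nirenberg f s < b)
    {u : ℝ → R3 → ℝ} {I : Set ℝ} {T M r₀ : ℝ} (hM : 0 < M) (hr₀ : 0 < r₀) (hT : T ∉ I)
    (hu : ∀ t ∈ I, ContDiff ℝ ∞ (u t))
    (hlow : ∀ t ∈ I, |t - T| < r₀ → ∀ x, ‖x - x₀‖ < r₀ →
      b - M * (|t - T| + ‖x - x₀‖) ≤ nirenberg f (u t x)) : BlowsUpAt f u I T := by
  have hpos : ∀ t ∈ I, 0 < |t - T| := fun t ht =>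
    abs_pos.2 (sub_ne_zero.2 fun h => hT (h ▸ ht))
  have hcenter : ∀ t ∈ I, |t - T| < r₀ → b - M * |t - T| ≤ nirenberg f (u t x₀) := by
    intro t ht htr
    have := hlow t ht htr x₀ (by simpa using hr₀)
    simpa using this
  have hball : ∀ t ∈ I, |t - T| < r₀ → ∀ r x, |t - T| ≤ r → r < r₀ → ‖x - x₀‖ ≤ r →
      b - 2 * M * r ≤ nirenberg f (u t x) := by
    intro t ht htr r x h1 h2 h3
    refine le_trans ?_ (hlow t ht htr x (h3.trans_lt h2))
    nlinarith
  have hsup : ∀ t ∈ I, ∀ ρ : ℝ, 0 < ρ → ENNReal.ofReal (u t x₀) ≤ supNormBall x₀ ρ (u t) := by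
    intro t ht ρ hρ
    refine le_trans ?_ (enorm_le_supNormBall (hu t ht).continuous x₀ hρ)
    rw [← ofReal_norm]
    exact ENNReal.ofReal_le_ofReal (le_abs_self _)
  refine ⟨x₀, fun ρ hρ => ⟨?_, ?_, fun K hK hfK _ => ⟨?_, ?_⟩⟩⟩
  · refine ENNReal.tendsto_nhds_top fun n => ?_
    have hn : 0 < b - nirenberg f (n + 1) := sub_pos.2 (hb _)
    filter_upwards [eventually_mem_and_abs_sub_lt I T (lt_min hr₀ (div_pos hn hM))] with t ht
    have h1 := hcenter t ht.1 (ht.2.trans_le (min_le_left _ _))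
    have h2 := ht.2.trans_le (min_le_right _ _)
    rw [lt_div_iff₀ hM] at h2
    have h3 : nirenberg f (n + 1) < nirenberg f (u t x₀) := by linarith
    have h4 := (strictMono_nirenberg hf).lt_iff_lt.1 h3
    refine lt_of_lt_of_le ?_ (hsup t ht.1 ρ hρ)
    rw [← ENNReal.ofReal_natCast]
    exact (ENNReal.ofReal_lt_ofReal_iff_of_nonneg (Nat.cast_nonneg n)).2 (by linarith)
  · rintro ⟨K, hfK⟩
    have hS : Tendsto (fun t => threeHalvesSq x₀ ρ (u t)) (𝓝[I] T) (𝓝 ⊤) := by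
      refine ENNReal.tendsto_nhds_top fun n => ?_
      obtain ⟨η, hη, h⟩ := loglog_le_threeHalvesSq (x₀ := x₀) hf hb hfK hM
        (lt_min (half_pos hr₀) hρ) (min_le_right _ ρ) (n + 1)
      filter_upwards [eventually_mem_and_abs_sub_lt I T (lt_min hr₀ hη)] with t ht
      refine lt_of_lt_of_le ?_ (h (u t) |t - T| (hu t ht.1) (hpos t ht.1)
        (ht.2.trans_le (min_le_right _ _)) fun r x h1 h2 h3 => hball t ht.1
          (ht.2.trans_le (min_le_left _ _)) r x h1 ?_ h3)
      · rw [← ENNReal.ofReal_natCast]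
        exact (ENNReal.ofReal_lt_ofReal_iff (by positivity)).2 (by linarith)
      · exact (h2.trans (min_le_left _ _)).trans_lt (half_lt_self hr₀)
    simp only [threeHalvesNormBall_eq]
    have h := (ENNReal.continuous_rpow_const (y := (1 / 2 : ℝ))).tendsto ⊤
    rw [ENNReal.top_rpow_of_pos (by norm_num)] at h
    exact h.comp hS
  · refine ⟨-Real.log (K * M) / K, ?_⟩
    have hη : 0 < min r₀ (min 1 (K * M)⁻¹) := lt_min hr₀ (lt_min one_pos (by positivity))
    filter_upwards [eventually_mem_and_abs_sub_lt I T hη] with t ht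
    have ht1 := ht.2.trans_le ((min_le_right _ _).trans (min_le_left _ _))
    have ht2 := ht.2.trans_le ((min_le_right _ _).trans (min_le_right _ _))
    have hp := hpos t ht.1
    refine le_trans (ENNReal.ofReal_le_ofReal ?_) (hsup t ht.1 ρ hρ)
    have h1 := neg_log_div_le_of_le_nirenberg hf hb hK hfK (y := M * |t - T|) (by positivity) (by
      rw [← mul_inv_cancel₀ (show K * M ≠ 0 by positivity), ← mul_assoc]
      gcongr) (hcenter t ht.1 (ht.2.trans_le (min_le_left _ _)))
    refine le_trans (le_of_eq ?_) h1
    rw [abs_of_neg (Real.log_neg hp ht1), ← mul_assoc, Real.log_mul (by positivity) hp.ne']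
    ring
  · obtain ⟨c, η, hc, hη, h⟩ := log_le_threeHalvesSq (x₀ := x₀) hf hb hK hfK hM
      (lt_min one_pos hρ) (min_le_left _ _) (min_le_right _ ρ)
    refine ⟨√c, Real.sqrt_pos.2 hc, ?_⟩
    filter_upwards [eventually_mem_and_abs_sub_lt I T (lt_min hr₀ (lt_min one_pos hη))] with t ht
    have ht1 := ht.2.trans_le ((min_le_right _ _).trans (min_le_left _ _))
    have ht2 := ht.2.trans_le ((min_le_right _ _).trans (min_le_right _ _))
    have hp := hpos t ht.1
    have htr := ht.2.trans_le (min_le_left _ _)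
    have h1 := h (u t) |t - T| (hu t ht.1) hp ht2 fun x hx =>
      hball t ht.1 htr _ x le_rfl htr hx
    have hlog := Real.log_neg hp ht1
    rw [threeHalvesNormBall_eq, abs_of_neg hlog, Real.sqrt_eq_rpow, ← Real.mul_rpow hc.le
      (by linarith), ← ENNReal.ofReal_rpow_of_nonneg (mul_nonneg hc.le (by linarith))
      (by norm_num)]
    exact ENNReal.rpow_le_rpow h1 (by norm_num)

end

/-! ### Reflection and conclusion -/

theorem nirenberg_reflect (f : ℝ → ℝ) (s : ℝ) :
    nirenberg (fun r => -f (-r)) s = -nirenberg f (-s) := by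
  have hw : ∀ r, nirenbergWeight (fun r => -f (-r)) r = nirenbergWeight f (-r) := fun r => by
    have h := intervalIntegral.integral_comp_neg (a := 0) (b := r) f
    unfold nirenbergWeight
    rw [intervalIntegral.integral_neg, h, neg_zero, intervalIntegral.integral_symm, neg_neg]
  have h := intervalIntegral.integral_comp_neg (a := 0) (b := s) (nirenbergWeight f)
  unfold nirenberg
  simp only [hw]
  rw [h, neg_zero, intervalIntegral.integral_symm]

/-- If `u` solves the equation with nonlinearity `f`, then `-u` solves it with `r ↦ -f(-r)`. The two
one-sided bounds on `f` exchange their roles. -/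
theorem BlowsUpAt.of_reflect {f : ℝ → ℝ} {u : ℝ → R3 → ℝ} {I : Set ℝ} {T : ℝ}
    (h : BlowsUpAt (fun r => -f (-r)) (fun t x => -u t x) I T) : BlowsUpAt f u I T := by
  obtain ⟨x₀, h⟩ := h
  have h1 : ∀ ρ t, supNormBall x₀ ρ (fun x => -u t x) = supNormBall x₀ ρ (u t) := fun ρ t =>
    eLpNorm_neg (u t) _ _
  have h2 : ∀ ρ t, threeHalvesNormBall x₀ ρ (fun x => -u t x) = threeHalvesNormBall x₀ ρ (u t) := by
    intro ρ t
    have h3 : ∀ x, fderiv ℝ (fun x => -u t x) x = -fderiv ℝ (u t) x := fun x => fderiv_fun_neg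
    unfold threeHalvesNormBall
    simp only [h3, enorm_neg, neg_sub_neg]
    congr 2
    refine lintegral_congr fun x => lintegral_congr fun y => ?_
    rw [← ofReal_norm, norm_sub_rev, ofReal_norm]
  refine ⟨x₀, fun ρ hρ => ?_⟩
  obtain ⟨ha, hb, hc⟩ := h ρ hρ
  simp only [h1, h2] at ha hb hc
  refine ⟨ha, fun ⟨K, hK⟩ => hb ⟨K, fun s => ?_⟩, fun K hK hp hm => hc K hK (fun s hs => ?_)
    fun s hs => ?_⟩
  · have := hK (-s)
    rw [neg_sq] at this
    linarith
  · have := hm (-s) (by linarith)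
    linarith
  · have := hp (-s) (by linarith)
    linarith

theorem nirenberg_lt_of_notMem_range {f : ℝ → ℝ} (hf : Continuous f) {b : ℝ} (hb0 : 0 ≤ b)
    (hb : b ∉ range (nirenberg f)) (s : ℝ) : nirenberg f s < b := by
  by_contra! h
  have hc : Continuous (nirenberg f) :=
    continuous_iff_continuousAt.2 fun s => (hasDerivAt_nirenberg hf s).continuousAt
  exact hb (mem_range_of_exists_le_of_exists_ge hc ⟨0, by rwa [nirenberg_zero]⟩ ⟨s, h⟩)

/-- The wave `V` is Lipschitz near `(T, x₀)`, so `Φ(u) = V` approaches its value there linearly. -/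
theorem blowsUpAt_nirenbergInv_of_nonneg {f : ℝ → ℝ} (hf : Continuous f) {V : ℝ × R3 → ℝ}
    (hV : ContDiff ℝ ∞ V) {u : ℝ → R3 → ℝ} {I : Set ℝ} {T : ℝ} {x₀ : R3}
    (huV : ∀ t ∈ I, ∀ x, nirenberg f (u t x) = V (t, x)) (hu : ∀ t ∈ I, ContDiff ℝ ∞ (u t))
    (hT : V (T, x₀) ∉ range (nirenberg f)) (h0 : 0 ≤ V (T, x₀)) : BlowsUpAt f u I T := by
  obtain ⟨K, s, hs, hLip⟩ :=
    ((hV.of_le (by simp) : ContDiff ℝ 1 V).contDiffAt (x := (T, x₀))).exists_lipschitzOnWith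
  obtain ⟨r₀, hr₀, hball⟩ := Metric.mem_nhds_iff.1 hs
  refine blowsUpAt_of_lower_bound (M := K + 1) (r₀ := r₀) (x₀ := x₀) hf
    (nirenberg_lt_of_notMem_range hf h0 hT) (by positivity) hr₀
    (fun hTI => hT ⟨u T x₀, huV T hTI x₀⟩) hu fun t ht htr x hx => ?_
  rw [huV t ht]
  have hmem : (t, x) ∈ Metric.ball (T, x₀) r₀ := by
    rw [Metric.mem_ball, Prod.dist_eq]
    exact max_lt (by rwa [Real.dist_eq]) (by rwa [dist_eq_norm])
  have h1 := hLip.dist_le_mul _ (hball hmem) _ (hball (Metric.mem_ball_self hr₀))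
  rw [Real.dist_eq] at h1
  have h2 : dist (t, x) (T, x₀) ≤ |t - T| + ‖x - x₀‖ := by
    rw [Prod.dist_eq, Real.dist_eq, dist_eq_norm]
    exact max_le_add_of_nonneg (abs_nonneg _) (norm_nonneg _)
  have h3 := neg_le_of_abs_le h1
  have h4 : (K : ℝ) * dist (t, x) (T, x₀) ≤ (K + 1) * (|t - T| + ‖x - x₀‖) := by
    gcongr
    linarith
  linarith

/-- When the wave reaches an end point of the range of the change of variable, the solution blows
up; the lower end point is reduced to the upper one by the symmetry `u ↦ -u`. -/
theorem blowsUpAt_nirenbergInv {f : ℝ → ℝ} (hf : Continuous f) {V : ℝ × R3 → ℝ}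
    (hV : ContDiff ℝ ∞ V) {u : ℝ → R3 → ℝ} {I : Set ℝ} {T : ℝ} {x₀ : R3}
    (huV : ∀ t ∈ I, ∀ x, nirenberg f (u t x) = V (t, x)) (hu : ∀ t ∈ I, ContDiff ℝ ∞ (u t))
    (hT : V (T, x₀) ∉ range (nirenberg f)) : BlowsUpAt f u I T := by
  rcases le_total 0 (V (T, x₀)) with h0 | h0
  · exact blowsUpAt_nirenbergInv_of_nonneg hf hV huV hu hT h0
  · refine BlowsUpAt.of_reflect ?_
    refine blowsUpAt_nirenbergInv_of_nonneg (V := fun p => -V p) (x₀ := x₀) (by fun_prop) hV.neg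
      (fun t ht x => ?_) (fun t ht => (hu t ht).neg) ?_ (neg_nonneg.2 h0)
    · rw [nirenberg_reflect, neg_neg, huV t ht]
    · rintro ⟨s, hs⟩
      rw [nirenberg_reflect] at hs
      exact hT ⟨-s, neg_injective hs⟩

theorem mainTheorem6 (f : ℝ → ℝ) (hf : ContDiff ℝ ∞ f) (u₀ u₁ : 𝓢(R3, ℝ)) :
    ∃ u : ℝ → R3 → ℝ,
      BlowsUpInFiniteTime f u₀ u₁ u ∨
      (IsSmoothSolution f u₀ u₁ univ u ∧
        (∀ t : ℝ, ∃ φ : 𝓢(R3, ℝ), ∀ x, u t x = φ x) ∧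
        (∀ n : ℕ, (⨆ t : ℝ, sobolevNorm n (u t)) < ⊤) ∧
        (∀ k n : ℕ, ∃ C : ℝ, ∀ t : ℝ, t ≠ 0 → ∀ x : R3,
          ‖iteratedFDeriv ℝ n (timeDeriv k u t) x‖ ≤ C * |t|⁻¹) ∧
        Scatters u) := by
  obtain ⟨g₀, hg₀⟩ := exists_schwartz_comp (contDiff_nirenberg hf) (nirenberg_zero f) u₀
  obtain ⟨g₁, hg₁⟩ := exists_schwartz_comp_mul (contDiff_nirenbergWeight hf) u₀ u₁
  set V := freeWave g₀ g₁ with hVdef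
  have hdom := dominatedBy_freeWave g₀ g₁
  have hV : ContDiff ℝ ∞ V := (hdom 0).smooth
  have hsol : ∀ I : Set ℝ, (∀ t ∈ I, ∀ x, V (t, x) ∈ range (nirenberg f)) →
      IsSmoothSolution f u₀ u₁ I (fun t x => nirenbergInv f (V (t, x))) := fun I hI =>
    isSmoothSolution_nirenbergInv hf hV
      (fun p => dalembertian_freeWave (g₀.smooth ⊤) (g₁.smooth ⊤) p)
      (fun x => by rw [hVdef, freeWave_initial _ (g₀.smooth ⊤), hg₀])
      (fun x => by rw [hVdef, dirDeriv_freeWave_initial (g₀.smooth ⊤) (g₁.smooth ⊤), hg₁]) hI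
  refine ⟨fun t x => nirenbergInv f (V (t, x)), ?_⟩
  -- The times at which the free wave leaves the range of the change of variable.
  set B := {t : ℝ | ∃ x, V (t, x) ∉ range (nirenberg f)} with hB
  have hgood : ∀ t, t ∉ B → ∀ x, V (t, x) ∈ range (nirenberg f) := fun t ht x =>
    by_contra fun h => ht ⟨x, h⟩
  by_cases hne : B.Nonempty
  · left
    have hBc : IsCompact B := (hdom 1).isCompact_exit_times
      (isOpenEmbedding_nirenberg hf).isOpen_range (zero_mem_range_nirenberg f)
    have h0 : (0 : ℝ) ∉ B := by
      rintro ⟨x, hx⟩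
      refine hx ⟨u₀ x, ?_⟩
      rw [hVdef, freeWave_initial _ (g₀.smooth ⊤), hg₀]
    obtain ⟨Tm, Tp, hm, hp, hor, hI, hT⟩ := exists_timeInterval hBc hne h0
    refine ⟨Tm, Tp, hm, hp, hor, hsol _ fun t ht => hgood t (hI t ht), fun T hTT => ?_⟩
    obtain ⟨x₀, hx₀⟩ := hT T hTT
    refine blowsUpAt_nirenbergInv hf.continuous hV (fun t ht x => ?_) (fun t ht => ?_) hx₀
    · obtain ⟨s, hs⟩ := hgood t (hI t ht) x
      rw [← hs, nirenbergInv_nirenberg hf.continuous]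
    · exact contDiff_iff_contDiffAt.2 fun x =>
        (contDiffAt_nirenbergInv hf (hgood t (hI t ht) x)).comp x
          (hV.comp (contDiff_prodMk_right t)).contDiffAt
  · right
    have hr : ∀ t x, V (t, x) ∈ range (nirenberg f) := fun t => hgood t fun h => hne ⟨t, h⟩
    exact ⟨hsol univ fun t _ => hr t, global_solution_properties hf g₀ g₁ fun p => hr p.1 p.2⟩
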